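/- Let $k$ be an algebraically closed field, $R=k[x_0,x_1,x_2]$, and let $\lambda=[d_1,\dots,d_r]$ be a partition of $d=d_1+\cdots+d_r$ with $r\ge 2$ and $d_1\ge d_2\ge\cdots\ge d_r\ge 1$. Put $s=d_2+\cdots+d_r$ and $D=\sum_{1\le i<j\le r}d_id_j$. Let $\mathbb X_{2,\lambda}\subset\mathbb P(R_d)$ be the variety of classes $[F]$ of forms $F=F_1\cdots F_r$ with $F_i\in R_{d_i}$. For such a form with its factors, let $I_F\subset R$ be the ideal generated by $F/F_1,\dots,F/F_r$, and let $Y_F\subset\mathbb P^2$ be the scheme defined by $I_F$ (for a general point $[F]$, a set of $D$ points). For two general points $[F]=[F_1\cdots F_r]$ and $[G]=[G_1\cdots G_r]$ of $\mathbb X_{2,\lambda}$ (that is, for $(F_1,\dots,F_r,G_1,\dots,G_r)$ in a nonempty Zariski open subset of $\prod_i R_{d_i}\times\prod_i R_{d_i}$), let $Z=Y_F\cup Y_G$ be the scheme-theoretic union and let $I_Z\subset R$ be its homogeneous (saturated) ideal. Write $[d_1,\dots,d_r]\succeq[a_1,\dots,a_r]$ if $d_i\ge a_i$ for all $i$ (so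 both sides have the same number of entries). Suppose that $d_1<s$. Then: (i) $(I_Z)_d$ has the expected dimension, i.e. $$\dim_k (I_Z)_d=\max\left\{\binom{d+2}{2}-2D,\;0\right\}.$$ (ii) $(I_Z)_d=(0)$ if and only if one of the following holds: - $r=3$ and $[d_1,d_2,d_3]\succeq[4,3,3]$; - $r=3$ and $[d_1,d_2,d_3]\succeq[6,6,2]$; - $r=4$ and $[d_1,d_2,d_3,d_4]\succeq[4,4,1,1]$; - $r=4$ and $[d_1,d_2,d_3,d_4]\succeq[2,2,2,1]$; - $r=5$ and $[d_1,\dots,d_5]\succeq[2,1,1,1,1]$; - $r\ge 6$ (and then $[d_1,\dots,d_r]\succeq[1,\dots,1]$). -/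

import Mathlib

open MvPolynomial

namespace ReducibleCurves

/-- The form `F₁ ⋯ F_r` of a tuple of factors with the factor `F_i` left out, i.e. `F / F_i`. -/
noncomputable def cofactor {k : Type*} [Field k] {r : ℕ}
    (F : Fin r → MvPolynomial (Fin 3) k) (i : Fin r) : MvPolynomial (Fin 3) k :=
  ∏ j ∈ Finset.univ.erase i, F j

/-- The ideal `I_F` of `k[x₀, x₁, x₂]` generated by `F / F₁, …, F / F_r`. It defines the point
scheme `Y_F` in the projective plane. -/
noncomputable def cofactorIdeal {k : Type*} [Field k] {r : ℕ}
    (F : Fin r → MvPolynomial (Fin 3) k) : Ideal (MvPolynomial (Fin 3) k) :=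
  Ideal.span (Set.range (cofactor F))

/-- The ideal `(x₀, x₁, x₂)`. -/
noncomputable def irrelevantIdeal (k : Type*) [Field k] : Ideal (MvPolynomial (Fin 3) k) :=
  Ideal.span (Set.range X)

/-- The saturation of an ideal of `k[x₀, x₁, x₂]` with respect to `(x₀, x₁, x₂)`. For a homogeneous
ideal `I` it is the homogeneous ideal of the closed subscheme of the projective plane that is
defined by `I`. -/
def saturation {k : Type*} [Field k] (I : Ideal (MvPolynomial (Fin 3) k)) :
    Ideal (MvPolynomial (Fin 3) k) where
  carrier := {f | ∃ n : ℕ, ∀ g ∈ irrelevantIdeal k ^ n, g * f ∈ I}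
  zero_mem' := ⟨0, fun g _ => by simp⟩
  add_mem' := by
    rintro a b ⟨m, hm⟩ ⟨n, hn⟩
    refine ⟨max m n, fun g hg => ?_⟩
    rw [mul_add]
    exact I.add_mem (hm g (Ideal.pow_le_pow_right (le_max_left m n) hg))
      (hn g (Ideal.pow_le_pow_right (le_max_right m n) hg))
  smul_mem' := by
    rintro c f ⟨n, hn⟩
    refine ⟨n, fun g hg => ?_⟩
    rw [smul_eq_mul, mul_left_comm]
    exact I.mul_mem_left c (hn g hg)

/-- The homogeneous ideal `I_Z` of the scheme-theoretic union `Z = Y_F ∪ Y_G` in the projective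
plane of the schemes defined by `I_F` and `I_G`. -/
noncomputable def unionIdeal {k : Type*} [Field k] {r : ℕ}
    (F G : Fin r → MvPolynomial (Fin 3) k) : Ideal (MvPolynomial (Fin 3) k) :=
  saturation (cofactorIdeal F) ⊓ saturation (cofactorIdeal G)

/-- The degree `n` part `I_n` of an ideal `I` of `k[x₀, x₁, x₂]`, as a vector space over `k`. -/
noncomputable def degreePart {k : Type*} [Field k]
    (I : Ideal (MvPolynomial (Fin 3) k)) (n : ℕ) : Submodule k (MvPolynomial (Fin 3) k) :=
  I.restrictScalars k ⊓ homogeneousSubmodule (Fin 3) k n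

/-- The `F_i` are forms of degrees `d_i`. The points of the variety of reducible forms of type
`[d₁, …, d_r]` are the classes of the nonzero products `F₁ ⋯ F_r` of such tuples. -/
def IsFactorTuple {k : Type*} [Field k] {r : ℕ} (d : Fin r → ℕ)
    (F : Fin r → MvPolynomial (Fin 3) k) : Prop :=
  ∀ i, (F i).IsHomogeneous (d i)

/-- The coefficients of a pair of tuples of forms: the coordinates on the parameter space
`∏ R_{d_i} × ∏ R_{d_i}`. -/
noncomputable def coeffs {k : Type*} [Field k] {r : ℕ}
    (F G : Fin r → MvPolynomial (Fin 3) k) :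
    (Fin r × (Fin 3 →₀ ℕ)) ⊕ (Fin r × (Fin 3 →₀ ℕ)) → k :=
  Sum.elim (fun a => (F a.1).coeff a.2) (fun a => (G a.1).coeff a.2)

/-- The property `Q` holds for two general points `[F₁ ⋯ F_r]`, `[G₁ ⋯ G_r]` of the variety of
reducible forms of type `[d₁, …, d_r]`. This variety is the image, under multiplication, of the
irreducible space of tuples of forms of degrees `d_i`, so the condition is that `Q` holds on a
nonempty Zariski open subset of the space of pairs of such tuples; it suffices to consider the
basic open subsets, where one polynomial `P` in the coefficients of the `F_i` and `G_i` does not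
vanish. -/
def ForGeneralPair (k : Type*) [Field k] {r : ℕ} (d : Fin r → ℕ)
    (Q : (Fin r → MvPolynomial (Fin 3) k) → (Fin r → MvPolynomial (Fin 3) k) → Prop) : Prop :=
  ∃ P : MvPolynomial ((Fin r × (Fin 3 →₀ ℕ)) ⊕ (Fin r × (Fin 3 →₀ ℕ))) k,
    (∃ F G, IsFactorTuple d F ∧ IsFactorTuple d G ∧ eval (coeffs F G) P ≠ 0) ∧
    ∀ F G, IsFactorTuple d F → IsFactorTuple d G → eval (coeffs F G) P ≠ 0 → Q F G

/-- The number `D = ∑_{i < j} d_i d_j`. -/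
def pairSum {r : ℕ} (d : Fin r → ℕ) : ℕ :=
  ∑ i, ∑ j ∈ Finset.univ.filter (fun j => i < j), d i * d j

/-- The expected dimension `max {binom(|d| + 2, 2) - 2 D, 0}` of the degree `|d|` part of `I_Z`,
where `|d| = ∑ d_i`. -/
def expDim {r : ℕ} (d : Fin r → ℕ) : ℤ :=
  max (((((∑ i, d i) + 2).choose 2 : ℕ) : ℤ) - 2 * (pairSum d : ℤ)) 0

/-- `[d₁, …, d_r] ⪰ [a₁, …, a_r]`: both have the same number of entries and `a_i ≤ d_i`
for all `i`. -/
def Dominates {r : ℕ} (d : Fin r → ℕ) (a : List ℕ) : Prop :=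
  List.Forall₂ (fun x y => y ≤ x) (List.ofFn d) a

end ReducibleCurves

/-! When no two factors have a common divisor, `(I_F)_d` consists of the sums `∑ (F / F_i) H_i` with
`H_i ∈ R_{d_i}` (the image of `tangentMap`). The only relations are `H_i = c_i F_i` with `∑ c_i =
0`, so the codimension in `R_d` is `D`. For general `F` the ideal `I_F` is saturated, because `x₀`
is a non-zero-divisor modulo it. Hence `(I_Z)_d` is the intersection of two such images, and linear
algebra gives `dim ≥ binom(d + 2, 2) - 2 D`. By semicontinuity the matching upper bound has to be
found for one special pair only.

The special pair consists of products of lines: `d_i` lines of colour `i` in each of two families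
`a`, `b`. Forms in both images vanish at the intersection points of lines of different colours, and
the space of forms of degree `d` with these zeros is bounded by induction on the number of lines.
Take `e` lines per family, `n` of them of colour `i`, and add one line `L` of colour `i` to both
families. It carries `2 (e - n)` new points. If `e + 2` of them are distinct, a form of degree `e +
1` with these zeros is divisible by `L`, and the quotient belongs to the old configuration. If `L`
passes through a point of `a_j ∩ b_l`, two of the points collide. Moving one copy of `L` shows that
the limit condition is a derivative, which becomes vanishing of the quotient at that point
(`LinesBound.add_line_aux`). Points where some remaining form is nonzero exist, since otherwise too
many lines would divide it (`eq_zero_of_eval_cross`). So the dimension drops by one or two.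

Such a step changes the virtual dimension by `2 n + 2 - e`. Chains of steps keep the bound equal to
the virtual dimension until it reaches zero. From the minimal types, vanishing spreads to all larger
types with `d_1 < s` (`TypeBound.of_le`), because this inequality leaves enough points on a general
new line. The few families of types left over have positive virtual dimension. -/

namespace ReducibleCurves

open Matrix

/-! ### Linear forms and restriction of forms to lines -/

section Forms

variable {k : Type*} [Field k]

/-- Allows the coefficients in an ideal membership of a form to be replaced by their components of
the right degree. -/
theorem homogeneousComponent_mul_of_isHomogeneous {σ R : Type*} [CommSemiring R]
    {g : MvPolynomial σ R} {e : ℕ} (hg : g.IsHomogeneous e) (K : MvPolynomial σ R) (n : ℕ) :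
    homogeneousComponent (n + e) (g * K) = g * homogeneousComponent n K := by
  let _ := MvPolynomial.gradedAlgebra (σ := σ) (R := R)
  have h := DirectSum.coe_decompose_mul_of_left_mem_of_le (homogeneousSubmodule σ R)
    (a := g) (b := K) (i := e) (n := n + e) hg (Nat.le_add_left _ _)
  rw [Nat.add_sub_cancel] at h
  have h2 : ∀ (m : ℕ) (φ : MvPolynomial σ R),
      ((DirectSum.decompose (homogeneousSubmodule σ R) φ m : homogeneousSubmodule σ R m) :
        MvPolynomial σ R) = homogeneousComponent m φ :=
    fun m φ => decomposition.decompose'_apply φ m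
  rwa [h2, h2] at h

theorem mem_finsuppAntidiag_iff_degree (n : ℕ) (α : Fin 3 →₀ ℕ) :
    α ∈ (Finset.univ : Finset (Fin 3)).finsuppAntidiag n ↔ α.degree = n := by
  rw [Finset.mem_finsuppAntidiag, Finsupp.degree_eq_sum]
  simp

theorem finrank_homogeneousSubmodule (n : ℕ) :
    Module.finrank k (homogeneousSubmodule (Fin 3) k n) = (n + 2).choose 2 := by
  have hset : {d : Fin 3 →₀ ℕ | d.degree = n}
      = ((Finset.univ : Finset (Fin 3)).finsuppAntidiag n : Set (Fin 3 →₀ ℕ)) := by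
    ext α
    simp [← mem_finsuppAntidiag_iff_degree]
  rw [homogeneousSubmodule_eq_finsupp_supported, hset]
  have e := (AddMonoidAlgebra.supportedEquivFinsupp (R := k) (S := k)
    ((Finset.univ : Finset (Fin 3)).finsuppAntidiag n : Set (Fin 3 →₀ ℕ)))
  rw [e.finrank_eq]
  simp [Finset.card_finsuppAntidiag_nat_eq_choose]
  rw [add_comm 2 n, Nat.choose_symm_add]

instance finite_homogeneousSubmodule (n : ℕ) :
    Module.Finite k (homogeneousSubmodule (Fin 3) k n) :=
  Module.Finite.iff_fg.mpr (homogeneousSubmodule_fg _ _ n)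

/-- The linear form with coefficient vector `a`. -/
noncomputable def lin (a : Fin 3 → k) : MvPolynomial (Fin 3) k := ∑ i, C (a i) * X i

theorem eval_lin (a p : Fin 3 → k) : eval p (lin a) = a ⬝ᵥ p := by
  simp [lin, dotProduct]

theorem lin_isHomogeneous (a : Fin 3 → k) : (lin a).IsHomogeneous 1 :=
  IsHomogeneous.sum _ _ _ fun _ _ => isHomogeneous_C_mul_X _ _

theorem exists_dotProduct_eq_one {a : Fin 3 → k} (ha : a ≠ 0) : ∃ w, a ⬝ᵥ w = 1 := by
  obtain ⟨i, hi⟩ := Function.ne_iff.mp ha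
  exact ⟨Pi.single i (a i)⁻¹, by simpa using mul_inv_cancel₀ hi⟩

theorem lin_ne_zero {a : Fin 3 → k} (ha : a ≠ 0) : lin a ≠ 0 := by
  obtain ⟨w, hw⟩ := exists_dotProduct_eq_one ha
  intro h
  have := eval_lin a w
  rw [h, hw] at this
  simp at this

/-- Projection of forms onto the line `a` along the vector `w`. -/
noncomputable def lineProj (a w : Fin 3 → k) : MvPolynomial (Fin 3) k →ₐ[k] MvPolynomial (Fin 3) k :=
  aeval fun j => X j - C (w j) * lin a

theorem eval_lineProj (a w p : Fin 3 → k) (f : MvPolynomial (Fin 3) k) :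
    eval p (lineProj a w f) = eval (p - (a ⬝ᵥ p) • w) f := by
  have : (aeval p : MvPolynomial (Fin 3) k →ₐ[k] k).comp (lineProj a w)
      = aeval (p - (a ⬝ᵥ p) • w) := by
    apply MvPolynomial.algHom_ext
    intro j
    simp [lineProj, aeval_eq_eval, eval_lin, mul_comm]
  simpa [aeval_eq_eval] using congrArg (fun φ => φ f) this

theorem lin_dvd_sub_lineProj (a w : Fin 3 → k) (f : MvPolynomial (Fin 3) k) :
    lin a ∣ f - lineProj a w f := by
  rw [← Ideal.mem_span_singleton, ← Ideal.Quotient.eq]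
  have : (Ideal.Quotient.mkₐ k (Ideal.span {lin a}))
      = (Ideal.Quotient.mkₐ k (Ideal.span {lin a})).comp (lineProj a w) := by
    apply MvPolynomial.algHom_ext
    intro j
    simp only [lineProj, AlgHom.comp_apply, aeval_X, Ideal.Quotient.mkₐ_eq_mk]
    rw [Ideal.Quotient.eq, Ideal.mem_span_singleton]
    simp
  exact congrArg (fun φ => φ f) this

theorem lineProj_lin {a w : Fin 3 → k} (h : a ⬝ᵥ w = 1) : lineProj a w (lin a) = 0 := by
  have : ∀ b : Fin 3 → k, lineProj a w (lin b) = lin b - C (b ⬝ᵥ w) * lin a := by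
    intro b
    have hC : ∀ x, lineProj a w (C x) = C x := fun x => by simp [lineProj]
    simp only [lin, map_sum, map_mul, hC, dotProduct]
    rw [Finset.sum_mul, ← Finset.sum_sub_distrib]
    refine Finset.sum_congr rfl fun i _ => ?_
    simp only [lineProj, aeval_X, lin, Finset.mul_sum]
    rw [mul_sub, Finset.mul_sum]
    congr 1
    exact Finset.sum_congr rfl fun _ _ => by ring
  rw [this, h]
  simp

theorem lin_dvd_iff_lineProj {a w : Fin 3 → k} (h : a ⬝ᵥ w = 1) (f : MvPolynomial (Fin 3) k) :
    lin a ∣ f ↔ lineProj a w f = 0 := by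
  constructor
  · rintro ⟨g, rfl⟩
    rw [map_mul, lineProj_lin h, zero_mul]
  · intro hf
    simpa [hf] using lin_dvd_sub_lineProj a w f

/-- The projection along `w` takes values in the line, so `lineProj a w f` is zero as a function,
hence as a polynomial. -/
theorem lin_dvd_of_forall_eval [Infinite k] {a : Fin 3 → k} (ha : a ≠ 0)
    {f : MvPolynomial (Fin 3) k} (hf : ∀ p, a ⬝ᵥ p = 0 → eval p f = 0) : lin a ∣ f := by
  obtain ⟨w, hw⟩ := exists_dotProduct_eq_one ha
  rw [lin_dvd_iff_lineProj hw]
  apply MvPolynomial.funext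
  intro p
  rw [eval_lineProj, map_zero]
  apply hf
  simp [dotProduct_sub, hw]

/-- Divisibility by `lin a` is vanishing under the homomorphism `lineProj a w` into a domain. -/
theorem prime_lin {a : Fin 3 → k} (ha : a ≠ 0) : Prime (lin a) := by
  obtain ⟨w, hw⟩ := exists_dotProduct_eq_one ha
  refine ⟨lin_ne_zero ha, fun h => ?_, fun f g h => ?_⟩
  · have := h.map (eval (0 : Fin 3 → k))
    rw [eval_lin] at this
    simp at this
  · rw [lin_dvd_iff_lineProj hw, map_mul] at h
    rw [lin_dvd_iff_lineProj hw, lin_dvd_iff_lineProj hw]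
    exact mul_eq_zero.mp h

theorem isRelPrime_lin {a b : Fin 3 → k} (hab : a ⨯₃ b ≠ 0) : IsRelPrime (lin a) (lin b) := by
  have ha : a ≠ 0 := by rintro rfl; simp at hab
  rw [(prime_lin ha).irreducible.isRelPrime_iff_not_dvd]
  rintro ⟨g, hg⟩
  apply hab
  have h : ∀ p, a ⬝ᵥ p = 0 → b ⬝ᵥ p = 0 := by
    intro p hp
    rw [← eval_lin, hg, map_mul, eval_lin, hp, zero_mul]
  have h0 := h ![a 1, -a 0, 0] (by simp [dotProduct, Fin.sum_univ_three]; ring)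
  have h1 := h ![a 2, 0, -a 0] (by simp [dotProduct, Fin.sum_univ_three]; ring)
  have h2 := h ![0, a 2, -a 1] (by simp [dotProduct, Fin.sum_univ_three]; ring)
  simp only [dotProduct, Fin.sum_univ_three] at h0 h1 h2
  rw [cross_apply]
  ext i
  fin_cases i <;> simp at h0 h1 h2 ⊢ <;> first | linear_combination h0 | linear_combination -h0 | linear_combination h1 | linear_combination -h1 | linear_combination h2 | linear_combination -h2

theorem eval_smul_of_isHomogeneous {f : MvPolynomial (Fin 3) k} {n : ℕ} (hf : f.IsHomogeneous n)
    (t : k) (p : Fin 3 → k) : eval (t • p) f = t ^ n * eval p f := by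
  rw [eval_eq, eval_eq, Finset.mul_sum]
  refine Finset.sum_congr rfl fun α hα => ?_
  have h := hf.degree_eq_sum_deg_support hα
  simp only [Pi.smul_apply, smul_eq_mul, mul_pow, Finset.prod_mul_distrib]
  rw [Finset.prod_pow_eq_pow_sum, h]
  ring

/-- Restriction of a polynomial to the affine line through `p` with direction `v`. -/
noncomputable def restrictLine (p v : Fin 3 → k) : MvPolynomial (Fin 3) k →ₐ[k] Polynomial k :=
  aeval fun i => Polynomial.C (p i) + Polynomial.X * Polynomial.C (v i)

theorem eval_restrictLine (p v : Fin 3 → k) (t : k) (f : MvPolynomial (Fin 3) k) :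
    (restrictLine p v f).eval t = eval (p + t • v) f := by
  have : (Polynomial.aeval t).comp (restrictLine p v) = (aeval (p + t • v)) := by
    apply MvPolynomial.algHom_ext
    intro j
    simp only [restrictLine, AlgHom.comp_apply, aeval_X, map_add, map_mul, Polynomial.aeval_C,
      Polynomial.aeval_X, Algebra.algebraMap_self, RingHom.id_apply, Pi.add_apply, Pi.smul_apply,
      smul_eq_mul]
  simpa [aeval_eq_eval, Polynomial.aeval_def] using congrArg (fun φ => φ f) this

theorem restrictLine_lin (p v a : Fin 3 → k) :
    restrictLine p v (lin a) = Polynomial.C (a ⬝ᵥ p) + Polynomial.X * Polynomial.C (a ⬝ᵥ v) := by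
  simp only [lin, restrictLine, map_sum, map_mul, aeval_X, aeval_C, dotProduct,
    Finset.mul_sum, ← Finset.sum_add_distrib, Polynomial.algebraMap_eq]
  exact Finset.sum_congr rfl fun i _ => by ring

theorem natDegree_restrictLine_le {f : MvPolynomial (Fin 3) k} {n : ℕ} (hf : f.IsHomogeneous n)
    (p v : Fin 3 → k) : (restrictLine p v f).natDegree ≤ n := by
  have := aeval_natDegree_le (n := 1) f hf.totalDegree_le
    (fun i => Polynomial.C (p i) + Polynomial.X * Polynomial.C (v i)) (fun i => by compute_degree)
  simpa [restrictLine] using this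

end Forms

end ReducibleCurves

namespace ReducibleCurves

open Matrix

/-! ### Semicontinuity of kernel dimensions -/

section Semicontinuity

variable {k V A κ : Type*} [Field k] [AddCommGroup V] [Module k V] [CommRing A] [Algebra k A]

/-- The common kernel of a family of `A`-valued functionals, specialized along `ε : A → k`. -/
def commonKer (φ : κ → V →ₗ[k] A) (ε : A →ₐ[k] k) : Submodule k V :=
  ⨅ i, LinearMap.ker (ε.toLinearMap ∘ₗ φ i)

theorem mem_commonKer {φ : κ → V →ₗ[k] A} {ε : A →ₐ[k] k} {v : V} :
    v ∈ commonKer φ ε ↔ ∀ i, ε (φ i v) = 0 := by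
  simp [commonKer]

/-- The dimension of the common kernel is upper semicontinuous. -/
theorem exists_finrank_commonKer_le [Finite κ] [Module.Finite k V] (φ : κ → V →ₗ[k] A)
    (ε₀ : A →ₐ[k] k) {m : ℕ} (hm : Module.finrank k (commonKer φ ε₀) ≤ m) :
    ∃ P : A, ε₀ P ≠ 0 ∧ ∀ ε : A →ₐ[k] k, ε P ≠ 0 → Module.finrank k (commonKer φ ε) ≤ m := by
  classical
  have := Fintype.ofFinite κ
  -- On a complement `W` of the special kernel the functionals at `ε₀` are jointly injective.
  -- Composing with a left inverse `g` gives an endomorphism of `W` whose determinant is the wanted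
  -- `P`. Where it is nonzero, the kernel meets `W` trivially.
  obtain ⟨W, hW⟩ := Submodule.exists_isCompl (commonKer φ ε₀)
  let b := Module.finBasis k W
  let ψ : (A →ₐ[k] k) → W →ₗ[k] (κ → k) := fun ε =>
    LinearMap.pi fun i => (ε.toLinearMap ∘ₗ φ i) ∘ₗ W.subtype
  have hψ : ∀ (ε : A →ₐ[k] k) (w : W), ψ ε w = 0 ↔ (w : V) ∈ commonKer φ ε := by
    intro ε w
    rw [mem_commonKer, funext_iff]
    rfl
  have hinj : LinearMap.ker (ψ ε₀) = ⊥ := by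
    rw [LinearMap.ker_eq_bot']
    intro w hw
    rw [hψ] at hw
    exact Subtype.ext (Submodule.disjoint_def.mp hW.disjoint _ hw w.2)
  obtain ⟨g, hg⟩ := LinearMap.exists_leftInverse_of_injective _ hinj
  let B : Matrix (Fin (Module.finrank k W)) κ k := fun i c => b.repr (g (Pi.single c 1)) i
  let Q : Matrix (Fin (Module.finrank k W)) (Fin (Module.finrank k W)) A :=
    fun i j => ∑ c, algebraMap k A (B i c) * φ c (b j)
  have hdet : ∀ ε : A →ₐ[k] k, ε Q.det = LinearMap.det (g ∘ₗ ψ ε) := by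
    intro ε
    rw [AlgHom.map_det, ← LinearMap.det_toMatrix b]
    congr 1
    ext i j
    rw [LinearMap.toMatrix_apply, LinearMap.comp_apply]
    have h1 : ψ ε (b j) = ∑ c, ε (φ c (b j)) • Pi.single c (1 : k) := by
      ext c
      simp [Finset.sum_apply, Pi.single_apply, ψ]
    rw [h1]
    change ε (Q i j) = _
    simp only [Q, B, map_sum, map_mul, map_smul,
      AlgHom.commutes, Finsupp.coe_finsetSum, Finset.sum_apply, Finsupp.smul_apply, smul_eq_mul,
      Algebra.algebraMap_self, RingHom.id_apply]
    exact Finset.sum_congr rfl fun _ _ => mul_comm _ _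
  refine ⟨Q.det, ?_, fun ε hε => ?_⟩
  · rw [hdet, hg, LinearMap.det_id]
    exact one_ne_zero
  · rw [hdet] at hε
    have hbij : Function.Injective (g ∘ₗ ψ ε) :=
      (LinearMap.equivOfDetNeZero (g ∘ₗ ψ ε) hε).injective
    have hdis : Disjoint (commonKer φ ε) W := by
      rw [Submodule.disjoint_def]
      intro v hv hvW
      have h0 : ψ ε ⟨v, hvW⟩ = 0 := (hψ ε ⟨v, hvW⟩).mpr hv
      have : (g ∘ₗ ψ ε) ⟨v, hvW⟩ = (g ∘ₗ ψ ε) 0 := by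
        rw [LinearMap.comp_apply, h0, map_zero, map_zero]
      exact congrArg Subtype.val (hbij this)
    have h1 := Submodule.finrank_add_finrank_le_of_disjoint hdis
    have h2 := Submodule.finrank_add_eq_of_isCompl hW
    omega

theorem finrank_le_finrank_inf_add {ε : ℕ} [Module.Finite k V] (K : Submodule k V)
    (ψ : Fin ε → V →ₗ[k] k) :
    Module.finrank k K ≤
      Module.finrank k (K ⊓ ⨅ i, LinearMap.ker (ψ i) : Submodule k V) + ε := by
  have h := LinearMap.finrank_range_add_finrank_ker ((LinearMap.pi ψ).domRestrict K)
  have h1 := Submodule.finrank_le (LinearMap.range ((LinearMap.pi ψ).domRestrict K))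
  have h2 : Module.finrank k (LinearMap.ker ((LinearMap.pi ψ).domRestrict K)) ≤
      Module.finrank k (K ⊓ ⨅ i, LinearMap.ker (ψ i) : Submodule k V) := by
    rw [← LinearMap.ker_pi]
    refine LinearMap.finrank_le_finrank_of_injective
      (f := LinearMap.restrict (p := LinearMap.ker ((LinearMap.pi ψ).domRestrict K))
        (q := K ⊓ LinearMap.ker (LinearMap.pi ψ)) K.subtype ?_) ?_
    · intro x hx
      exact ⟨x.2, hx⟩
    · intro x y hxy
      exact Subtype.ext (Subtype.ext (congrArg
        (fun z : (K ⊓ LinearMap.ker (LinearMap.pi ψ) : Submodule k V) => (z : V)) hxy))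
  rw [Module.finrank_fin_fun] at h1
  omega

end Semicontinuity

/-! ### Forms with many zeros on a line -/

section Lines

variable {k : Type*} [Field k]

theorem exists_smul_of_cross_eq_zero {u v : Fin 3 → k} (hu : u ≠ 0) (h : u ⨯₃ v = 0) :
    ∃ t : k, v = t • u := by
  obtain ⟨w, hw⟩ := exists_dotProduct_eq_one hu
  refine ⟨w ⬝ᵥ v, ?_⟩
  have h1 := cross_cross_eq_smul_sub_smul' w u v
  rw [h, hw] at h1
  simp only [map_zero, one_smul] at h1
  exact (sub_eq_zero.mp h1.symm).symm

theorem exists_eq_cross {L p : Fin 3 → k} (hL : L ≠ 0) (hp : L ⬝ᵥ p = 0) : ∃ y, p = L ⨯₃ y := by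
  obtain ⟨w, hw⟩ := exists_dotProduct_eq_one hL
  refine ⟨p ⨯₃ w, ?_⟩
  rw [cross_cross_eq_smul_sub_smul', hw, dotProduct_comm p, hp]
  simp

theorem cross_cross_cross (L x y : Fin 3 → k) :
    (L ⨯₃ x) ⨯₃ (L ⨯₃ y) = (L ⬝ᵥ x ⨯₃ y) • L := by
  simp only [cross_apply, dotProduct, Fin.sum_univ_three]
  ext i
  fin_cases i <;> simp <;> ring

theorem cross_linear_relation (L x y z : Fin 3 → k) :
    (L ⬝ᵥ x ⨯₃ y) • (L ⨯₃ z) = (L ⬝ᵥ z ⨯₃ y) • (L ⨯₃ x) + (L ⬝ᵥ x ⨯₃ z) • (L ⨯₃ y) := by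
  simp only [cross_apply, dotProduct, Fin.sum_univ_three]
  ext i
  fin_cases i <;> simp <;> ring

/-- A Plücker relation for points of the line `L`; it makes the parameters in
`lin_dvd_of_eval_cross` distinct. -/
theorem triple_product_pluecker (L x y u v : Fin 3 → k) :
    (L ⬝ᵥ x ⨯₃ u) * (L ⬝ᵥ v ⨯₃ y) - (L ⬝ᵥ x ⨯₃ v) * (L ⬝ᵥ u ⨯₃ y) =
      - ((L ⬝ᵥ x ⨯₃ y) * (L ⬝ᵥ u ⨯₃ v)) := by
  simp only [cross_apply, dotProduct, Fin.sum_univ_three]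
  simp
  ring

/-- A form of degree `n` that vanishes at `n + 1` points of a line vanishes on the line. -/
theorem lin_dvd_of_eval_cross [Infinite k] {J : Type*} [Fintype J] {L : Fin 3 → k} (hL : L ≠ 0)
    (x : J → Fin 3 → k) (hx : ∀ i j, i ≠ j → L ⬝ᵥ x i ⨯₃ x j ≠ 0) {n : ℕ} (hn : 1 ≤ n)
    {f : MvPolynomial (Fin 3) k} (hf : f.IsHomogeneous n) (hcard : n + 1 ≤ Fintype.card J)
    (h0 : ∀ j, eval (L ⨯₃ x j) f = 0) : lin L ∣ f := by
  apply lin_dvd_of_forall_eval hL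
  intro p hp
  obtain ⟨y, rfl⟩ := exists_eq_cross hL hp
  by_cases hy : ∃ j, L ⬝ᵥ x j ⨯₃ y = 0
  · obtain ⟨j, hj⟩ := hy
    have hne : L ⨯₃ x j ≠ 0 := by
      have : 1 < Fintype.card J := by omega
      obtain ⟨i, hi⟩ := Fintype.exists_ne_of_one_lt_card this j
      intro h
      apply hx j i hi.symm
      rw [triple_product_permutation, triple_product_permutation, h, dotProduct_zero]
    have hc : (L ⨯₃ x j) ⨯₃ (L ⨯₃ y) = 0 := by rw [cross_cross_cross, hj, zero_smul]
    obtain ⟨t, ht⟩ := exists_smul_of_cross_eq_zero hne hc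
    rw [ht, eval_smul_of_isHomogeneous hf, h0, mul_zero]
  push Not at hy
  have : Nonempty J := Fintype.card_pos_iff.mp (by omega)
  obtain ⟨o⟩ := this
  -- The point `L ⨯₃ x j` has the displayed quotient as its affine parameter, so the restriction of
  -- `f` has more zeros than its degree allows.
  have hzero : restrictLine (L ⨯₃ x o) (L ⨯₃ y) f = 0 := by
    refine Polynomial.eq_zero_of_natDegree_lt_card_of_eval_eq_zero _
      (f := fun j => (L ⬝ᵥ x o ⨯₃ x j) / (L ⬝ᵥ x j ⨯₃ y)) ?_ ?_ ?_
    · intro i j hij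
      by_contra hne
      have hij' : (L ⬝ᵥ x o ⨯₃ x i) * (L ⬝ᵥ x j ⨯₃ y) = (L ⬝ᵥ x o ⨯₃ x j) * (L ⬝ᵥ x i ⨯₃ y) :=
        (div_eq_div_iff (hy i) (hy j)).mp hij
      have := triple_product_pluecker L (x o) y (x i) (x j)
      rw [hij', sub_self, zero_eq_neg] at this
      exact mul_ne_zero (hy o) (hx i j hne) this
    · intro j
      rw [eval_restrictLine]
      have h := cross_linear_relation L (x o) y (x j)
      have h2 : L ⨯₃ x o + ((L ⬝ᵥ x o ⨯₃ x j) / (L ⬝ᵥ x j ⨯₃ y)) • (L ⨯₃ y) =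
          ((L ⬝ᵥ x j ⨯₃ y)⁻¹ * (L ⬝ᵥ x o ⨯₃ y)) • (L ⨯₃ x j) := by
        rw [mul_smul, h, smul_add, smul_smul, smul_smul, inv_mul_cancel₀ (hy j), one_smul,
          div_eq_inv_mul]
      rw [h2, eval_smul_of_isHomogeneous hf, h0, mul_zero]
    · exact lt_of_le_of_lt (natDegree_restrictLine_le hf _ _) hcard
  -- `L ⨯₃ y` is the point at infinity of this parametrization. Exchanging base point and direction
  -- moves it to parameter `0`, the one value that the first parametrization misses and that the
  -- factor `X` absorbs.
  have hrev : Polynomial.X * restrictLine (L ⨯₃ y) (L ⨯₃ x o) f = 0 := by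
    apply Polynomial.funext
    intro t
    rw [Polynomial.eval_mul, Polynomial.eval_X, Polynomial.eval_zero, eval_restrictLine]
    rcases eq_or_ne t 0 with rfl | ht
    · rw [zero_mul]
    · have : L ⨯₃ y + t • (L ⨯₃ x o) = t • (L ⨯₃ x o + t⁻¹ • (L ⨯₃ y)) := by
        rw [smul_add, smul_smul, mul_inv_cancel₀ ht, one_smul, add_comm]
      rw [this, eval_smul_of_isHomogeneous hf, ← eval_restrictLine, hzero]
      simp
  have hrev' := (mul_eq_zero.mp hrev).resolve_left Polynomial.X_ne_zero
  have := eval_restrictLine (L ⨯₃ y) (L ⨯₃ x o) 0 f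
  rw [hrev'] at this
  simpa using this.symm

end Lines

end ReducibleCurves

namespace ReducibleCurves

open Matrix

/-! ### Coloured line configurations in general position -/

section Configurations

variable {k : Type*} [Field k] {ι γ κ : Type*}

/-- The intersection points of pairs of lines of different colours. -/
def crossPoints (c : ι → γ) (a : ι → Fin 3 → k) : Set (Fin 3 → k) :=
  {p | ∃ i j, c i ≠ c j ∧ p = a i ⨯₃ a j}

/-- The forms of degree `n` that vanish on `S`. -/
def vanishingForms (n : ℕ) (S : Set (Fin 3 → k)) :
    Submodule k (homogeneousSubmodule (Fin 3) k n) where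
  carrier := {f | ∀ p ∈ S, eval p (f : MvPolynomial (Fin 3) k) = 0}
  zero_mem' := by simp
  add_mem' := by
    intro f g hf hg p hp
    simp [hf p hp, hg p hp]
  smul_mem' := by
    intro t f hf p hp
    simp [hf p hp]

theorem mem_vanishingForms {n : ℕ} {S : Set (Fin 3 → k)} {f : homogeneousSubmodule (Fin 3) k n} :
    f ∈ vanishingForms n S ↔ ∀ p ∈ S, eval p (f : MvPolynomial (Fin 3) k) = 0 := Iff.rfl

variable (k) in
/-- For some pair of families of lines coloured by `c`, the forms that vanish at all the
intersection points of lines of different colours of each family have dimension at most `m`. -/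
def LinesBound [Fintype ι] (c : ι → γ) (m : ℕ) : Prop :=
  ∃ a b : ι → Fin 3 → k, Module.finrank k
    (vanishingForms (Fintype.card ι) (crossPoints c a ∪ crossPoints c b)) ≤ m

theorem LinesBound.mono [Fintype ι] {c : ι → γ} {m m' : ℕ} (h : LinesBound k c m) (hm : m ≤ m') :
    LinesBound k c m' := by
  obtain ⟨a, b, hab⟩ := h
  exact ⟨a, b, hab.trans hm⟩

/-- No three lines are concurrent, the intersection points of three disjoint pairs are not
collinear, and no intersection point lies on `x₀ = 0`. The last condition serves the saturation
argument. -/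
structure GeneralPosition (x : κ → Fin 3 → k) : Prop where
  three : ∀ g : Fin 3 ↪ κ, x (g 0) ⬝ᵥ x (g 1) ⨯₃ x (g 2) ≠ 0
  six : ∀ g : Fin 6 ↪ κ, ((x (g 0) ⨯₃ x (g 1)) ⨯₃ (x (g 2) ⨯₃ x (g 3))) ⬝ᵥ
    (x (g 4) ⨯₃ x (g 5)) ≠ 0
  two : ∀ g : Fin 2 ↪ κ, (x (g 0) ⨯₃ x (g 1)) 0 ≠ 0

theorem GeneralPosition.triple {x : κ → Fin 3 → k} (h : GeneralPosition x) {u v w : κ}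
    (huv : u ≠ v) (huw : u ≠ w) (hvw : v ≠ w) : x u ⬝ᵥ x v ⨯₃ x w ≠ 0 := by
  have hinj : Function.Injective ![u, v, w] := by
    intro i j
    fin_cases i <;> fin_cases j <;> simp [huv, huw, hvw, huv.symm, huw.symm, hvw.symm]
  exact h.three ⟨_, hinj⟩

theorem GeneralPosition.cross_zero {x : κ → Fin 3 → k} (h : GeneralPosition x) {u v : κ}
    (huv : u ≠ v) : (x u ⨯₃ x v) 0 ≠ 0 := by
  have hinj : Function.Injective ![u, v] := by
    intro i j
    fin_cases i <;> fin_cases j <;> simp [huv, huv.symm]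
  exact h.two ⟨_, hinj⟩

theorem GeneralPosition.cross_ne_zero {x : κ → Fin 3 → k} (h : GeneralPosition x) {u v : κ}
    (huv : u ≠ v) : x u ⨯₃ x v ≠ 0 :=
  fun h0 => h.cross_zero huv (by rw [h0]; rfl)

/-- Coordinates of a generic family of vectors. -/
noncomputable def genericVector (k : Type*) [Field k] (u : κ) :
    Fin 3 → MvPolynomial (κ × Fin 3) k := fun j => X (u, j)

theorem eval_genericVector (x : κ → Fin 3 → k) (u : κ) (j : Fin 3) :
    eval (fun p : κ × Fin 3 => x p.1 p.2) (genericVector k u j) = x u j := by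
  simp [genericVector]

/-- Each condition is the nonvanishing of a nonzero polynomial. There are finitely many embeddings
of the indices, so over an infinite field all conditions hold at once somewhere. -/
theorem exists_generic_avoiding [Infinite k] [Finite κ] {P : MvPolynomial (κ × Fin 3) k}
    (hP : P ≠ 0) : ∃ x : κ → Fin 3 → k, aeval (fun p : κ × Fin 3 => x p.1 p.2) P ≠ 0 ∧
      GeneralPosition x := by
  classical
  have := Fintype.ofFinite κ
  let Φ3 : MvPolynomial (Fin 3 × Fin 3) k :=
    genericVector k 0 ⬝ᵥ genericVector k 1 ⨯₃ genericVector k 2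
  let Φ6 : MvPolynomial (Fin 6 × Fin 3) k :=
    ((genericVector k 0 ⨯₃ genericVector k 1) ⨯₃ (genericVector k 2 ⨯₃ genericVector k 3)) ⬝ᵥ
      (genericVector k 4 ⨯₃ genericVector k 5)
  let Φ2 : MvPolynomial (Fin 2 × Fin 3) k := (genericVector k 0 ⨯₃ genericVector k 1) 0
  have e3 : ∀ y : Fin 3 → Fin 3 → k, aeval (fun p : Fin 3 × Fin 3 => y p.1 p.2) Φ3 =
      y 0 ⬝ᵥ y 1 ⨯₃ y 2 := by
    intro y
    simp [Φ3, dotProduct, Fin.sum_univ_three, cross_apply, eval_genericVector]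
  have e6 : ∀ y : Fin 6 → Fin 3 → k, aeval (fun p : Fin 6 × Fin 3 => y p.1 p.2) Φ6 =
      ((y 0 ⨯₃ y 1) ⨯₃ (y 2 ⨯₃ y 3)) ⬝ᵥ (y 4 ⨯₃ y 5) := by
    intro y
    simp [Φ6, dotProduct, Fin.sum_univ_three, cross_apply, eval_genericVector]
  have e2 : ∀ y : Fin 2 → Fin 3 → k, aeval (fun p : Fin 2 × Fin 3 => y p.1 p.2) Φ2 =
      (y 0 ⨯₃ y 1) 0 := by
    intro y
    simp [Φ2, cross_apply, eval_genericVector]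
  have n3 : Φ3 ≠ 0 := by
    intro h
    have := e3 ![![1, 0, 0], ![0, 1, 0], ![0, 0, 1]]
    rw [h] at this
    simp [dotProduct, Fin.sum_univ_three, cross_apply] at this
  have n6 : Φ6 ≠ 0 := by
    intro h
    -- The three pairs of coordinate lines meet in the vertices of the coordinate triangle.
    have := e6 ![![0, 1, 0], ![0, 0, 1], ![0, 0, 1], ![1, 0, 0], ![1, 0, 0], ![0, 1, 0]]
    rw [h] at this
    simp [dotProduct, Fin.sum_univ_three, cross_apply] at this
  have n2 : Φ2 ≠ 0 := by
    intro h
    have := e2 ![![0, 1, 0], ![0, 0, 1]]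
    rw [h] at this
    simp [cross_apply] at this
  have key : ∀ (n : ℕ) (Φ : MvPolynomial (Fin n × Fin 3) k), Φ ≠ 0 →
      (∏ g : Fin n ↪ κ, rename (Prod.map g id) Φ) ≠ 0 := by
    intro n Φ hΦ
    refine Finset.prod_ne_zero_iff.mpr fun g _ => ?_
    rw [Ne, map_eq_zero_iff _ (rename_injective _ (g.injective.prodMap Function.injective_id))]
    exact hΦ
  have hne := mul_ne_zero hP (mul_ne_zero (key 3 Φ3 n3) (mul_ne_zero (key 6 Φ6 n6) (key 2 Φ2 n2)))
  obtain ⟨z, hz⟩ : ∃ z : κ × Fin 3 → k, eval z (P * ((∏ g : Fin 3 ↪ κ, rename (Prod.map g id) Φ3) *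
      ((∏ g : Fin 6 ↪ κ, rename (Prod.map g id) Φ6) *
        (∏ g : Fin 2 ↪ κ, rename (Prod.map g id) Φ2)))) ≠ 0 := by
    by_contra hcon
    push Not at hcon
    exact hne (MvPolynomial.funext fun z => by rw [hcon z, map_zero])
  simp only [map_mul, map_prod, mul_ne_zero_iff, Finset.prod_ne_zero_iff, eval_rename] at hz
  obtain ⟨h1, h3, h6, h2⟩ := hz
  refine ⟨fun u j => z (u, j), ?_, ⟨fun g => ?_, fun g => ?_, fun g => ?_⟩⟩
  · simpa [aeval_eq_eval] using h1
  · rw [← e3 fun i j => z (g i, j)]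
    exact h3 g (Finset.mem_univ _)
  · rw [← e6 fun i j => z (g i, j)]
    exact h6 g (Finset.mem_univ _)
  · rw [← e2 fun i j => z (g i, j)]
    exact h2 g (Finset.mem_univ _)

theorem exists_vector_avoiding [Infinite k] [Finite κ] (v : κ → Fin 3 → k) (hv : ∀ i, v i ≠ 0) :
    ∃ w : Fin 3 → k, ∀ i, w ⬝ᵥ v i ≠ 0 := by
  have := Fintype.ofFinite κ
  have hne : ∏ i, lin (v i) ≠ 0 := Finset.prod_ne_zero_iff.mpr fun i _ => lin_ne_zero (hv i)
  obtain ⟨z, hz⟩ : ∃ z : Fin 3 → k, eval z (∏ i, lin (v i)) ≠ 0 := by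
    by_contra hcon
    push Not at hcon
    exact hne (MvPolynomial.funext fun z => by rw [hcon z, map_zero])
  rw [map_prod, Finset.prod_ne_zero_iff] at hz
  refine ⟨z, fun i => ?_⟩
  have := hz i (Finset.mem_univ _)
  rwa [eval_lin, dotProduct_comm] at this

/-- Pairs of indices of different colours. -/
abbrev ColourPair (c : ι → γ) := {p : ι × ι // c p.1 ≠ c p.2}

/-- The bound is an open condition on the coefficients of the lines, so a configuration satisfying
it can be moved into general position. -/
theorem LinesBound.exists_generalPosition [Infinite k] [Fintype ι] {c : ι → γ} {m : ℕ}
    (h : LinesBound k c m) : ∃ a b : ι → Fin 3 → k, Module.finrank k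
      (vanishingForms (Fintype.card ι) (crossPoints c a ∪ crossPoints c b)) ≤ m ∧
      GeneralPosition (Sum.elim a b) := by
  classical
  obtain ⟨a₀, b₀, h₀⟩ := h
  let pt : ColourPair c ⊕ ColourPair c → Fin 3 → MvPolynomial ((ι ⊕ ι) × Fin 3) k :=
    Sum.elim (fun p => genericVector k (Sum.inl p.1.1) ⨯₃ genericVector k (Sum.inl p.1.2))
      (fun p => genericVector k (Sum.inr p.1.1) ⨯₃ genericVector k (Sum.inr p.1.2))
  let φ : ColourPair c ⊕ ColourPair c →
      homogeneousSubmodule (Fin 3) k (Fintype.card ι) →ₗ[k] MvPolynomial ((ι ⊕ ι) × Fin 3) k :=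
    fun p => (aeval (pt p)).toLinearMap ∘ₗ Submodule.subtype _
  have hφ : ∀ a b : ι → Fin 3 → k,
      commonKer φ (aeval fun p : (ι ⊕ ι) × Fin 3 => Sum.elim a b p.1 p.2) =
        vanishingForms (Fintype.card ι) (crossPoints c a ∪ crossPoints c b) := by
    intro a b
    have hev : ∀ (q : Fin 3 → MvPolynomial ((ι ⊕ ι) × Fin 3) k) (f : MvPolynomial (Fin 3) k),
        (aeval fun p : (ι ⊕ ι) × Fin 3 => Sum.elim a b p.1 p.2) (aeval q f) =
          eval (fun j => (aeval fun p : (ι ⊕ ι) × Fin 3 => Sum.elim a b p.1 p.2) (q j)) f := by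
      intro q f
      rw [← aeval_eq_eval, ← AlgHom.comp_apply, comp_aeval]
    have hpt : ∀ u v : ι ⊕ ι, (fun j => (aeval fun p : (ι ⊕ ι) × Fin 3 => Sum.elim a b p.1 p.2)
        ((genericVector k u ⨯₃ genericVector k v) j)) = Sum.elim a b u ⨯₃ Sum.elim a b v := by
      intro u v
      ext j
      fin_cases j <;> simp [cross_apply, genericVector]
    ext f
    rw [mem_commonKer, mem_vanishingForms]
    simp only [Sum.forall, φ, LinearMap.comp_apply, AlgHom.toLinearMap_apply, hev, pt,
      Sum.elim_inl, Sum.elim_inr, hpt, Submodule.subtype_apply]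
    constructor
    · rintro ⟨h1, h2⟩ p (⟨i, j, hij, rfl⟩ | ⟨i, j, hij, rfl⟩)
      · exact h1 ⟨(i, j), hij⟩
      · exact h2 ⟨(i, j), hij⟩
    · intro hf
      exact ⟨fun p => hf _ (Or.inl ⟨_, _, p.2, rfl⟩), fun p => hf _ (Or.inr ⟨_, _, p.2, rfl⟩)⟩
  rw [← hφ] at h₀
  obtain ⟨P, hP, hP'⟩ := exists_finrank_commonKer_le φ _ h₀
  obtain ⟨x, hx, hgp⟩ := exists_generic_avoiding (P := P) (by rintro rfl; simp at hP)
  refine ⟨x ∘ Sum.inl, x ∘ Sum.inr, ?_, ?_⟩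
  · rw [← hφ, Sum.elim_comp_inl_inr]
    exact hP' _ hx
  · rwa [Sum.elim_comp_inl_inr]

end Configurations

end ReducibleCurves

namespace ReducibleCurves

open Matrix

/-! ### Degeneration: one line added to both families -/

section AddLine

variable {k : Type*} [Field k] {ι γ κ : Type*}

theorem crossPoints_option_subset (c : ι → γ) (i₀ : γ) (a : ι → Fin 3 → k) (L p : Fin 3 → k)
    (hp : p ∈ crossPoints c a ∨ ∃ j, c j ≠ i₀ ∧ p = L ⨯₃ a j) :
    p ∈ crossPoints (fun o : Option ι => o.elim i₀ c) (fun o => o.elim L a) := by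
  rcases hp with ⟨i, j, hij, rfl⟩ | ⟨j, hj, rfl⟩
  · exact ⟨some i, some j, hij, rfl⟩
  · exact ⟨none, some j, hj.symm, rfl⟩

theorem divX_X_mul (p : Polynomial k) : (Polynomial.X * p).divX = p := by
  ext n
  rw [Polynomial.coeff_divX, Polynomial.coeff_X_mul]

/-- `Polynomial.divX` as a linear map. -/
noncomputable def divXₗ : Polynomial k →ₗ[k] Polynomial k where
  toFun := Polynomial.divX
  map_add' _ _ := Polynomial.divX_add
  map_smul' r p := by
    rw [Polynomial.smul_eq_C_mul, Polynomial.divX_C_mul, ← Polynomial.smul_eq_C_mul,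
      RingHom.id_apply]

/-- Multiplication by a linear form, on forms of degree `n`. -/
noncomputable def mulLin (L : Fin 3 → k) (n : ℕ) :
    homogeneousSubmodule (Fin 3) k n →ₗ[k] homogeneousSubmodule (Fin 3) k (n + 1) :=
  LinearMap.restrict (LinearMap.mulLeft k (lin L)) fun f hf => by
    have := (lin_isHomogeneous L).mul hf
    rw [add_comm] at this
    exact this

/-- Evaluation at a point, on forms of degree `n`. -/
noncomputable def evalForm (p : Fin 3 → k) (n : ℕ) : homogeneousSubmodule (Fin 3) k n →ₗ[k] k :=
  (aeval p).toLinearMap ∘ₗ Submodule.subtype _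

theorem evalForm_apply (p : Fin 3 → k) {n : ℕ} (f : homogeneousSubmodule (Fin 3) k n) :
    evalForm p n f = eval p (f : MvPolynomial (Fin 3) k) := by
  simp [evalForm, aeval_eq_eval]

/-- A line `L` is added, with colour `i₀`, to both families; the lines of `S` in the second family
are those that meet `L` in a point where it also meets a line of the first family. The line of the
second family is then moved. -/
theorem LinesBound.add_line_aux [Infinite k] [Fintype ι] (c : ι → γ) (i₀ : γ)
    (a b : ι → Fin 3 → k) (L M : Fin 3 → k) (hL : L ≠ 0) (S : Set ι) (τ : ι → ι) {ε : ℕ}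
    (w : Fin ε → Fin 3 → k) (hS : ∀ l ∈ S, c l ≠ i₀)
    (hτ : ∀ l ∈ S, c (τ l) ≠ i₀ ∧ ∃ μ : k, L ⨯₃ b l = μ • (L ⨯₃ a (τ l)))
    (hM : ∀ l ∈ S, L ⬝ᵥ M ⨯₃ b l ≠ 0)
    (hpts : ∀ p ∈ crossPoints c a ∪ crossPoints c b, L ⬝ᵥ p ≠ 0)
    {J : Type*} [Fintype J] (x : J → Fin 3 → k)
    (hJ : ∀ j, (∃ l, c l ≠ i₀ ∧ x j = a l) ∨ (∃ l, c l ≠ i₀ ∧ l ∉ S ∧ x j = b l) ∨ ∃ l, x j = w l)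
    (hx : ∀ u v, u ≠ v → L ⬝ᵥ x u ⨯₃ x v ≠ 0) (hcard : Fintype.card ι + 2 ≤ Fintype.card J) :
    LinesBound k (fun o : Option ι => o.elim i₀ c)
      (Module.finrank k (vanishingForms (Fintype.card ι)
        ((crossPoints c a ∪ crossPoints c b) ∪ (fun l => L ⨯₃ b l) '' S)) + ε) := by
  classical
  set e := Fintype.card ι with he
  -- The vanishing conditions as functions of `t`, when the second copy of the line is `L + t M`.
  -- For `l ∈ S` the value at `t = 0` repeats the condition at `L ⨯₃ a (τ l)`. It is therefore
  -- divided by `t`, and in the limit it is a derivative along the line `b l`.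
  let φ : (ColourPair c ⊕ ColourPair c) ⊕ ({j // c j ≠ i₀} ⊕ {j // c j ≠ i₀}) →
      homogeneousSubmodule (Fin 3) k (e + 1) →ₗ[k] Polynomial k :=
    Sum.elim
      (Sum.elim (fun p => Algebra.linearMap k _ ∘ₗ evalForm (a p.1.1 ⨯₃ a p.1.2) _)
        (fun p => Algebra.linearMap k _ ∘ₗ evalForm (b p.1.1 ⨯₃ b p.1.2) _))
      (Sum.elim (fun j => Algebra.linearMap k _ ∘ₗ evalForm (L ⨯₃ a j) _)
        (fun l => if (l : ι) ∈ S then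
            divXₗ ∘ₗ (restrictLine (L ⨯₃ b l) (M ⨯₃ b l)).toLinearMap ∘ₗ Submodule.subtype _
          else (restrictLine (L ⨯₃ b l) (M ⨯₃ b l)).toLinearMap ∘ₗ Submodule.subtype _))
  have hker : ∀ (t : k) (f : homogeneousSubmodule (Fin 3) k (e + 1)),
      f ∈ commonKer φ (Polynomial.aeval t) ↔
        (∀ p ∈ crossPoints c a ∪ crossPoints c b, eval p (f : MvPolynomial (Fin 3) k) = 0) ∧
        (∀ j, c j ≠ i₀ → eval (L ⨯₃ a j) (f : MvPolynomial (Fin 3) k) = 0) ∧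
        (∀ l, c l ≠ i₀ → l ∉ S →
          (restrictLine (L ⨯₃ b l) (M ⨯₃ b l) (f : MvPolynomial (Fin 3) k)).eval t = 0) ∧
        (∀ l, c l ≠ i₀ → l ∈ S →
          (restrictLine (L ⨯₃ b l) (M ⨯₃ b l) (f : MvPolynomial (Fin 3) k)).divX.eval t = 0) := by
    intro t f
    rw [mem_commonKer]
    simp only [Sum.forall, φ, Sum.elim_inl, Sum.elim_inr, LinearMap.comp_apply,
      Algebra.linearMap_apply, evalForm_apply, AlgHom.commutes, Algebra.algebraMap_self,
      RingHom.id_apply]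
    constructor
    · rintro ⟨⟨h1, h2⟩, h3, h4⟩
      refine ⟨?_, fun j hj => h3 ⟨j, hj⟩, fun l hl hlS => ?_, fun l hl hlS => ?_⟩
      · rintro p (⟨i, j, hij, rfl⟩ | ⟨i, j, hij, rfl⟩)
        · exact h1 ⟨(i, j), hij⟩
        · exact h2 ⟨(i, j), hij⟩
      · have := h4 ⟨l, hl⟩
        rw [if_neg hlS] at this
        simpa [Polynomial.coe_aeval_eq_eval] using this
      · have := h4 ⟨l, hl⟩
        rw [if_pos hlS] at this
        simpa [Polynomial.coe_aeval_eq_eval, divXₗ] using this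
    · rintro ⟨h1, h2, h3, h4⟩
      refine ⟨⟨fun p => h1 _ (Or.inl ⟨_, _, p.2, rfl⟩), fun p => h1 _ (Or.inr ⟨_, _, p.2, rfl⟩)⟩,
        fun j => h2 j j.2, fun l => ?_⟩
      split_ifs with hlS
      · simpa [Polynomial.coe_aeval_eq_eval, divXₗ] using h4 l l.2 hlS
      · simpa [Polynomial.coe_aeval_eq_eval] using h3 l l.2 hlS
  have hbound : Module.finrank k (commonKer φ (Polynomial.aeval 0)) ≤
      Module.finrank k (vanishingForms e
        ((crossPoints c a ∪ crossPoints c b) ∪ (fun l => L ⨯₃ b l) '' S)) + ε := by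
    refine (finrank_le_finrank_inf_add _ fun i => evalForm (L ⨯₃ w i) (e + 1)).trans ?_
    refine Nat.add_le_add_right ?_ _
    refine le_trans (Submodule.finrank_mono ?_) (Submodule.finrank_map_le (mulLin L e) _)
    rintro f ⟨hf, hfw⟩
    obtain ⟨h1, h2, h3, h4⟩ := (hker 0 f).mp hf
    simp only [SetLike.mem_coe, Submodule.mem_iInf, LinearMap.mem_ker, evalForm_apply] at hfw
    -- At `t = 0` the new points, together with the `ε` auxiliary ones, include `e + 2` distinct
    -- points of `L`, one more than the degree of `f`.
    have hdvd : lin L ∣ (f : MvPolynomial (Fin 3) k) := by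
      refine lin_dvd_of_eval_cross hL x hx (Nat.le_add_left 1 e) f.2 hcard fun j => ?_
      rcases hJ j with ⟨l, hl, hj⟩ | ⟨l, hl, hlS, hj⟩ | ⟨l, hj⟩
      · rw [hj]
        exact h2 l hl
      · rw [hj]
        have := h3 l hl hlS
        rw [eval_restrictLine] at this
        simpa using this
      · rw [hj]
        exact hfw l
    obtain ⟨g, hg⟩ := hdvd
    have hfg : (f : MvPolynomial (Fin 3) k) = lin L * homogeneousComponent e g := by
      rw [← homogeneousComponent_mul_of_isHomogeneous (lin_isHomogeneous L), ← hg]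
      exact (homogeneousComponent_eq_self f.2).symm
    refine ⟨⟨homogeneousComponent e g, homogeneousComponent_isHomogeneous e g⟩, ?_,
      Subtype.ext hfg.symm⟩
    rintro p (hp | ⟨l, hl, rfl⟩)
    · have := h1 p hp
      rw [hfg, map_mul, eval_lin] at this
      exact (mul_eq_zero.mp this).resolve_left (hpts p hp)
    -- Along `b l` the form `lin L` is a nonzero multiple of `t`, so the derivative condition on `f`
    -- is vanishing of the quotient at `L ⨯₃ b l`.
    · have := h4 l (hS l hl) hl
      rw [hfg, map_mul, restrictLine_lin, dot_self_cross, Polynomial.C_0, zero_add, mul_assoc,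
        divX_X_mul, Polynomial.eval_mul, Polynomial.eval_C, eval_restrictLine, zero_smul,
        add_zero] at this
      exact (mul_eq_zero.mp this).resolve_left (hM l hl)
  obtain ⟨P, hP, hP'⟩ := exists_finrank_commonKer_le φ _ hbound
  -- Besides `P`, the value `t = 0` is avoided: only for `t ≠ 0` do the divided conditions follow
  -- from vanishing at the moved points.
  obtain ⟨t, ht⟩ : ∃ t : k, Polynomial.eval t (Polynomial.X * P) ≠ 0 := by
    by_contra hcon
    push Not at hcon
    have h0 : Polynomial.X * P = 0 := Polynomial.funext fun t => by simpa using hcon t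
    have hP0 := (mul_eq_zero.mp h0).resolve_left Polynomial.X_ne_zero
    rw [hP0, map_zero] at hP
    exact hP rfl
  rw [Polynomial.eval_mul, Polynomial.eval_X, mul_ne_zero_iff] at ht
  refine ⟨fun o => o.elim L a, fun o => o.elim (L + t • M) b, ?_⟩
  rw [Fintype.card_option]
  refine le_trans (Submodule.finrank_mono ?_)
    (hP' (Polynomial.aeval t) (by simpa [Polynomial.coe_aeval_eq_eval] using ht.2))
  intro f hf
  have hft : ∀ l, c l ≠ i₀ →
      (restrictLine (L ⨯₃ b l) (M ⨯₃ b l) (f : MvPolynomial (Fin 3) k)).eval t = 0 := by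
    intro l hl
    rw [eval_restrictLine]
    refine hf _ (Or.inr (crossPoints_option_subset _ _ _ _ _ (Or.inr ⟨l, hl, ?_⟩)))
    simp
  have hfa : ∀ l, c l ≠ i₀ → eval (L ⨯₃ a l) (f : MvPolynomial (Fin 3) k) = 0 := fun l hl =>
    hf _ (Or.inl (crossPoints_option_subset _ _ _ _ _ (Or.inr ⟨l, hl, rfl⟩)))
  rw [hker]
  refine ⟨?_, hfa, fun l hl _ => hft l hl, fun l hl hlS => ?_⟩
  · rintro p (hp | hp)
    · exact hf p (Or.inl (crossPoints_option_subset _ _ _ _ _ (Or.inl hp)))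
    · exact hf p (Or.inr (crossPoints_option_subset _ _ _ _ _ (Or.inl hp)))
  · obtain ⟨hτl, μ, hμ⟩ := hτ l hlS
    have h0 : (restrictLine (L ⨯₃ b l) (M ⨯₃ b l) (f : MvPolynomial (Fin 3) k)).coeff 0 = 0 := by
      rw [Polynomial.coeff_zero_eq_eval_zero, eval_restrictLine, zero_smul, add_zero, hμ,
        eval_smul_of_isHomogeneous f.2, hfa _ hτl, mul_zero]
    have h1 := hft l hl
    rw [← Polynomial.X_mul_divX_add (restrictLine (L ⨯₃ b l) (M ⨯₃ b l) (f : MvPolynomial (Fin 3) k)),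
      h0, Polynomial.C_0, add_zero, Polynomial.eval_mul, Polynomial.eval_X] at h1
    exact (mul_eq_zero.mp h1).resolve_left ht.1

end AddLine

end ReducibleCurves

namespace ReducibleCurves

open Matrix

/-! ### Zeros forcing a form to vanish, and point counts on the new line -/

section AddLineGeneral

variable {k : Type*} [Field k] {ι γ κ : Type*}

theorem cross_ne_zero_of_triple {L x y : Fin 3 → k} (h : L ⬝ᵥ x ⨯₃ y ≠ 0) : L ⨯₃ x ≠ 0 := by
  intro h0
  apply h
  rw [triple_product_permutation, triple_product_permutation, h0, dotProduct_zero]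

theorem cross_cross_cross_right (L x y : Fin 3 → k) :
    (L ⨯₃ y) ⨯₃ (x ⨯₃ y) = (L ⬝ᵥ x ⨯₃ y) • y := by
  simp only [cross_apply, dotProduct, Fin.sum_univ_three]
  ext i
  fin_cases i <;> simp <;> ring

theorem eval_cross_swap {n : ℕ} {f : MvPolynomial (Fin 3) k} (hf : f.IsHomogeneous n)
    {u v : Fin 3 → k} (h : eval (u ⨯₃ v) f = 0) : eval (v ⨯₃ u) f = 0 := by
  rw [← cross_anticomm, ← neg_one_smul k, eval_smul_of_isHomogeneous hf, h, mul_zero]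

theorem GeneralPosition.lin_dvd [Infinite k] {x : κ → Fin 3 → k} (hx : GeneralPosition x) {n : ℕ}
    (hn : 1 ≤ n) {f : MvPolynomial (Fin 3) k} (hf : f.IsHomogeneous n) (u : κ) (T : Finset κ)
    (hu : u ∉ T) (h0 : ∀ v ∈ T, eval (x u ⨯₃ x v) f = 0) (hT : n + 1 ≤ T.card) :
    lin (x u) ∣ f := by
  have hne : ∀ v ∈ T, u ≠ v := fun v hv h => hu (h ▸ hv)
  have hxu : x u ≠ 0 := by
    obtain ⟨v, hv⟩ : T.Nonempty := Finset.card_pos.mp (by omega)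
    have := hx.cross_ne_zero (hne v hv)
    rintro h
    rw [h] at this
    simp at this
  refine lin_dvd_of_eval_cross (J := T) hxu (fun v => x v) ?_ hn hf (by simpa using hT)
    fun v => h0 v v.2
  intro v w hvw
  exact hx.triple (hne v v.2) (hne w w.2) fun h => hvw (Subtype.ext h)

theorem GeneralPosition.eq_zero_of_prod_dvd {x : κ → Fin 3 → k} (hx : GeneralPosition x) {n : ℕ}
    {f : MvPolynomial (Fin 3) k} (hf : f.IsHomogeneous n) (T : Finset κ) (hT : n < T.card)
    (h : ∀ u ∈ T, lin (x u) ∣ f) (hne : ∀ u ∈ T, x u ≠ 0) : f = 0 := by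
  by_contra h0
  have hdvd : ∏ u ∈ T, lin (x u) ∣ f := by
    refine Finset.prod_dvd_of_isRelPrime ?_ h
    intro u _ v _ huv
    exact isRelPrime_lin (hx.cross_ne_zero huv)
  obtain ⟨g, hg⟩ := hdvd
  have hp : (∏ u ∈ T, lin (x u)) ≠ 0 := Finset.prod_ne_zero_iff.mpr fun u hu => lin_ne_zero (hne u hu)
  have hg0 : g ≠ 0 := by
    rintro rfl
    exact h0 (by simpa using hg)
  have hhom : (∏ u ∈ T, lin (x u)).IsHomogeneous T.card := by
    simpa using IsHomogeneous.prod T (fun u => lin (x u)) (fun _ => 1)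
      fun u _ => lin_isHomogeneous (x u)
  have h1 := hf.totalDegree h0
  rw [hg, totalDegree_mul_of_isDomain hp hg0, hhom.totalDegree hp] at h1
  omega

/-- The number of lines of a given colour. -/
def colourCard [Fintype ι] [DecidableEq γ] (c : ι → γ) (i : γ) : ℕ :=
  (Finset.univ.filter fun j => c j = i).card

theorem card_filter_ne [Fintype ι] [DecidableEq γ] (c : ι → γ) (i : γ) :
    (Finset.univ.filter fun j => c j ≠ i).card + colourCard c i = Fintype.card ι := by
  rw [add_comm, colourCard, Finset.card_filter_add_card_filter_not]
  rfl

/-- Let `e` be the degree. The line `a j` with `j ∈ A` carries a zero for each line of another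
colour of its family and for each line of `B`, more than `e` in all, so it divides `f`; likewise for
`B`. More than `e` distinct lines cannot divide a nonzero form of degree `e`. -/
theorem eq_zero_of_eval_cross [Infinite k] [Fintype ι] [DecidableEq γ] {c : ι → γ}
    {a b : ι → Fin 3 → k} (hx : GeneralPosition (Sum.elim a b))
    {f : homogeneousSubmodule (Fin 3) k (Fintype.card ι)}
    (hf : f ∈ vanishingForms (Fintype.card ι) (crossPoints c a ∪ crossPoints c b))
    (A B : Finset ι) (hAB : ∀ j ∈ A, ∀ l ∈ B, eval (a j ⨯₃ b l) (f : MvPolynomial (Fin 3) k) = 0)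
    (hA : ∀ j ∈ A, colourCard c (c j) < B.card) (hB : ∀ l ∈ B, colourCard c (c l) < A.card)
    (hcard : Fintype.card ι < A.card + B.card) : f = 0 := by
  classical
  have hpos : 1 ≤ Fintype.card ι := by
    rcases Nat.eq_zero_or_pos (Fintype.card ι) with h | h
    · have := Finset.card_le_univ A
      have := Finset.card_le_univ B
      omega
    · exact h
  have hne : ∀ u, Sum.elim a b u ≠ 0 := by
    intro u
    obtain ⟨o⟩ := Fintype.card_pos_iff.mp hpos
    have : ∃ v, u ≠ v := by
      rcases u with j | j
      · exact ⟨Sum.inr j, Sum.inl_ne_inr⟩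
      · exact ⟨Sum.inl j, Sum.inr_ne_inl⟩
    obtain ⟨v, hv⟩ := this
    intro h
    have := hx.cross_ne_zero hv
    rw [h] at this
    simp at this
  apply Subtype.ext
  refine hx.eq_zero_of_prod_dvd f.2 (A.disjSum B) (by rwa [Finset.card_disjSum]) ?_ fun u _ => hne u
  intro u hu
  rw [Finset.mem_disjSum] at hu
  rcases hu with ⟨j, hj, rfl⟩ | ⟨l, hl, rfl⟩
  · refine hx.lin_dvd hpos f.2 (Sum.inl j)
      ((Finset.univ.filter fun i => c i ≠ c j).disjSum B) (by simp) ?_ ?_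
    · intro v hv
      rw [Finset.mem_disjSum] at hv
      rcases hv with ⟨i, hi, rfl⟩ | ⟨l, hl, rfl⟩
      · exact hf _ (Or.inl ⟨j, i, Ne.symm (by simpa using hi), rfl⟩)
      · exact hAB j hj l hl
    · have := hA j hj
      have := card_filter_ne c (c j)
      rw [Finset.card_disjSum]
      omega
  · refine hx.lin_dvd hpos f.2 (Sum.inr l)
      (A.disjSum (Finset.univ.filter fun i => c i ≠ c l)) (by simp) ?_ ?_
    · intro v hv
      rw [Finset.mem_disjSum] at hv
      rcases hv with ⟨j, hj, rfl⟩ | ⟨i, hi, rfl⟩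
      · exact eval_cross_swap f.2 (hAB j hj l hl)
      · exact hf _ (Or.inr ⟨l, i, Ne.symm (by simpa using hi), rfl⟩)
    · have := hB l hl
      have := card_filter_ne c (c l)
      rw [Finset.card_disjSum]
      omega

/-- The pair of lines `u`, `v` is one of the pairs `a (τ l)`, `b l` with `l ∈ S`. -/
def IsMarked (S : Finset ι) (τ : ι → ι) (u v : ι ⊕ ι) : Prop :=
  ∃ l ∈ S, (u = Sum.inl (τ l) ∧ v = Sum.inr l) ∨ (u = Sum.inr l ∧ v = Sum.inl (τ l))

/-- `L` passes through the points `a (τ l) ⨯₃ b l`, `l ∈ S`, and is otherwise general. With `e`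
lines per family, `n` of them of colour `i₀`, it carries `2 (e - n) - |S| + ε` distinct points, and
`hcard` says that this is at least `e + 2`. -/
theorem LinesBound.add_line [Infinite k] [Fintype ι] [DecidableEq γ] (c : ι → γ) (i₀ : γ)
    {a b : ι → Fin 3 → k} {L : Fin 3 → k} (S : Finset ι) (τ : ι → ι) {ε : ℕ} (hε : ε ≤ 1)
    (hLx : ∀ u, L ⨯₃ Sum.elim a b u ≠ 0)
    (hgen : ∀ u v, u ≠ v → ¬ IsMarked S τ u v → L ⬝ᵥ Sum.elim a b u ⨯₃ Sum.elim a b v ≠ 0)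
    (hinc : ∀ l ∈ S, L ⬝ᵥ a (τ l) ⨯₃ b l = 0)
    (hS : ∀ l ∈ S, c l ≠ i₀ ∧ c (τ l) ≠ i₀) (hpos : 1 ≤ Fintype.card ι)
    (hcard : 2 * colourCard c i₀ + 2 + S.card ≤ Fintype.card ι + ε) :
    LinesBound k (fun o : Option ι => o.elim i₀ c)
      (Module.finrank k (vanishingForms (Fintype.card ι)
        ((crossPoints c a ∪ crossPoints c b) ∪ (fun l => a (τ l) ⨯₃ b l) '' S)) + ε) := by
  classical
  have hL : L ≠ 0 := by
    obtain ⟨o⟩ := Fintype.card_pos_iff.mp hpos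
    rintro rfl
    exact hLx (Sum.inl o) (by simp)
  obtain ⟨M, hM⟩ := exists_vector_avoiding (fun u => Sum.elim a b u ⨯₃ L) fun u h => hLx u (by
    rw [← cross_anticomm, h, neg_zero])
  -- `L ⨯₃ w` is the auxiliary point of `L`. Only one is chosen, so distinctness of the points needs
  -- `ε ≤ 1`.
  obtain ⟨w, hw⟩ := exists_vector_avoiding (fun u => L ⨯₃ Sum.elim a b u) hLx
  have hlw : ∀ u, L ⬝ᵥ Sum.elim a b u ⨯₃ w ≠ 0 := by
    intro u
    rw [triple_product_permutation, triple_product_permutation]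
    exact hw u
  have hwl : ∀ u, L ⬝ᵥ w ⨯₃ Sum.elim a b u ≠ 0 := by
    intro u h
    apply hlw u
    rw [← cross_anticomm, dotProduct_neg, h, neg_zero]
  let x : ({j // c j ≠ i₀} ⊕ {l // c l ≠ i₀ ∧ l ∉ S}) ⊕ Fin ε → Fin 3 → k :=
    Sum.elim (Sum.elim (fun j => a j) (fun l => b l)) (fun _ => w)
  have key := LinesBound.add_line_aux c i₀ a b L M hL (S : Set ι) τ (fun _ : Fin ε => w)
    (fun l hl => (hS l hl).1)
    (fun l hl => ⟨(hS l hl).2, exists_smul_of_cross_eq_zero (hLx (Sum.inl (τ l))) (by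
      rw [← zero_smul k L, ← hinc l hl]
      exact cross_cross_cross _ _ _)⟩)
    (fun l _ => by
      rw [triple_product_permutation]
      exact hM (Sum.inr l))
    ?_ x ?_ ?_ ?_
  · refine key.mono (Nat.add_le_add_right (Submodule.finrank_mono ?_) _)
    rintro f hf p (hp | ⟨l, hl, rfl⟩)
    · exact hf p (Or.inl hp)
    · have h1 : (L ⨯₃ b l) ⨯₃ (a (τ l) ⨯₃ b l) = 0 := by
        rw [cross_cross_cross_right, hinc l hl, zero_smul]
      obtain ⟨t, ht⟩ := exists_smul_of_cross_eq_zero (hLx (Sum.inr l)) h1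
      change eval (a (τ l) ⨯₃ b l) _ = 0
      rw [ht, eval_smul_of_isHomogeneous f.2]
      have := hf _ (Or.inr ⟨l, hl, rfl⟩)
      simp only at this
      rw [Sum.elim_inr, this, mul_zero]
  · rintro p (⟨i, j, hij, rfl⟩ | ⟨i, j, hij, rfl⟩)
    · refine hgen (Sum.inl i) (Sum.inl j) (fun h => hij (by rw [Sum.inl_injective h])) ?_
      rintro ⟨l, -, h | h⟩ <;> simp at h
    · refine hgen (Sum.inr i) (Sum.inr j) (fun h => hij (by rw [Sum.inr_injective h])) ?_
      rintro ⟨l, -, h | h⟩ <;> simp at h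
  · rintro ((j | l) | i)
    · exact Or.inl ⟨j, j.2, rfl⟩
    · exact Or.inr (Or.inl ⟨l, l.2.1, l.2.2, rfl⟩)
    · exact Or.inr (Or.inr ⟨i, rfl⟩)
  · rintro ((j | l) | i) ((j' | l') | i') huv
    · refine hgen (Sum.inl j) (Sum.inl j') (fun h => huv ?_) ?_
      · rw [Subtype.ext (Sum.inl_injective h)]
      · rintro ⟨l, -, h | h⟩ <;> simp at h
    · refine hgen (Sum.inl j) (Sum.inr l') Sum.inl_ne_inr ?_
      rintro ⟨l, hl, h | h⟩
      · exact l'.2.2 (Sum.inr_injective h.2 ▸ hl)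
      · exact Sum.inl_ne_inr h.1
    · exact hlw (Sum.inl j)
    · refine hgen (Sum.inr l) (Sum.inl j') Sum.inr_ne_inl ?_
      rintro ⟨l', hl, h | h⟩
      · exact Sum.inr_ne_inl h.1
      · exact l.2.2 (Sum.inr_injective h.1 ▸ hl)
    · refine hgen (Sum.inr l) (Sum.inr l') (fun h => huv ?_) ?_
      · rw [Subtype.ext (Sum.inr_injective h)]
      · rintro ⟨l, -, h | h⟩ <;> simp at h
    · exact hlw (Sum.inr l)
    · exact hwl (Sum.inl j')
    · exact hwl (Sum.inr l')
    · exact absurd (congrArg Sum.inr (Fin.ext (by omega))) huv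
  · have h1 : Fintype.card {j // c j ≠ i₀} + colourCard c i₀ = Fintype.card ι := by
      rw [Fintype.card_subtype, card_filter_ne]
    have h2 : Fintype.card {l // c l ≠ i₀ ∧ l ∉ S} + S.card = Fintype.card {j // c j ≠ i₀} := by
      have hsub : S ⊆ Finset.univ.filter fun j => c j ≠ i₀ := fun l hl => by simpa using (hS l hl).1
      rw [Fintype.card_subtype, Fintype.card_subtype, ← Finset.card_sdiff_add_card_eq_card hsub]
      congr 2
      ext l
      simp
    rw [Fintype.card_sum, Fintype.card_sum, Fintype.card_fin]
    omega

end AddLineGeneral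

end ReducibleCurves

namespace ReducibleCurves

open Matrix

/-! ### Adding a line through zero, one or two mixed intersection points -/

section Steps

variable {k : Type*} [Field k] {ι γ κ : Type*}

/-- Adding a line in general position. -/
theorem LinesBound.add_general_line [Infinite k] [Fintype ι] [DecidableEq γ] {c : ι → γ} {m : ℕ}
    (h : LinesBound k c m) (i₀ : γ) {ε : ℕ} (hε : ε ≤ 1) (hpos : 1 ≤ Fintype.card ι)
    (hcard : 2 * colourCard c i₀ + 2 ≤ Fintype.card ι + ε) :
    LinesBound k (fun o : Option ι => o.elim i₀ c) (m + ε) := by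
  classical
  obtain ⟨a, b, hab, hx⟩ := h.exists_generalPosition
  obtain ⟨L, hL⟩ := exists_vector_avoiding
    (fun p : {p : (ι ⊕ ι) × (ι ⊕ ι) // p.1 ≠ p.2} =>
      Sum.elim a b p.1.1 ⨯₃ Sum.elim a b p.1.2) fun p => hx.cross_ne_zero p.2
  have hgen : ∀ u v : ι ⊕ ι, u ≠ v → L ⬝ᵥ Sum.elim a b u ⨯₃ Sum.elim a b v ≠ 0 :=
    fun u v huv => hL ⟨(u, v), huv⟩
  obtain ⟨o⟩ := Fintype.card_pos_iff.mp hpos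
  have key := LinesBound.add_line c i₀ (a := a) (b := b) (L := L) ∅ id hε ?_
    (fun u v huv _ => hgen u v huv) (by simp) (by simp) hpos (by simpa using hcard)
  · refine key.mono (Nat.add_le_add_right (le_trans (Submodule.finrank_mono ?_) hab) _)
    intro f hf p hp
    exact hf p (Or.inl hp)
  · rintro (j | j)
    · exact cross_ne_zero_of_triple (hgen (Sum.inl j) (Sum.inr o) Sum.inl_ne_inr)
    · exact cross_ne_zero_of_triple (hgen (Sum.inr j) (Sum.inl o) Sum.inr_ne_inl)

/-- Marked pairs mix the two families, so any second line of the same family as `u` shows that `L`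
and `u` are different lines. -/
theorem cross_ne_zero_of_unmarked [Fintype ι] {a b : ι → Fin 3 → k} {L : Fin 3 → k}
    {S : Finset ι} {τ : ι → ι} (h2 : 2 ≤ Fintype.card ι)
    (hgen : ∀ u v, u ≠ v → ¬ IsMarked S τ u v → L ⬝ᵥ Sum.elim a b u ⨯₃ Sum.elim a b v ≠ 0)
    (u : ι ⊕ ι) : L ⨯₃ Sum.elim a b u ≠ 0 := by
  rcases u with j | j
  · obtain ⟨i, hi⟩ := Fintype.exists_ne_of_one_lt_card (by omega) j
    refine cross_ne_zero_of_triple (hgen (Sum.inl j) (Sum.inl i) (by simpa using hi.symm) ?_)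
    rintro ⟨l, -, h | h⟩ <;> simp at h
  · obtain ⟨i, hi⟩ := Fintype.exists_ne_of_one_lt_card (by omega) j
    refine cross_ne_zero_of_triple (hgen (Sum.inr j) (Sum.inr i) (by simpa using hi.symm) ?_)
    rintro ⟨l, -, h | h⟩ <;> simp at h

/-- A line through the intersection point of the lines `A` and `B`, otherwise general. -/
theorem GeneralPosition.exists_line_through [Infinite k] [Finite κ] {x : κ → Fin 3 → k}
    (hx : GeneralPosition x) {A B : κ} (hAB : A ≠ B) :
    ∃ L : Fin 3 → k, L ⬝ᵥ x A ⨯₃ x B = 0 ∧ ∀ u v, u ≠ v → ¬ (u = A ∧ v = B) → ¬ (u = B ∧ v = A) →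
      L ⬝ᵥ x u ⨯₃ x v ≠ 0 := by
  classical
  set p := x A ⨯₃ x B with hp
  -- The second point `q` of `L` lies off the lines joining `p` to the other intersection points.
  -- These points differ from `p` because no three lines are concurrent.
  obtain ⟨q, hq⟩ := exists_vector_avoiding
    (fun z : {z : κ × κ // z.1 ≠ z.2 ∧ ¬ (z.1 = A ∧ z.2 = B) ∧ ¬ (z.1 = B ∧ z.2 = A)} =>
      (x z.1.1 ⨯₃ x z.1.2) ⨯₃ p) (by
    rintro ⟨⟨u, v⟩, huv, h1, h2⟩ h0
    obtain ⟨t, ht⟩ := exists_smul_of_cross_eq_zero (hx.cross_ne_zero huv) h0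
    simp only at huv h1 h2 ht
    have hu : x u ⬝ᵥ p = 0 := by rw [ht, dotProduct_smul, dot_self_cross, smul_zero]
    have hv : x v ⬝ᵥ p = 0 := by rw [ht, dotProduct_smul, dot_cross_self, smul_zero]
    by_cases huA : u = A
    · have hvB : v ≠ B := fun h => h1 ⟨huA, h⟩
      exact hx.triple (fun h => huv (huA.trans h.symm)) hvB hAB hv
    · by_cases huB : u = B
      · have hvA : v ≠ A := fun h => h2 ⟨huB, h⟩
        exact hx.triple hvA (fun h => huv (huB.trans h.symm)) hAB hv
      · exact hx.triple huA huB hAB hu)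
  refine ⟨p ⨯₃ q, ?_, fun u v huv h1 h2 => ?_⟩
  · rw [dotProduct_comm, dot_self_cross]
  · have := hq ⟨(u, v), huv, h1, h2⟩
    rwa [triple_product_permutation, dotProduct_comm] at this

theorem finrank_vanishingForms_union_singleton_lt {n : ℕ} {Z T : Set (Fin 3 → k)}
    {p : Fin 3 → k} (hp : p ∈ T) {f : homogeneousSubmodule (Fin 3) k n}
    (hf : f ∈ vanishingForms n Z) (hfp : eval p (f : MvPolynomial (Fin 3) k) ≠ 0) :
    Module.finrank k (vanishingForms n (Z ∪ T)) < Module.finrank k (vanishingForms n Z) := by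
  apply Submodule.finrank_lt_finrank_of_lt
  refine lt_of_le_of_ne (fun g hg q hq => hg q (Or.inl hq)) fun h => ?_
  rw [← h] at hf
  exact hfp (hf p (Or.inr hp))

/-- Adding a line through an intersection point of the two families. -/
theorem LinesBound.add_line_through_point [Infinite k] [Fintype ι] [DecidableEq γ] {c : ι → γ}
    {m : ℕ} (h : LinesBound k c m) (i₀ : γ) (hcard : 2 * colourCard c i₀ + 3 ≤ Fintype.card ι)
    (hc : ∀ j, c j ≠ i₀ → colourCard c i₀ + colourCard c (c j) < Fintype.card ι) :
    LinesBound k (fun o : Option ι => o.elim i₀ c) (m - 1) := by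
  classical
  obtain ⟨a, b, hab, hx⟩ := h.exists_generalPosition
  rcases eq_or_ne (vanishingForms (Fintype.card ι) (crossPoints c a ∪ crossPoints c b)) ⊥ with h0 | h0
  · have h1 : LinesBound k c 0 := ⟨a, b, by rw [h0, finrank_bot]⟩
    exact (h1.add_general_line i₀ (zero_le_one) (by omega) (by omega)).mono (Nat.zero_le _)
  obtain ⟨f, hf, hf0⟩ := Submodule.exists_mem_ne_zero_of_ne_bot h0
  -- Otherwise `eq_zero_of_eval_cross` applies to all lines of colour other than `i₀`: with `e`
  -- lines per family, `n` of colour `i₀`, there are `2 (e - n) > e` of them.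
  have hex : ∃ j l, c j ≠ i₀ ∧ c l ≠ i₀ ∧ eval (a j ⨯₃ b l) (f : MvPolynomial (Fin 3) k) ≠ 0 := by
    by_contra hcon
    push Not at hcon
    have hs := card_filter_ne c i₀
    apply hf0
    refine eq_zero_of_eval_cross hx hf (Finset.univ.filter fun j => c j ≠ i₀)
      (Finset.univ.filter fun j => c j ≠ i₀) ?_ ?_ ?_ (by omega)
    · intro j hj l hl
      exact hcon j l (by simpa using hj) (by simpa using hl)
    · intro j hj
      have := hc j (by simpa using hj)
      omega
    · intro j hj
      have := hc j (by simpa using hj)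
      omega
  obtain ⟨j, l, hj, hl, hjl⟩ := hex
  obtain ⟨L, hL0, hL⟩ := hx.exists_line_through (A := Sum.inl j) (B := Sum.inr l) Sum.inl_ne_inr
  have hgen : ∀ u v, u ≠ v → ¬ IsMarked {l} (fun _ => j) u v →
      L ⬝ᵥ Sum.elim a b u ⨯₃ Sum.elim a b v ≠ 0 := by
    intro u v huv hm
    refine hL u v huv (fun h => hm ⟨l, by simp, Or.inl h⟩) (fun h => hm ⟨l, by simp, Or.inr h⟩)
  have key := LinesBound.add_line c i₀ (a := a) (b := b) (L := L) {l} (fun _ => j) zero_le_one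
    (cross_ne_zero_of_unmarked (by omega) hgen) hgen (by simpa using hL0) (by simp [hj, hl])
    (by omega) (by rw [Finset.card_singleton]; omega)
  refine key.mono ?_
  have := finrank_vanishingForms_union_singleton_lt
    (T := (fun l => a j ⨯₃ b l) '' ({l} : Finset ι)) (p := a j ⨯₃ b l) ⟨l, by simp, rfl⟩ hf hjl
  omega

/-- With `p`, `p'` the two points, the expression is `(p · u) (p' · v) - (p · v) (p' · u)`. If `u`
or `v` is one of the four lines, one term vanishes and the other does not, as no three lines are
concurrent; otherwise condition `six` applies. -/
theorem GeneralPosition.line_through_two {x : κ → Fin 3 → k} (hx : GeneralPosition x)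
    {A B A' B' : κ} (h1 : A ≠ B) (h2 : A' ≠ B') (h3 : A ≠ A') (h4 : A ≠ B') (h5 : B ≠ A')
    (h6 : B ≠ B') {u v : κ} (huv : u ≠ v) (hAB : ¬ (u = A ∧ v = B)) (hBA : ¬ (u = B ∧ v = A))
    (hAB' : ¬ (u = A' ∧ v = B')) (hBA' : ¬ (u = B' ∧ v = A')) :
    ((x A ⨯₃ x B) ⨯₃ (x A' ⨯₃ x B')) ⬝ᵥ x u ⨯₃ x v ≠ 0 := by
  have hp : ∀ w, w ≠ A → w ≠ B → (x A ⨯₃ x B) ⬝ᵥ x w ≠ 0 := fun w hA hB => by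
    rw [dotProduct_comm]
    exact hx.triple hA hB h1
  have hp' : ∀ w, w ≠ A' → w ≠ B' → (x A' ⨯₃ x B') ⬝ᵥ x w ≠ 0 := fun w hA hB => by
    rw [dotProduct_comm]
    exact hx.triple hA hB h2
  have z1 : (x A ⨯₃ x B) ⬝ᵥ x A = 0 := by rw [dotProduct_comm, dot_self_cross]
  have z2 : (x A ⨯₃ x B) ⬝ᵥ x B = 0 := by rw [dotProduct_comm, dot_cross_self]
  have z3 : (x A' ⨯₃ x B') ⬝ᵥ x A' = 0 := by rw [dotProduct_comm, dot_self_cross]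
  have z4 : (x A' ⨯₃ x B') ⬝ᵥ x B' = 0 := by rw [dotProduct_comm, dot_cross_self]
  by_cases huA : u = A
  · subst huA
    rw [cross_dot_cross, z1, zero_mul, zero_sub, neg_ne_zero]
    exact mul_ne_zero (hp v huv.symm fun h => hAB ⟨rfl, h⟩) (hp' u h3 h4)
  by_cases huB : u = B
  · subst huB
    rw [cross_dot_cross, z2, zero_mul, zero_sub, neg_ne_zero]
    exact mul_ne_zero (hp v (fun h => hBA ⟨rfl, h⟩) huv.symm) (hp' u h5 h6)
  by_cases huA' : u = A'
  · subst huA'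
    rw [cross_dot_cross, z3, mul_zero, sub_zero]
    exact mul_ne_zero (hp u huA huB) (hp' v huv.symm fun h => hAB' ⟨rfl, h⟩)
  by_cases huB' : u = B'
  · subst huB'
    rw [cross_dot_cross, z4, mul_zero, sub_zero]
    exact mul_ne_zero (hp u huA huB) (hp' v (fun h => hBA' ⟨rfl, h⟩) huv.symm)
  by_cases hvA : v = A
  · subst hvA
    rw [cross_dot_cross, z1, zero_mul, sub_zero]
    exact mul_ne_zero (hp u huA huB) (hp' v h3 h4)
  by_cases hvB : v = B
  · subst hvB
    rw [cross_dot_cross, z2, zero_mul, sub_zero]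
    exact mul_ne_zero (hp u huA huB) (hp' v h5 h6)
  by_cases hvA' : v = A'
  · subst hvA'
    rw [cross_dot_cross, z3, mul_zero, zero_sub, neg_ne_zero]
    exact mul_ne_zero (hp v hvA hvB) (hp' u huA' huB')
  by_cases hvB' : v = B'
  · subst hvB'
    rw [cross_dot_cross, z4, mul_zero, zero_sub, neg_ne_zero]
    exact mul_ne_zero (hp v hvA hvB) (hp' u huA' huB')
  have hinj : Function.Injective ![A, B, A', B', u, v] := by
    intro i j
    fin_cases i <;> fin_cases j <;>
      simp [h1, h2, h3, h4, h5, h6, huv, huA, huB, huA', huB', hvA, hvB, hvA', hvB', Ne.symm h1,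
        Ne.symm h2, Ne.symm h3, Ne.symm h4, Ne.symm h5, Ne.symm h6, Ne.symm huv, Ne.symm huA,
        Ne.symm huB, Ne.symm huA', Ne.symm huB', Ne.symm hvA, Ne.symm hvB, Ne.symm hvA',
        Ne.symm hvB']
  exact hx.six ⟨_, hinj⟩

/-- Adding a line through two intersection points of the two families. -/
theorem LinesBound.add_line_through_two_points [Infinite k] [Fintype ι] [DecidableEq γ]
    {c : ι → γ} {m : ℕ} (h : LinesBound k c m) (i₀ : γ)
    (hcard : 2 * colourCard c i₀ + 4 ≤ Fintype.card ι)
    (hc : ∀ j, c j ≠ i₀ → colourCard c i₀ + colourCard c (c j) + 1 < Fintype.card ι) :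
    LinesBound k (fun o : Option ι => o.elim i₀ c) (m - 2) := by
  classical
  obtain ⟨a, b, hab, hx⟩ := h.exists_generalPosition
  -- In dimension at most one a single point already reaches zero.
  rcases Nat.lt_or_ge (Module.finrank k (vanishingForms (Fintype.card ι)
    (crossPoints c a ∪ crossPoints c b))) 2 with h2 | h2
  · have h1 : LinesBound k c 1 := ⟨a, b, by omega⟩
    refine (h1.add_line_through_point i₀ (by omega) fun j hj => ?_).mono (Nat.zero_le _)
    have := hc j hj
    omega
  have h0 : vanishingForms (Fintype.card ι) (crossPoints c a ∪ crossPoints c b) ≠ ⊥ := by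
    intro h0
    rw [h0, finrank_bot] at h2
    omega
  obtain ⟨f, hf, hf0⟩ := Submodule.exists_mem_ne_zero_of_ne_bot h0
  have hs := card_filter_ne c i₀
  have hex : ∃ j l, c j ≠ i₀ ∧ c l ≠ i₀ ∧ eval (a j ⨯₃ b l) (f : MvPolynomial (Fin 3) k) ≠ 0 := by
    by_contra hcon
    push Not at hcon
    apply hf0
    refine eq_zero_of_eval_cross hx hf (Finset.univ.filter fun j => c j ≠ i₀)
      (Finset.univ.filter fun j => c j ≠ i₀) ?_ ?_ ?_ (by omega)
    · intro j hj l hl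
      exact hcon j l (by simpa using hj) (by simpa using hl)
    · intro j hj
      have := hc j (by simpa using hj)
      omega
    · intro j hj
      have := hc j (by simpa using hj)
      omega
  obtain ⟨j, l, hj, hl, hjl⟩ := hex
  obtain ⟨g, hg, hg0⟩ : ∃ g ∈ vanishingForms (Fintype.card ι)
      ((crossPoints c a ∪ crossPoints c b) ∪ {a j ⨯₃ b l}), g ≠ 0 := by
    apply Submodule.exists_mem_ne_zero_of_ne_bot
    intro hbot
    have := finrank_le_finrank_inf_add
      (vanishingForms (Fintype.card ι) (crossPoints c a ∪ crossPoints c b))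
      (fun _ : Fin 1 => evalForm (a j ⨯₃ b l) (Fintype.card ι))
    have hle : (vanishingForms (Fintype.card ι) (crossPoints c a ∪ crossPoints c b) ⊓
        ⨅ _ : Fin 1, LinearMap.ker (evalForm (a j ⨯₃ b l) (Fintype.card ι)) :
          Submodule k (homogeneousSubmodule (Fin 3) k (Fintype.card ι))) ≤ ⊥ := by
      rw [← hbot]
      rintro f ⟨h1, h2⟩ p (hp | hp)
      · exact h1 p hp
      · rw [Set.mem_singleton_iff.mp hp]
        simpa [evalForm_apply] using h2
    rw [le_bot_iff.mp hle, finrank_bot] at this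
    omega
  have hg' : g ∈ vanishingForms (Fintype.card ι) (crossPoints c a ∪ crossPoints c b) :=
    fun p hp => hg p (Or.inl hp)
  -- The second point avoids both lines of the first, so that the line joining them is none of the
  -- four. Leaving these lines out costs one in each family, hence the `+ 1` in `hc`.
  have hex' : ∃ j' l', c j' ≠ i₀ ∧ c l' ≠ i₀ ∧ j' ≠ j ∧ l' ≠ l ∧
      eval (a j' ⨯₃ b l') (g : MvPolynomial (Fin 3) k) ≠ 0 := by
    by_contra hcon
    push Not at hcon
    apply hg0
    have hcj : ((Finset.univ.filter fun j => c j ≠ i₀).erase j).card + 1 =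
        (Finset.univ.filter fun j => c j ≠ i₀).card :=
      Finset.card_erase_add_one (by simpa using hj)
    have hcl : ((Finset.univ.filter fun j => c j ≠ i₀).erase l).card + 1 =
        (Finset.univ.filter fun j => c j ≠ i₀).card :=
      Finset.card_erase_add_one (by simpa using hl)
    refine eq_zero_of_eval_cross hx hg' ((Finset.univ.filter fun j => c j ≠ i₀).erase j)
      ((Finset.univ.filter fun j => c j ≠ i₀).erase l) ?_ ?_ ?_ (by omega)
    · intro j' hj' l' hl'
      rw [Finset.mem_erase] at hj' hl'
      exact hcon j' l' (by simpa using hj'.2) (by simpa using hl'.2) hj'.1 hl'.1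
    · intro j hj
      have := hc j (by simpa using (Finset.mem_erase.mp hj).2)
      omega
    · intro j hj
      have := hc j (by simpa using (Finset.mem_erase.mp hj).2)
      omega
  obtain ⟨j', l', hj', hl', hjj, hll, hjl'⟩ := hex'
  let τ : ι → ι := fun i => if i = l then j else j'
  have hτl : τ l = j := if_pos rfl
  have hτl' : τ l' = j' := if_neg hll
  let L := (a j ⨯₃ b l) ⨯₃ (a j' ⨯₃ b l')
  have hgen : ∀ u v, u ≠ v → ¬ IsMarked {l, l'} τ u v →
      L ⬝ᵥ Sum.elim a b u ⨯₃ Sum.elim a b v ≠ 0 := by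
    intro u v huv hm
    refine hx.line_through_two (A := Sum.inl j) (B := Sum.inr l) (A' := Sum.inl j')
      (B' := Sum.inr l') Sum.inl_ne_inr Sum.inl_ne_inr (by simpa using hjj.symm) Sum.inl_ne_inr
      Sum.inr_ne_inl (by simpa using hll.symm) huv (fun h => hm ⟨l, by simp, Or.inl ?_⟩)
      (fun h => hm ⟨l, by simp, Or.inr ?_⟩) (fun h => hm ⟨l', by simp, Or.inl ?_⟩)
      (fun h => hm ⟨l', by simp, Or.inr ?_⟩)
    · rwa [hτl]
    · rwa [hτl]
    · rwa [hτl']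
    · rwa [hτl']
  have key := LinesBound.add_line c i₀ (a := a) (b := b) (L := L) {l, l'} τ zero_le_one
    (cross_ne_zero_of_unmarked (by omega) hgen) hgen ?_ ?_
    (by omega) (by rw [Finset.card_pair hll.symm]; omega)
  · refine key.mono ?_
    have e1 := finrank_vanishingForms_union_singleton_lt (T := {a j ⨯₃ b l}) rfl hf hjl
    have e2 := finrank_vanishingForms_union_singleton_lt (T := {a j' ⨯₃ b l'}) rfl hg hjl'
    have e3 : Module.finrank k (vanishingForms (Fintype.card ι) ((crossPoints c a ∪ crossPoints c b) ∪
        (fun l => a (τ l) ⨯₃ b l) '' (({l, l'} : Finset ι) : Set ι))) ≤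
        Module.finrank k (vanishingForms (Fintype.card ι) ((crossPoints c a ∪ crossPoints c b) ∪
          {a j ⨯₃ b l} ∪ {a j' ⨯₃ b l'})) := by
      apply Submodule.finrank_mono
      rintro f hf p ((hp | hp) | hp)
      · exact hf p (Or.inl hp)
      · refine hf p (Or.inr ⟨l, by simp, ?_⟩)
        rw [Set.mem_singleton_iff.mp hp]
        simp only [hτl]
      · refine hf p (Or.inr ⟨l', by simp, ?_⟩)
        rw [Set.mem_singleton_iff.mp hp]
        simp only [hτl']
    omega
  · intro i hi
    rw [Finset.mem_insert, Finset.mem_singleton] at hi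
    rcases hi with rfl | rfl
    · rw [hτl, dotProduct_comm]
      exact dot_self_cross _ _
    · rw [hτl', dotProduct_comm]
      exact dot_cross_self _ _
  · intro i hi
    rw [Finset.mem_insert, Finset.mem_singleton] at hi
    rcases hi with rfl | rfl
    · rw [hτl]
      exact ⟨hl, hj⟩
    · rw [hτl']
      exact ⟨hl', hj'⟩

end Steps

end ReducibleCurves

namespace ReducibleCurves

/-! ### Bounds for types: explicit chains and upward propagation -/

section Types

variable {k : Type*} [Field k] {r : ℕ}

variable (k) in
/-- `LinesBound` for some family with `n i` lines of colour `i`. -/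
def TypeBound (n : Fin r → ℕ) (m : ℕ) : Prop :=
  ∃ (ι : Type) (_ : Fintype ι) (c : ι → Fin r), (∀ i, colourCard c i = n i) ∧ LinesBound k c m

theorem TypeBound.mono {n : Fin r → ℕ} {m m' : ℕ} (h : TypeBound k n m) (hm : m ≤ m') :
    TypeBound k n m' := by
  obtain ⟨ι, _, c, hc, hb⟩ := h
  exact ⟨ι, _, c, hc, hb.mono hm⟩

theorem card_eq_sum_colourCard {ι : Type*} [Fintype ι] (c : ι → Fin r) :
    Fintype.card ι = ∑ i, colourCard c i :=
  Finset.card_eq_sum_card_fiberwise fun _ _ => Finset.mem_coe.mpr (Finset.mem_univ _)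

theorem colourCard_option {ι : Type*} [Fintype ι] (c : ι → Fin r) (i j : Fin r) :
    colourCard (fun o : Option ι => o.elim i c) j = 
      colourCard c j + (Pi.single i 1 : Fin r → ℕ) j := by
  simp only [colourCard, Finset.card_filter, Fintype.sum_option, Option.elim_none, Option.elim_some,
    Pi.single_apply]
  rw [add_comm]
  simp only [@eq_comm _ i j]
  congr

/-- Recolouring along an injection keeps the intersection points. It provides an empty colour before
the first line of that colour is added. -/
theorem TypeBound.map {s : ℕ} {n : Fin r → ℕ} {m : ℕ} (h : TypeBound k n m) (n' : Fin s → ℕ)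
    (g : Fin r → Fin s) (hg : Function.Injective g) (h1 : ∀ i, n' (g i) = n i)
    (h2 : ∀ j, j ∉ Set.range g → n' j = 0) : TypeBound k n' m := by
  obtain ⟨ι, _, c, hc, a, b, hab⟩ := h
  have hcp : ∀ a : ι → Fin 3 → k, crossPoints (g ∘ c) a = crossPoints c a := by
    intro a
    simp [crossPoints, hg.eq_iff]
  refine ⟨ι, _, g ∘ c, fun j => ?_, a, b, by rwa [hcp, hcp]⟩
  by_cases hj : j ∈ Set.range g
  · obtain ⟨i, rfl⟩ := hj
    rw [h1, ← hc]
    simp [colourCard, hg.eq_iff]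
  · rw [h2 j hj, colourCard, Finset.card_eq_zero, Finset.filter_eq_empty_iff]
    rintro i - rfl
    exact hj ⟨c i, rfl⟩

theorem TypeBound.add_general [Infinite k] {n n' : Fin r → ℕ} {m m' : ℕ} (h : TypeBound k n m)
    (i : Fin r) (ε : ℕ) (hε : ε ≤ 1) (hpos : 1 ≤ ∑ j, n j) (hi : 2 * n i + 2 ≤ ∑ j, n j + ε)
    (hn : ∀ j, n' j = n j + (Pi.single i 1 : Fin r → ℕ) j) (hm : m + ε ≤ m') : TypeBound k n' m' := by
  obtain ⟨ι, _, c, hc, hb⟩ := h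
  obtain rfl : colourCard c = n := funext hc
  rw [← card_eq_sum_colourCard] at hpos hi
  exact ⟨Option ι, inferInstance, _, fun j => (colourCard_option c i j).trans (hn j).symm,
    (hb.add_general_line i hε hpos hi).mono hm⟩

theorem TypeBound.add_through_point [Infinite k] {n n' : Fin r → ℕ} {m m' : ℕ}
    (h : TypeBound k n m) (i : Fin r) (hi : 2 * n i + 3 ≤ ∑ j, n j)
    (hj : ∀ j, j ≠ i → n i + n j < ∑ j, n j)
    (hn : ∀ j, n' j = n j + (Pi.single i 1 : Fin r → ℕ) j) (hm : m - 1 ≤ m') : TypeBound k n' m' := by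
  obtain ⟨ι, _, c, hc, hb⟩ := h
  obtain rfl : colourCard c = n := funext hc
  rw [← card_eq_sum_colourCard] at hj hi
  exact ⟨Option ι, inferInstance, _, fun j => (colourCard_option c i j).trans (hn j).symm,
    (hb.add_line_through_point i hi fun j h => hj _ h).mono hm⟩

theorem TypeBound.add_through_two_points [Infinite k] {n n' : Fin r → ℕ} {m m' : ℕ}
    (h : TypeBound k n m) (i : Fin r) (hi : 2 * n i + 4 ≤ ∑ j, n j)
    (hj : ∀ j, j ≠ i → n i + n j + 1 < ∑ j, n j)
    (hn : ∀ j, n' j = n j + (Pi.single i 1 : Fin r → ℕ) j) (hm : m - 2 ≤ m') : TypeBound k n' m' := by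
  obtain ⟨ι, _, c, hc, hb⟩ := h
  obtain rfl : colourCard c = n := funext hc
  rw [← card_eq_sum_colourCard] at hj hi
  exact ⟨Option ι, inferInstance, _, fun j => (colourCard_option c i j).trans (hn j).symm,
    (hb.add_line_through_two_points i hi fun j h => hj _ h).mono hm⟩

variable (k)

theorem typeBound_one : TypeBound k ![1] 3 := by
  refine ⟨Unit, inferInstance, fun _ => 0, fun i => ?_, 0, 0, ?_⟩
  · fin_cases i
    rfl
  · have h := finrank_homogeneousSubmodule (k := k) 1
    have := Submodule.finrank_le (vanishingForms (k := k) (Fintype.card Unit)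
      (crossPoints (fun _ : Unit => (0 : Fin 1)) 0 ∪ crossPoints (fun _ : Unit => (0 : Fin 1)) 0))
    rw [Fintype.card_unit, h] at this
    exact this

variable [Infinite k]

theorem typeBound_one_one : TypeBound k ![1, 1] 4 :=
  ((typeBound_one k).map ![1, 0] ![0] (by decide) (by decide) (by decide)).add_general 1 1
    le_rfl (by decide) (by decide) (by decide) le_rfl

theorem typeBound_one_one_one : TypeBound k ![1, 1, 1] 4 :=
  ((typeBound_one_one k).map ![1, 1, 0] ![0, 1] (by decide) (by decide) (by decide)).add_general
    2 0 (by decide) (by decide) (by decide) (by decide) le_rfl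

/-- The first line added in each round has one point too few: `2 n + 2 = e + 1` for `n = a + 1`, `e
= 2 a + 3`. The auxiliary point raises the bound by one, exactly as the virtual dimension rises. -/
theorem typeBound_a_a_one (a : ℕ) : TypeBound k ![a + 1, a + 1, 1] (a + 4) := by
  induction a with
  | zero => exact typeBound_one_one_one k
  | succ a ih =>
    have h1 : TypeBound k ![a + 2, a + 1, 1] (a + 5) := by
      refine ih.add_general 0 1 le_rfl ?_ ?_ (fun j => ?_) le_rfl
      · simp [Fin.sum_univ_three]
      · simp [Fin.sum_univ_three]
        omega
      · fin_cases j <;> simp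
    refine h1.add_general 1 0 zero_le_one ?_ ?_ (fun j => ?_) le_rfl
    · simp [Fin.sum_univ_three]
    · simp [Fin.sum_univ_three]
      omega
    · fin_cases j <;> simp

/-- For `a ≤ 4` the bound is the virtual dimension of both types; afterwards it is truncated to
zero. A general line in the first colour keeps it, and a line through one point in the second colour
lowers it by one. -/
theorem typeBound_a_a_two (a : ℕ) :
    TypeBound k ![a + 2, a + 2, 2] (4 - a) ∧ TypeBound k ![a + 3, a + 2, 2] (4 - a) := by
  have up : ∀ a, TypeBound k ![a + 2, a + 2, 2] (4 - a) → TypeBound k ![a + 3, a + 2, 2] (4 - a) := by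
    intro a h
    refine h.add_general 0 0 zero_le_one ?_ ?_ (fun j => ?_) le_rfl
    · simp [Fin.sum_univ_three]
    · simp [Fin.sum_univ_three]
      omega
    · fin_cases j <;> simp
  suffices h : TypeBound k ![a + 2, a + 2, 2] (4 - a) from ⟨h, up a h⟩
  induction a with
  | zero =>
    exact (typeBound_a_a_one k 1).add_through_point 2 (by decide) (by decide) (by decide)
      (by decide)
  | succ a ih =>
    refine (up a ih).add_through_point 1 ?_ (fun j hj => ?_) (fun j => ?_) (by omega)
    · simp [Fin.sum_univ_three]
      omega
    · fin_cases j <;> (simp [Fin.sum_univ_three] at hj ⊢; try omega)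
    · fin_cases j <;> simp

theorem typeBound_three_three_three : TypeBound k ![3, 3, 3] 1 :=
  (typeBound_a_a_two k 1).1.add_through_two_points 2 (by decide) (by decide) (by decide) (by decide)

theorem typeBound_four_three_three : TypeBound k ![4, 3, 3] 0 :=
  (typeBound_three_three_three k).add_through_point 0 (by decide) (by decide) (by decide)
    (by decide)

/-- The same alternation as in `typeBound_a_a_two`, reaching zero at `a = 3`. -/
theorem typeBound_a_a_one_one (a : ℕ) :
    TypeBound k ![a + 1, a + 1, 1, 1] (3 - a) ∧ TypeBound k ![a + 2, a + 1, 1, 1] (3 - a) := by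
  have up : ∀ a, TypeBound k ![a + 1, a + 1, 1, 1] (3 - a) →
      TypeBound k ![a + 2, a + 1, 1, 1] (3 - a) := by
    intro a h
    refine h.add_general 0 0 zero_le_one ?_ ?_ (fun j => ?_) le_rfl
    · simp [Fin.sum_univ_four]
    · simp [Fin.sum_univ_four]
      omega
    · fin_cases j <;> simp
  suffices h : TypeBound k ![a + 1, a + 1, 1, 1] (3 - a) from ⟨h, up a h⟩
  induction a with
  | zero =>
    exact ((typeBound_one_one_one k).map ![1, 1, 1, 0] ![0, 1, 2] (by decide) (by decide)
      (by decide)).add_through_point 3 (by decide) (by decide) (by decide) (by decide)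
  | succ a ih =>
    refine (up a ih).add_through_point 1 ?_ (fun j hj => ?_) (fun j => ?_) (by omega)
    · simp [Fin.sum_univ_four]
      omega
    · fin_cases j <;> (simp [Fin.sum_univ_four] at hj ⊢; try omega)
    · fin_cases j <;> simp

theorem typeBound_two_two_two_one : TypeBound k ![2, 2, 2, 1] 0 :=
  (typeBound_a_a_one_one k 1).1.add_through_two_points 2 (by decide) (by decide) (by decide)
    (by decide)

theorem typeBound_five_ones : TypeBound k ![1, 1, 1, 1, 1] 1 :=
  ((typeBound_a_a_one_one k 0).1.map ![1, 1, 1, 1, 0] ![0, 1, 2, 3] (by decide) (by decide)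
    (by decide)).add_through_two_points 4 (by decide) (by decide) (by decide) (by decide)

theorem typeBound_two_one_one_one_one : TypeBound k ![2, 1, 1, 1, 1] 0 :=
  (typeBound_five_ones k).add_through_point 0 (by decide) (by decide) (by decide) (by decide)

theorem typeBound_six_ones : TypeBound k ![1, 1, 1, 1, 1, 1] 0 :=
  ((typeBound_five_ones k).map ![1, 1, 1, 1, 1, 0] ![0, 1, 2, 3, 4] (by decide) (by decide)
    (by decide)).add_through_point 5 (by decide) (by decide) (by decide) (by decide)

variable {k}

/-- Vanishing propagates upwards among balanced types. -/
theorem TypeBound.of_le {μ : Fin r → ℕ} (hμ : TypeBound k μ 0) (hbal : ∀ j, 2 * μ j < ∑ i, μ i)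
    (hpair : ∀ i j, i ≠ j → μ i + μ j + 2 ≤ ∑ i, μ i) (n : Fin r → ℕ) (hle : ∀ j, μ j ≤ n j)
    (hn : ∀ j, 2 * n j < ∑ i, n i) : TypeBound k n 0 := by
  induction hN : ∑ i, n i using Nat.strong_induction_on generalizing n with
  | _ N ih =>
  by_cases heq : μ = n
  · exact heq ▸ hμ
  have hne : (Finset.univ.filter fun j => μ j < n j).Nonempty := by
    obtain ⟨j, hj⟩ := Function.ne_iff.mp heq
    exact ⟨j, by simpa using lt_of_le_of_ne (hle j) hj⟩
  -- Removing a line from the largest colour that exceeds `μ` keeps the type balanced: for another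
  -- such colour `j`, `n j ≤ n i`, and `hpair` leaves at least two lines outside the colours `i` and
  -- `j`.
  obtain ⟨i, hi, hmax⟩ := Finset.exists_max_image _ n hne
  simp only [Finset.mem_filter, Finset.mem_univ, true_and] at hi hmax
  let ν : Fin r → ℕ := fun j => if j = i then n j - 1 else n j
  have hnν : ∀ j, n j = ν j + (Pi.single i 1 : Fin r → ℕ) j := by
    intro j
    by_cases h : j = i
    · subst h
      simp only [ν, if_true, Pi.single_eq_same]
      omega
    · simp [ν, h]
  have hsum : ∑ j, n j = ∑ j, ν j + 1 := by
    rw [Finset.sum_congr rfl fun j _ => hnν j, Finset.sum_add_distrib]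
    simp
  have hνi : ν i + 1 = n i := by
    simp only [ν, if_true]
    omega
  have hνj : ∀ j, j ≠ i → ν j = n j := fun j h => if_neg h
  have hleν : ∀ j, μ j ≤ ν j := by
    intro j
    by_cases h : j = i
    · subst h
      omega
    · rw [hνj j h]
      exact hle j
  have hsumle : ∑ j, μ j ≤ ∑ j, ν j := Finset.sum_le_sum fun j _ => hleν j
  have hνbal : ∀ j, 2 * ν j < ∑ i, ν i := by
    intro j
    by_cases h : j = i
    · subst h
      have := hn j
      omega
    · rw [hνj j h]
      rcases (hle j).eq_or_lt with hj | hj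
      · have := hbal j
        omega
      · have h1 := hmax j hj
        have h2 := hpair i j (Ne.symm h)
        have h3 : n i + n j + ∑ l ∈ (Finset.univ.erase i).erase j, n l = ∑ l, n l := by
          rw [add_assoc, Finset.add_sum_erase _ _ (by simp [h]), Finset.add_sum_erase _ _ (by simp)]
        have h4 : μ i + μ j + ∑ l ∈ (Finset.univ.erase i).erase j, μ l = ∑ l, μ l := by
          rw [add_assoc, Finset.add_sum_erase _ _ (by simp [h]), Finset.add_sum_erase _ _ (by simp)]
        have h5 : ∑ l ∈ (Finset.univ.erase i).erase j, μ l ≤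
          ∑ l ∈ (Finset.univ.erase i).erase j, n l := Finset.sum_le_sum fun l _ => hle l
        omega
  have := hn i
  exact (ih (∑ j, ν j) (by omega) ν hleν hνbal rfl).add_general i 0 zero_le_one (by
    have := hbal i
    omega) (by omega) hnν le_rfl

end Types

end ReducibleCurves

namespace ReducibleCurves

/-! ### Case analysis over all balanced types -/

section Cases

/-- The list of minimal types with vanishing. -/
def DominatesVanishing {r : ℕ} (d : Fin r → ℕ) : Prop :=
  Dominates d [4, 3, 3] ∨ Dominates d [6, 6, 2] ∨ Dominates d [4, 4, 1, 1] ∨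
    Dominates d [2, 2, 2, 1] ∨ Dominates d [2, 1, 1, 1, 1] ∨
      (6 ≤ r ∧ Dominates d (List.replicate r 1))

/-- `binom(|d| + 2, 2) - 2 D`. -/
def virtualDim {r : ℕ} (d : Fin r → ℕ) : ℤ :=
  ((((∑ i, d i) + 2).choose 2 : ℕ) : ℤ) - 2 * (pairSum d : ℤ)

theorem two_mul_choose_two (n : ℕ) : (2 : ℤ) * ((n + 2).choose 2 : ℕ) = (n + 2) * (n + 1) := by
  have h := Nat.triangle_succ (n + 1)
  rw [Nat.choose_two_right]
  have h2 : 2 ∣ (n + 2) * (n + 2 - 1) := by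
    have := Nat.even_mul_pred_self (n + 2)
    exact this.two_dvd
  obtain ⟨m, hm⟩ := h2
  rw [hm, Nat.mul_div_cancel_left _ (by norm_num)]
  have : ((n + 2) * (n + 2 - 1) : ℕ) = ((n + 2) * (n + 1) : ℕ) := rfl
  rw [this] at hm
  exact_mod_cast hm.symm

theorem dominatesVanishing_three (x y z : ℕ) :
    DominatesVanishing ![x, y, z] ↔ (4 ≤ x ∧ 3 ≤ y ∧ 3 ≤ z) ∨ (6 ≤ x ∧ 6 ≤ y ∧ 2 ≤ z) := by
  simp [DominatesVanishing, Dominates, List.ofFn_succ]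

theorem dominatesVanishing_four (x y z w : ℕ) :
    DominatesVanishing ![x, y, z, w] ↔
      (4 ≤ x ∧ 4 ≤ y ∧ 1 ≤ z ∧ 1 ≤ w) ∨ (2 ≤ x ∧ 2 ≤ y ∧ 2 ≤ z ∧ 1 ≤ w) := by
  simp [DominatesVanishing, Dominates, List.ofFn_succ]

theorem dominatesVanishing_five (x y z w t : ℕ) :
    DominatesVanishing ![x, y, z, w, t] ↔ 2 ≤ x ∧ 1 ≤ y ∧ 1 ≤ z ∧ 1 ≤ w ∧ 1 ≤ t := by
  simp [DominatesVanishing, Dominates, List.ofFn_succ]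

theorem virtualDim_three (x y z : ℕ) : 2 * virtualDim ![x, y, z] =
    (x + y + z + 2) * (x + y + z + 1) - 4 * (x * y + x * z + y * z) := by
  have h := two_mul_choose_two (x + y + z)
  have hp : pairSum ![x, y, z] = x * y + x * z + y * z := by
    simp [pairSum, Finset.sum_filter, Fin.sum_univ_three]
  rw [virtualDim, mul_sub, hp]
  simp only [Fin.sum_univ_three, Matrix.cons_val]
  rw [h]
  push_cast
  ring

theorem virtualDim_four (x y z w : ℕ) : 2 * virtualDim ![x, y, z, w] =
    (x + y + z + w + 2) * (x + y + z + w + 1) -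
      4 * (x * y + x * z + x * w + y * z + y * w + z * w) := by
  have h := two_mul_choose_two (x + y + z + w)
  have hp : pairSum ![x, y, z, w] = x * y + x * z + x * w + y * z + y * w + z * w := by
    simp [pairSum, Finset.sum_filter, Fin.sum_univ_four]
    ring
  rw [virtualDim, mul_sub, hp]
  simp only [Fin.sum_univ_four, Matrix.cons_val]
  rw [h]
  push_cast
  ring

theorem eq_vec_three (d : Fin 3 → ℕ) : d = ![d 0, d 1, d 2] := by
  ext i; fin_cases i <;> rfl

theorem eq_vec_four (d : Fin 4 → ℕ) : d = ![d 0, d 1, d 2, d 3] := by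
  ext i; fin_cases i <;> rfl

theorem eq_vec_five (d : Fin 5 → ℕ) : d = ![d 0, d 1, d 2, d 3, d 4] := by
  ext i; fin_cases i <;> rfl

/-- The possible outcomes: either the forms vanish, or the type bound is the virtual dimension. -/
def Outcome (k : Type*) [Field k] {r : ℕ} (d : Fin r → ℕ) : Prop :=
  (TypeBound k d 0 ∧ DominatesVanishing d) ∨
    ∃ m : ℕ, 1 ≤ m ∧ TypeBound k d m ∧ virtualDim d = m ∧ ¬ DominatesVanishing d

variable (k : Type*) [Field k] [Infinite k]

/-- Balance forces `x = y` if `z = 1` and `x ∈ {y, y + 1}` if `z = 2`. For `z ≥ 3` everything except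
`[3, 3, 3]` dominates `[4, 3, 3]`. -/
theorem outcome_three (x y z : ℕ) (hxy : y ≤ x) (hyz : z ≤ y) (hz : 1 ≤ z) (h : x < y + z) :
    Outcome k ![x, y, z] := by
  unfold Outcome
  rw [dominatesVanishing_three]
  have hv := virtualDim_three x y z
  rcases (show z = 1 ∨ z = 2 ∨ 3 ≤ z by omega) with rfl | rfl | hz
  · obtain ⟨a, rfl⟩ : ∃ a, y = a + 1 := ⟨y - 1, by omega⟩
    obtain rfl : x = a + 1 := by omega
    refine Or.inr ⟨a + 4, by omega, typeBound_a_a_one k a, ?_, by omega⟩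
    push_cast at hv ⊢
    linarith
  · obtain ⟨a, rfl⟩ : ∃ a, y = a + 2 := ⟨y - 2, by omega⟩
    rcases (show 4 ≤ a ∨ a < 4 by omega) with ha | ha
    · refine Or.inl ⟨?_, by omega⟩
      rcases (show x = a + 2 ∨ x = a + 3 by omega) with rfl | rfl
      · exact (typeBound_a_a_two k a).1.mono (by omega)
      · exact (typeBound_a_a_two k a).2.mono (by omega)
    · refine Or.inr ⟨4 - a, by omega, ?_, ?_, by omega⟩
      · rcases (show x = a + 2 ∨ x = a + 3 by omega) with rfl | rfl
        · exact (typeBound_a_a_two k a).1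
        · exact (typeBound_a_a_two k a).2
      · rw [Nat.cast_sub (by omega)]
        rcases (show x = a + 2 ∨ x = a + 3 by omega) with rfl | rfl <;>
          (push_cast at hv ⊢; linarith)
  · rcases (show x = 3 ∨ 4 ≤ x by omega) with rfl | hx
    · obtain rfl : y = 3 := by omega
      obtain rfl : z = 3 := by omega
      refine Or.inr ⟨1, le_rfl, typeBound_three_three_three k, ?_, by omega⟩
      norm_num at hv
      exact_mod_cast hv
    · refine Or.inl ⟨(typeBound_four_three_three k).of_le (by decide) (by decide) _ ?_ ?_, by omega⟩
      · intro j
        fin_cases j <;> simp <;> omega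
      · intro j
        fin_cases j <;> simp [Fin.sum_univ_three] <;> omega

/-- Either the type dominates `[2, 2, 2, 1]`, or `z = w = 1` and balance forces `x ∈ {y, y + 1}`. -/
theorem outcome_four (x y z w : ℕ) (hxy : y ≤ x) (hyz : z ≤ y) (hzw : w ≤ z) (hw : 1 ≤ w)
    (h : x < y + z + w) : Outcome k ![x, y, z, w] := by
  unfold Outcome
  rw [dominatesVanishing_four]
  have hv := virtualDim_four x y z w
  rcases (show z = 1 ∨ 2 ≤ z by omega) with rfl | hz
  · obtain rfl : w = 1 := by omega
    obtain ⟨a, rfl⟩ : ∃ a, y = a + 1 := ⟨y - 1, by omega⟩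
    rcases (show 3 ≤ a ∨ a < 3 by omega) with ha | ha
    · refine Or.inl ⟨?_, by omega⟩
      rcases (show x = a + 1 ∨ x = a + 2 by omega) with rfl | rfl
      · exact (typeBound_a_a_one_one k a).1.mono (by omega)
      · exact (typeBound_a_a_one_one k a).2.mono (by omega)
    · refine Or.inr ⟨3 - a, by omega, ?_, ?_, by omega⟩
      · rcases (show x = a + 1 ∨ x = a + 2 by omega) with rfl | rfl
        · exact (typeBound_a_a_one_one k a).1
        · exact (typeBound_a_a_one_one k a).2
      · rw [Nat.cast_sub (by omega)]
        rcases (show x = a + 1 ∨ x = a + 2 by omega) with rfl | rfl <;>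
          (push_cast at hv ⊢; linarith)
  · refine Or.inl ⟨(typeBound_two_two_two_one k).of_le (by decide) (by decide) _ ?_ ?_, by omega⟩
    · intro j
      fin_cases j <;> simp <;> omega
    · intro j
      fin_cases j <;> simp [Fin.sum_univ_four] <;> omega

theorem outcome_five (x y z w t : ℕ) (hxy : y ≤ x) (hyz : z ≤ y) (hzw : w ≤ z) (hwt : t ≤ w)
    (ht : 1 ≤ t) (h : x < y + z + w + t) : Outcome k ![x, y, z, w, t] := by
  unfold Outcome
  rw [dominatesVanishing_five]
  rcases (show x = 1 ∨ 2 ≤ x by omega) with rfl | hx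
  · obtain rfl : y = 1 := by omega
    obtain rfl : z = 1 := by omega
    obtain rfl : w = 1 := by omega
    obtain rfl : t = 1 := by omega
    exact Or.inr ⟨1, le_rfl, typeBound_five_ones k, by decide, by omega⟩
  · refine Or.inl ⟨(typeBound_two_one_one_one_one k).of_le (by decide) (by decide) _ ?_ ?_,
      by omega⟩
    · intro j
      fin_cases j <;> simp <;> omega
    · intro j
      fin_cases j <;> simp [Fin.sum_univ_five] <;> omega

theorem outcome_six_le {r : ℕ} (hr : 6 ≤ r) (d : Fin r → ℕ) (hpos : ∀ i, 1 ≤ d i)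
    (hbal : ∀ j, 2 * d j < ∑ i, d i) : Outcome k d := by
  refine Or.inl ⟨?_, ?_⟩
  · let μ : Fin r → ℕ := fun i => if (i : ℕ) < 6 then 1 else 0
    have hμ1 : ∀ j, μ j ≤ 1 := fun j => by
      simp only [μ]
      split_ifs <;> omega
    have hsum : ∑ i, μ i = 6 := by
      obtain ⟨s, rfl⟩ := Nat.exists_eq_add_of_le hr
      rw [Fin.sum_univ_add]
      simp [μ]
    have hμ : TypeBound k μ 0 := by
      refine (typeBound_six_ones k).map μ (Fin.castLE hr) (Fin.castLE_injective hr) ?_ ?_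
      · intro i
        fin_cases i <;> simp [μ]
      · intro j hj
        simp only [μ, ite_eq_right_iff, one_ne_zero, imp_false]
        exact fun h => hj ⟨⟨j, h⟩, rfl⟩
    refine hμ.of_le ?_ ?_ d (fun j => (hμ1 j).trans (hpos j)) hbal
    · intro j
      have := hμ1 j
      omega
    · intro i j _
      have := hμ1 i
      have := hμ1 j
      omega
  · refine Or.inr (Or.inr (Or.inr (Or.inr (Or.inr ⟨hr, ?_⟩))))
    rw [Dominates, List.forall₂_iff_get]
    refine ⟨by simp, fun i h1 h2 => ?_⟩
    simp only [List.get_eq_getElem, List.getElem_replicate, List.getElem_ofFn]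
    exact hpos _

theorem outcome (r : ℕ) (hr : 2 ≤ r) (d : Fin r → ℕ) (hanti : Antitone d) (hpos : ∀ i, 1 ≤ d i)
    (i₀ : Fin r) (hi₀ : ∀ j, i₀ ≤ j) (hlt : d i₀ < ∑ i ∈ Finset.univ.erase i₀, d i) :
    Outcome k d := by
  have hbal : ∀ j, 2 * d j < ∑ i, d i := by
    intro j
    have h1 := hanti (hi₀ j)
    have h2 := Finset.add_sum_erase Finset.univ d (Finset.mem_univ i₀)
    omega
  rcases (show r = 2 ∨ r = 3 ∨ r = 4 ∨ r = 5 ∨ 6 ≤ r by omega) with rfl | rfl | rfl | rfl | hr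
  -- Two factors are impossible, since balance would give `d 0 < d 1`.
  · have h0 := hbal 0
    have h1 := hanti (show (0 : Fin 2) ≤ 1 by decide)
    rw [Fin.sum_univ_two] at h0
    omega
  · have h0 := hbal 0
    rw [Fin.sum_univ_three] at h0
    rw [eq_vec_three d]
    exact outcome_three k _ _ _ (hanti (by decide)) (hanti (by decide)) (hpos _) (by omega)
  · have h0 := hbal 0
    rw [Fin.sum_univ_four] at h0
    rw [eq_vec_four d]
    exact outcome_four k _ _ _ _ (hanti (by decide)) (hanti (by decide)) (hanti (by decide))
      (hpos _) (by omega)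
  · have h0 := hbal 0
    rw [Fin.sum_univ_five] at h0
    rw [eq_vec_five d]
    exact outcome_five k _ _ _ _ _ (hanti (by decide)) (hanti (by decide)) (hanti (by decide))
      (hanti (by decide)) (hpos _) (by omega)
  · exact outcome_six_le k hr d hpos hbal

end Cases

end ReducibleCurves

namespace ReducibleCurves

open Matrix

/-! ### The degree `d` part of `I_F` and its dimension -/

section Tangent

variable {k : Type*} [Field k] {r : ℕ}

theorem two_mul_pairSum (d : Fin r → ℕ) :
    2 * pairSum d + ∑ i, d i * d i = (∑ i, d i) * ∑ i, d i := by
  have h1 : (∑ i, d i) * ∑ i, d i = ∑ i, ∑ j, d i * d j := by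
    rw [Finset.sum_mul_sum]
  have h2 : ∀ i j : Fin r, d i * d j = (if i < j then d i * d j else 0) +
      (if j < i then d i * d j else 0) + if i = j then d i * d j else 0 := by
    intro i j
    rcases lt_trichotomy i j with h | h | h
    · simp [h, h.not_gt, h.ne]
    · simp [h]
    · simp [h, h.not_gt, h.ne']
  have h3 : pairSum d = ∑ i, ∑ j, if i < j then d i * d j else 0 := by
    simp only [pairSum, Finset.sum_filter]
  have h4 : pairSum d = ∑ i, ∑ j, if j < i then d i * d j else 0 := by
    rw [h3, Finset.sum_comm]
    exact Finset.sum_congr rfl fun i _ => Finset.sum_congr rfl fun j _ => by rw [mul_comm]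
  have h5 : ∑ i, ∑ j, (if i = j then d i * d j else 0) = ∑ i, d i * d i := by simp
  rw [h1, Finset.sum_congr rfl fun i _ => Finset.sum_congr rfl fun j _ => h2 i j]
  simp only [Finset.sum_add_distrib]
  rw [← h3, ← h4, h5]
  ring

/-- This is `∑ dim R_{d_i} - (r - 1) = dim R_d - D`: the image of `tangentMap` has codimension `D`
when the kernel has dimension `r - 1`. -/
theorem sum_choose_add_pairSum (d : Fin r → ℕ) :
    ∑ i, (d i + 2).choose 2 + pairSum d + 1 = (∑ i, d i + 2).choose 2 + r := by
  have h1 := two_mul_choose_two (∑ i, d i)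
  have h2 : (2 : ℤ) * (∑ i, (d i + 2).choose 2 : ℕ) = ∑ i, ((d i : ℤ) + 2) * (d i + 1) := by
    push_cast
    rw [Finset.mul_sum]
    exact Finset.sum_congr rfl fun i _ => by exact_mod_cast two_mul_choose_two (d i)
  have h3 : ∑ i, ((d i : ℤ) + 2) * (d i + 1) =
      ∑ i, (d i : ℤ) * d i + 3 * ∑ i, (d i : ℤ) + 2 * r := by
    rw [Finset.mul_sum, ← Finset.sum_add_distrib]
    have : (2 * r : ℤ) = ∑ _i : Fin r, 2 := by simp [mul_comm]
    rw [this, ← Finset.sum_add_distrib]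
    exact Finset.sum_congr rfl fun i _ => by ring
  have h4 : (2 : ℤ) * pairSum d + ∑ i, (d i : ℤ) * d i = (∑ i, (d i : ℤ)) * ∑ i, (d i : ℤ) := by
    exact_mod_cast two_mul_pairSum d
  zify
  push_cast at h1 h2
  nlinarith

/-- The tuples `(H_i)` are mapped to `∑ (F / F_i) H_i`. -/
noncomputable def tangentMap (d : Fin r → ℕ) (F : Fin r → MvPolynomial (Fin 3) k) :
    (∀ i, homogeneousSubmodule (Fin 3) k (d i)) →ₗ[k] MvPolynomial (Fin 3) k :=
  ∑ i, LinearMap.mulLeft k (cofactor F i) ∘ₗ Submodule.subtype _ ∘ₗ LinearMap.proj i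

theorem tangentMap_apply (d : Fin r → ℕ) (F : Fin r → MvPolynomial (Fin 3) k)
    (h : ∀ i, homogeneousSubmodule (Fin 3) k (d i)) :
    tangentMap d F h = ∑ i, cofactor F i * (h i : MvPolynomial (Fin 3) k) := by
  simp [tangentMap]

theorem cofactor_mul (F : Fin r → MvPolynomial (Fin 3) k) (i : Fin r) :
    cofactor F i * F i = ∏ j, F j :=
  Finset.prod_erase_mul _ _ (Finset.mem_univ i)

theorem cofactor_isHomogeneous {d : Fin r → ℕ} {F : Fin r → MvPolynomial (Fin 3) k}
    (hF : IsFactorTuple d F) (i : Fin r) :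
    (cofactor F i).IsHomogeneous (∑ j ∈ Finset.univ.erase i, d j) :=
  IsHomogeneous.prod _ _ _ fun j _ => hF j

theorem tangentMap_isHomogeneous {d : Fin r → ℕ} {F : Fin r → MvPolynomial (Fin 3) k}
    (hF : IsFactorTuple d F) (h : ∀ i, homogeneousSubmodule (Fin 3) k (d i)) :
    (tangentMap d F h).IsHomogeneous (∑ i, d i) := by
  rw [tangentMap_apply]
  refine IsHomogeneous.sum _ _ _ fun i _ => ?_
  have := (cofactor_isHomogeneous hF i).mul (h i).2
  rwa [Finset.sum_erase_add _ _ (Finset.mem_univ i)] at this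

theorem degreePart_cofactorIdeal {d : Fin r → ℕ} {F : Fin r → MvPolynomial (Fin 3) k}
    (hF : IsFactorTuple d F) :
    degreePart (cofactorIdeal F) (∑ i, d i) = LinearMap.range (tangentMap d F) := by
  apply le_antisymm
  · rintro f ⟨hf, hfh⟩
    have hf' : f ∈ Ideal.span (Set.range (cofactor F)) := hf
    rw [Ideal.mem_span_range_iff_exists_fun] at hf'
    obtain ⟨K, hK⟩ := hf'
    refine ⟨fun i => ⟨homogeneousComponent (d i) (K i), homogeneousComponent_isHomogeneous _ _⟩, ?_⟩
    rw [tangentMap_apply, ← homogeneousComponent_eq_self hfh, ← hK, map_sum]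
    refine Finset.sum_congr rfl fun i _ => ?_
    rw [mul_comm (K i), ← Finset.add_sum_erase _ _ (Finset.mem_univ i),
      homogeneousComponent_mul_of_isHomogeneous (cofactor_isHomogeneous hF i)]
  · rintro _ ⟨h, rfl⟩
    refine ⟨?_, tangentMap_isHomogeneous hF h⟩
    rw [tangentMap_apply]
    exact Ideal.sum_mem _ fun i _ => Ideal.mul_mem_right _ _ (Ideal.subset_span ⟨i, rfl⟩)

/-- Multiples `(c_i F_i)` of the factors. -/
noncomputable def multiples {d : Fin r → ℕ} {F : Fin r → MvPolynomial (Fin 3) k}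
    (hF : IsFactorTuple d F) : (Fin r → k) →ₗ[k] ∀ i, homogeneousSubmodule (Fin 3) k (d i) :=
  LinearMap.pi fun i => (LinearMap.proj i).smulRight ⟨F i, hF i⟩

theorem multiples_apply {d : Fin r → ℕ} {F : Fin r → MvPolynomial (Fin 3) k}
    (hF : IsFactorTuple d F) (c : Fin r → k) (i : Fin r) :
    (multiples hF c i : MvPolynomial (Fin 3) k) = c i • F i := rfl

theorem tangentMap_multiples {d : Fin r → ℕ} {F : Fin r → MvPolynomial (Fin 3) k}
    (hF : IsFactorTuple d F) (c : Fin r → k) :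
    tangentMap d F (multiples hF c) = (∑ i, c i) • ∏ j, F j := by
  rw [tangentMap_apply, Finset.sum_smul]
  refine Finset.sum_congr rfl fun i _ => ?_
  rw [multiples_apply, mul_smul_comm, cofactor_mul]

variable (k) in
/-- The sum of the coordinates. -/
def coordSum (r : ℕ) : (Fin r → k) →ₗ[k] k := ∑ i, LinearMap.proj i

theorem coordSum_apply (c : Fin r → k) : coordSum k r c = ∑ i, c i := by simp [coordSum]

theorem finrank_ker_coordSum (hr : 1 ≤ r) :
    Module.finrank k (LinearMap.ker (coordSum k r)) + 1 = r := by
  have h := LinearMap.finrank_range_add_finrank_ker (coordSum k r)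
  have hs : LinearMap.range (coordSum k r) = ⊤ := by
    rw [LinearMap.range_eq_top]
    intro t
    refine ⟨Pi.single ⟨0, hr⟩ t, ?_⟩
    rw [coordSum_apply]
    simp
  rw [hs, finrank_top, Module.finrank_self, Module.finrank_fin_fun] at h
  omega

/-- The tuples `(c_i F_i)` with `∑ c_i = 0` are always relations. -/
theorem le_finrank_ker_tangentMap (hr : 1 ≤ r) {d : Fin r → ℕ}
    {F : Fin r → MvPolynomial (Fin 3) k} (hF : IsFactorTuple d F) (h0 : ∀ i, F i ≠ 0) :
    r ≤ Module.finrank k (LinearMap.ker (tangentMap d F)) + 1 := by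
  have hinj : Function.Injective (multiples hF) := by
    rw [injective_iff_map_eq_zero]
    intro c hc
    ext i
    have := congrArg (fun h => ((h i : homogeneousSubmodule (Fin 3) k (d i)) :
      MvPolynomial (Fin 3) k)) hc
    simp only [multiples_apply] at this
    exact (smul_eq_zero.mp this).resolve_right (h0 i)
  have hle : (LinearMap.ker (coordSum k r)).map (multiples hF) ≤ LinearMap.ker (tangentMap d F) := by
    rintro _ ⟨c, hc, rfl⟩
    have hc' : coordSum k r c = 0 := hc
    rw [LinearMap.mem_ker, tangentMap_multiples, ← coordSum_apply, hc', zero_smul]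
  have h1 := Submodule.finrank_mono hle
  rw [← (Submodule.equivMapOfInjective (multiples hF) hinj _).finrank_eq] at h1
  have := finrank_ker_coordSum (k := k) hr
  omega

/-- In a relation `∑ (F / F_i) H_i = 0` all terms but the `i`-th are divisible by `F_i`, so
coprimality gives `F_i ∣ H_i`. As the degrees agree, the quotient is a constant. -/
theorem finrank_ker_tangentMap_le (hr : 1 ≤ r) {d : Fin r → ℕ}
    {F : Fin r → MvPolynomial (Fin 3) k} (hF : IsFactorTuple d F) (h0 : ∀ i, F i ≠ 0)
    (hrel : ∀ i j, i ≠ j → IsRelPrime (F i) (F j)) :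
    Module.finrank k (LinearMap.ker (tangentMap d F)) + 1 ≤ r := by
  have hle : LinearMap.ker (tangentMap d F) ≤ (LinearMap.ker (coordSum k r)).map (multiples hF) := by
    intro h hh
    rw [LinearMap.mem_ker, tangentMap_apply] at hh
    have hdvd : ∀ i, F i ∣ (h i : MvPolynomial (Fin 3) k) := by
      intro i
      have h1 : F i ∣ cofactor F i * (h i : MvPolynomial (Fin 3) k) := by
        rw [← Finset.add_sum_erase _ _ (Finset.mem_univ i)] at hh
        rw [eq_neg_of_add_eq_zero_left hh, dvd_neg]
        refine Finset.dvd_sum fun j hj => Dvd.dvd.mul_right ?_ _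
        exact Finset.dvd_prod_of_mem _ (by simpa using (Finset.ne_of_mem_erase hj).symm)
      refine IsRelPrime.dvd_of_dvd_mul_left ?_ h1
      exact IsRelPrime.prod_right fun j hj => hrel i j (Finset.ne_of_mem_erase hj).symm
    have hc : ∀ i, ∃ c : k, (h i : MvPolynomial (Fin 3) k) = c • F i := by
      intro i
      obtain ⟨g, hg⟩ := hdvd i
      refine ⟨coeff 0 g, ?_⟩
      have := homogeneousComponent_mul_of_isHomogeneous (hF i) g 0
      rw [zero_add, ← hg, homogeneousComponent_eq_self (h i).2, homogeneousComponent_zero,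
        mul_comm] at this
      rw [this, smul_eq_C_mul]
    choose c hc using hc
    have hm : multiples hF c = h := by
      ext1 i
      exact Subtype.ext (hc i).symm
    refine ⟨c, ?_, hm⟩
    have h2 := tangentMap_multiples hF c
    rw [hm, tangentMap_apply, hh, eq_comm, smul_eq_zero, ← coordSum_apply] at h2
    exact h2.resolve_right (Finset.prod_ne_zero_iff.mpr fun i _ => h0 i)
  have h1 := (Submodule.finrank_mono hle).trans (Submodule.finrank_map_le _ _)
  have := finrank_ker_coordSum (k := k) hr
  omega

theorem finrank_range_tangentMap (d : Fin r → ℕ) (F : Fin r → MvPolynomial (Fin 3) k) :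
    Module.finrank k (LinearMap.range (tangentMap d F)) +
      Module.finrank k (LinearMap.ker (tangentMap d F)) = ∑ i, (d i + 2).choose 2 := by
  rw [LinearMap.finrank_range_add_finrank_ker, Module.finrank_pi_fintype]
  simp only [finrank_homogeneousSubmodule]

end Tangent

/-! ### Saturatedness of `I_F` by restriction to `x₀ = 0` -/

section Saturation

variable {k : Type*} [Field k] {r : ℕ}

/-- Multiplication by `x₀` on forms of degree `n`. -/
noncomputable def mulX (k : Type*) [Field k] (n : ℕ) :
    homogeneousSubmodule (Fin 3) k n →ₗ[k] MvPolynomial (Fin 3) k :=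
  LinearMap.mulLeft k (X 0) ∘ₗ Submodule.subtype _

theorem mulX_apply (n : ℕ) (g : homogeneousSubmodule (Fin 3) k n) :
    mulX k n g = X 0 * (g : MvPolynomial (Fin 3) k) := by
  simp [mulX]

theorem lin_single (i : Fin 3) : lin (Pi.single i (1 : k)) = X i := by
  simp only [lin, Pi.single_apply]
  rw [Finset.sum_eq_single i] <;> simp +contextual

variable (k) in
/-- Setting `x₀ = 0`. -/
noncomputable def setZero : MvPolynomial (Fin 3) k →ₐ[k] MvPolynomial (Fin 3) k :=
  lineProj (Pi.single 0 1) (Pi.single 0 1)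

theorem X_dvd_iff_setZero (f : MvPolynomial (Fin 3) k) : X 0 ∣ f ↔ setZero k f = 0 := by
  rw [← lin_single, setZero]
  exact lin_dvd_iff_lineProj (by simp) f

theorem setZero_X_zero : setZero k (X 0) = 0 := (X_dvd_iff_setZero _).mp dvd_rfl

theorem setZero_X {i : Fin 3} (hi : i ≠ 0) : setZero k (X i) = X i := by
  simp [setZero, lineProj, hi]

theorem setZero_setZero (f : MvPolynomial (Fin 3) k) : setZero k (setZero k f) = setZero k f := by
  have : X 0 ∣ f - setZero k f := by
    have := lin_dvd_sub_lineProj (Pi.single 0 1) (Pi.single 0 (1 : k)) f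
    rwa [lin_single] at this
  rw [X_dvd_iff_setZero, map_sub, sub_eq_zero] at this
  exact this.symm

theorem eval_zero_setZero (f : MvPolynomial (Fin 3) k) :
    eval (0 : Fin 3 → k) (setZero k f) = eval 0 f := by
  rw [setZero, eval_lineProj]
  simp

theorem isRelPrime_X_pow (n : ℕ) :
    IsRelPrime ((X 1 : MvPolynomial (Fin 3) k) ^ n) (X 2 ^ n) := by
  apply IsRelPrime.pow
  rw [← lin_single, ← lin_single]
  apply isRelPrime_lin
  intro h
  have := congrFun h 0
  simp [cross_apply] at this

variable {d : Fin r → ℕ} {F : Fin r → MvPolynomial (Fin 3) k}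

theorem setZero_cofactor_dvd {e : ℕ} {f : MvPolynomial (Fin 3) k}
    (hf : f ∈ LinearMap.range ((tangentMap d F).coprod (mulX k e))) {g : MvPolynomial (Fin 3) k}
    (hg : ∀ i, g ∣ setZero k (cofactor F i)) : g ∣ setZero k f := by
  obtain ⟨⟨h, q⟩, rfl⟩ := hf
  rw [LinearMap.coprod_apply, tangentMap_apply, mulX_apply, map_add, map_mul, setZero_X_zero,
    zero_mul, add_zero, map_sum]
  refine Finset.dvd_sum fun i _ => ?_
  rw [map_mul]
  exact (hg i).mul_right _

/-- Since `I_F + (x₀)` contains `x₁ ^ n` and `x₂ ^ n`, a common divisor of the restricted cofactors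
divides both. Membership in the range of a linear map is used in `hC` because it can be controlled
by ranks. -/
theorem isUnit_of_dvd_setZero_cofactor {e n : ℕ}
    (hC : ∀ i : Fin 3, X i ^ n ∈ LinearMap.range ((tangentMap d F).coprod (mulX k e)))
    {g : MvPolynomial (Fin 3) k} (hg : ∀ i, g ∣ setZero k (cofactor F i)) : IsUnit g := by
  have h1 := setZero_cofactor_dvd (hC 1) hg
  have h2 := setZero_cofactor_dvd (hC 2) hg
  rw [map_pow, setZero_X (by decide)] at h1 h2
  exact isRelPrime_X_pow n h1 h2

/-- Every cofactor contains `F i` or `F j`, so a common divisor of their restrictions divides all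
restricted cofactors. -/
theorem isRelPrime_setZero {e n : ℕ}
    (hC : ∀ i : Fin 3, X i ^ n ∈ LinearMap.range ((tangentMap d F).coprod (mulX k e)))
    {i j : Fin r} (hij : i ≠ j) : IsRelPrime (setZero k (F i)) (setZero k (F j)) := by
  intro g hgi hgj
  refine isUnit_of_dvd_setZero_cofactor hC fun l => ?_
  rw [cofactor, map_prod]
  by_cases hl : i = l
  · exact hgj.trans (Finset.dvd_prod_of_mem (fun j => setZero k (F j)) (by simp [← hl, hij.symm]))
  · exact hgi.trans (Finset.dvd_prod_of_mem (fun j => setZero k (F j)) (by simp [hl]))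

/-- Were it zero, all restricted cofactors but the `i`-th would vanish, and that one would be a unit
although it vanishes at the origin. -/
theorem setZero_ne_zero (hr : 2 ≤ r) (hpos : ∀ i, 1 ≤ d i) (hF : IsFactorTuple d F) {e n : ℕ}
    (hC : ∀ i : Fin 3, X i ^ n ∈ LinearMap.range ((tangentMap d F).coprod (mulX k e)))
    (i : Fin r) : setZero k (F i) ≠ 0 := by
  intro h0
  have hu : IsUnit (setZero k (cofactor F i)) := by
    refine isUnit_of_dvd_setZero_cofactor hC fun l => ?_
    by_cases hl : i = l
    · rw [hl]
    · have : setZero k (cofactor F l) = 0 := by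
        rw [cofactor, map_prod]
        exact Finset.prod_eq_zero (i := i) (by simp [hl]) h0
      rw [this]
      exact dvd_zero _
  have := Fin.nontrivial_iff_two_le.mpr hr
  obtain ⟨j, hj⟩ := exists_ne i
  have h1 := hu.map (eval (0 : Fin 3 → k))
  rw [eval_zero_setZero, cofactor, map_prod, Finset.prod_eq_zero (i := j) (by simp [hj])] at h1
  · exact not_isUnit_zero h1
  · have := eval_smul_of_isHomogeneous (hF j) 0 0
    rw [zero_smul, zero_pow (by have := hpos j; omega), zero_mul] at this
    exact this

/-- On `x₀ = 0` the representation of `x₀ f` becomes a relation between the cofactors, so there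
`H_i` is a multiple `F_i c_i`. Lifting, `x₀ f` is `(∏ F_j) ∑ c_i` plus `x₀` times an element of
`I_F`. As `∏ F_j` is nonzero on `x₀ = 0`, `x₀` divides `∑ c_i` and can be cancelled. -/
theorem mem_cofactorIdeal_of_X_mul_mem (hr : 2 ≤ r) (hpos : ∀ i, 1 ≤ d i)
    (hF : IsFactorTuple d F) {e n : ℕ}
    (hC : ∀ i : Fin 3, X i ^ n ∈ LinearMap.range ((tangentMap d F).coprod (mulX k e)))
    {f : MvPolynomial (Fin 3) k} (hf : X 0 * f ∈ cofactorIdeal F) : f ∈ cofactorIdeal F := by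
  rw [cofactorIdeal, Ideal.mem_span_range_iff_exists_fun] at hf
  obtain ⟨H, hH⟩ := hf
  have hπ : ∑ i, setZero k (H i) * setZero k (cofactor F i) = 0 := by
    have := congrArg (setZero k) hH
    rw [map_mul, setZero_X_zero, zero_mul, map_sum] at this
    simpa only [map_mul] using this
  have hdvd : ∀ i, setZero k (F i) ∣ setZero k (H i) := by
    intro i
    have h1 : setZero k (F i) ∣ setZero k (H i) * setZero k (cofactor F i) := by
      rw [← Finset.add_sum_erase _ _ (Finset.mem_univ i)] at hπ
      rw [eq_neg_of_add_eq_zero_left hπ, dvd_neg]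
      refine Finset.dvd_sum fun j hj => Dvd.dvd.mul_left ?_ _
      exact map_dvd _ (Finset.dvd_prod_of_mem _ (by simpa using (Finset.ne_of_mem_erase hj).symm))
    refine IsRelPrime.dvd_of_dvd_mul_right ?_ h1
    rw [cofactor, map_prod]
    exact IsRelPrime.prod_right fun j hj => isRelPrime_setZero hC (Finset.ne_of_mem_erase hj).symm
  have hex : ∀ i, ∃ c H', H i = F i * c + X 0 * H' := by
    intro i
    obtain ⟨c, hc⟩ := hdvd i
    have : X 0 ∣ H i - F i * setZero k c := by
      have hc' := congrArg (setZero k) hc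
      rw [setZero_setZero, map_mul, setZero_setZero] at hc'
      rw [X_dvd_iff_setZero, map_sub, map_mul, setZero_setZero, hc', sub_self]
    obtain ⟨H', hH'⟩ := this
    exact ⟨setZero k c, H', by linear_combination hH'⟩
  choose c H' hcH using hex
  have hsum : X 0 * f = (∏ j, F j) * ∑ i, c i + X 0 * ∑ i, H' i * cofactor F i := by
    rw [← hH, Finset.mul_sum, Finset.mul_sum, ← Finset.sum_add_distrib]
    refine Finset.sum_congr rfl fun i _ => ?_
    rw [hcH, ← cofactor_mul F i]
    ring
  have h1 : X 0 ∣ ∑ i, c i := by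
    have h2 := congrArg (setZero k) hsum
    rw [map_add, map_mul, map_mul, map_mul, setZero_X_zero, zero_mul, zero_mul, add_zero, eq_comm,
      mul_eq_zero, map_prod] at h2
    rw [X_dvd_iff_setZero]
    exact h2.resolve_left
      (Finset.prod_ne_zero_iff.mpr fun i _ => setZero_ne_zero hr hpos hF hC i)
  obtain ⟨c', hc'⟩ := h1
  have hfeq : f = (∏ j, F j) * c' + ∑ i, H' i * cofactor F i := by
    apply mul_left_cancel₀ (X_ne_zero (R := k) (0 : Fin 3))
    rw [hsum, hc']
    ring
  have hmem : ∀ i, cofactor F i ∈ cofactorIdeal F := fun i => Ideal.subset_span ⟨i, rfl⟩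
  rw [hfeq, ← cofactor_mul F ⟨0, two_pos.trans_le hr⟩]
  exact Ideal.add_mem _ (Ideal.mul_mem_right _ _ (Ideal.mul_mem_right _ _ (hmem _)))
    (Ideal.sum_mem _ fun i _ => Ideal.mul_mem_left _ _ (hmem i))

theorem saturation_cofactorIdeal (hr : 2 ≤ r) (hpos : ∀ i, 1 ≤ d i)
    (hF : IsFactorTuple d F) {e n : ℕ}
    (hC : ∀ i : Fin 3, X i ^ n ∈ LinearMap.range ((tangentMap d F).coprod (mulX k e))) :
    saturation (cofactorIdeal F) = cofactorIdeal F := by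
  apply le_antisymm
  · rintro f ⟨m, hm⟩
    have h := hm (X 0 ^ m) (Ideal.pow_mem_pow
      (show X 0 ∈ irrelevantIdeal k from Ideal.subset_span ⟨0, rfl⟩) m)
    clear hm
    induction m with
    | zero => simpa using h
    | succ m ih =>
      apply ih
      apply mem_cofactorIdeal_of_X_mul_mem hr hpos hF hC
      rwa [pow_succ', mul_assoc] at h
  · intro f hf
    exact ⟨0, fun g _ => Ideal.mul_mem_left _ _ hf⟩

end Saturation

end ReducibleCurves

namespace ReducibleCurves

open Matrix

/-! ### Products of lines as special factors -/

section Witness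

variable {k : Type*} [Field k] {r : ℕ} {ι : Type*}

/-- The forms that are the products of the lines of each colour. -/
noncomputable def lineProducts [Fintype ι] (c : ι → Fin r) (a : ι → Fin 3 → k) :
    Fin r → MvPolynomial (Fin 3) k :=
  fun i => ∏ j ∈ Finset.univ.filter fun j => c j = i, lin (a j)

theorem lineProducts_isFactorTuple [Fintype ι] (c : ι → Fin r) (a : ι → Fin 3 → k) :
    IsFactorTuple (colourCard c) (lineProducts c a) := by
  intro i
  have := IsHomogeneous.prod (Finset.univ.filter fun j => c j = i)
    (fun j => lin (a j)) (fun _ => 1) fun j _ => lin_isHomogeneous (a j)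
  rwa [Finset.sum_const, smul_eq_mul, mul_one] at this

theorem lineProducts_ne_zero [Fintype ι] (c : ι → Fin r) {a : ι → Fin 3 → k}
    (ha : ∀ j, a j ≠ 0) (i : Fin r) : lineProducts c a i ≠ 0 :=
  Finset.prod_ne_zero_iff.mpr fun j _ => lin_ne_zero (ha j)

theorem isRelPrime_lineProducts [Fintype ι] (c : ι → Fin r) {a : ι → Fin 3 → k}
    (ha : ∀ i j, i ≠ j → a i ⨯₃ a j ≠ 0) {i j : Fin r} (hij : i ≠ j) :
    IsRelPrime (lineProducts c a i) (lineProducts c a j) := by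
  refine IsRelPrime.prod_left fun u hu => IsRelPrime.prod_right fun v hv => ?_
  refine isRelPrime_lin (ha u v ?_)
  rintro rfl
  simp only [Finset.mem_filter, Finset.mem_univ, true_and] at hu hv
  exact hij (hu.symm.trans hv)

theorem lin_dvd_cofactor_lineProducts [Fintype ι] (c : ι → Fin r) (a : ι → Fin 3 → k) {j : ι}
    {i : Fin r} (h : c j ≠ i) : lin (a j) ∣ cofactor (lineProducts c a) i := by
  refine dvd_trans ?_ (Finset.dvd_prod_of_mem (lineProducts c a) (a := c j) (by simpa using h))
  exact Finset.dvd_prod_of_mem (fun j => lin (a j)) (by simp)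

theorem eval_tangentMap_lineProducts [Fintype ι] (c : ι → Fin r) (a : ι → Fin 3 → k)
    {f : MvPolynomial (Fin 3) k} {d : Fin r → ℕ}
    (hf : f ∈ LinearMap.range (tangentMap d (lineProducts c a))) {p : Fin 3 → k}
    (hp : p ∈ crossPoints c a) : eval p f = 0 := by
  obtain ⟨h, rfl⟩ := hf
  obtain ⟨i, j, hij, rfl⟩ := hp
  rw [tangentMap_apply, map_sum]
  refine Finset.sum_eq_zero fun l _ => ?_
  rw [map_mul]
  refine mul_eq_zero_of_left ?_ _
  by_cases hl : c i = l
  · obtain ⟨g, hg⟩ := lin_dvd_cofactor_lineProducts c a (j := j) (i := l) (by rw [← hl]; exact hij.symm)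
    rw [hg, map_mul, eval_lin, dot_cross_self, zero_mul]
  · obtain ⟨g, hg⟩ := lin_dvd_cofactor_lineProducts c a (j := i) (i := l) hl
    rw [hg, map_mul, eval_lin, dot_self_cross, zero_mul]

/-- Cramer's rule: the lines meet off `x₀ = 0`, so `lin u`, `lin v`, `x₀` form a basis of the linear
forms. -/
theorem exists_X_eq {u v : Fin 3 → k} (h : (u ⨯₃ v) 0 ≠ 0) (i : Fin 3) :
    ∃ α β δ : k, (X i : MvPolynomial (Fin 3) k) = C α * lin u + C β * lin v + C δ * X 0 := by
  have hD : u 1 * v 2 - u 2 * v 1 ≠ 0 := by simpa [cross_apply] using h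
  set D := u 1 * v 2 - u 2 * v 1 with hDdef
  have hCD : (C D : MvPolynomial (Fin 3) k) * C D⁻¹ = 1 := by
    rw [← C_mul, mul_inv_cancel₀ hD, C_1]
  have hCD' : (C D : MvPolynomial (Fin 3) k) = C (u 1) * C (v 2) - C (u 2) * C (v 1) := by
    rw [hDdef]
    simp
  have key : ∀ y z : MvPolynomial (Fin 3) k, C D * y = z → y = C D⁻¹ * z := by
    intro y z hyz
    rw [← hyz, ← mul_assoc, mul_comm (C D⁻¹), hCD, one_mul]
  fin_cases i
  · exact ⟨0, 0, 1, by simp⟩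
  · refine ⟨D⁻¹ * v 2, D⁻¹ * -u 2, D⁻¹ * (u 2 * v 0 - v 2 * u 0), ?_⟩
    have := key (X 1) (C (v 2) * lin u + C (-u 2) * lin v + C (u 2 * v 0 - v 2 * u 0) * X 0) (by
      rw [hCD']
      simp only [lin, Fin.sum_univ_three, C_sub, C_mul, C_neg]
      ring)
    simp only [C_mul]
    change X 1 = _
    rw [this]
    ring
  · refine ⟨D⁻¹ * -v 1, D⁻¹ * u 1, D⁻¹ * (v 1 * u 0 - u 1 * v 0), ?_⟩
    have := key (X 2) (C (-v 1) * lin u + C (u 1) * lin v + C (v 1 * u 0 - u 1 * v 0) * X 0) (by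
      rw [hCD']
      simp only [lin, Fin.sum_univ_three, C_sub, C_mul, C_neg]
      ring)
    simp only [C_mul]
    change X 2 = _
    rw [this]
    ring

/-- The lines cut `x₀ = 0` in distinct points, and the products omitting one line restrict to the
Lagrange basis of the binary forms of degree `|A| - 1`. For the induction a variable is expressed by
`lin (a j)`, `lin (a t)` and `x₀`. -/
theorem irrelevantIdeal_pow_le [DecidableEq ι] {a : ι → Fin 3 → k}
    (ha : ∀ i j, i ≠ j → (a i ⨯₃ a j) 0 ≠ 0) (A : Finset ι) (hA : A.Nonempty) :
    irrelevantIdeal k ^ (A.card - 1) ≤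
      Ideal.span ({X 0} ∪ (fun j => ∏ l ∈ A.erase j, lin (a l)) '' A) := by
  induction hA using Finset.Nonempty.cons_induction with
  | singleton t =>
    have : (1 : MvPolynomial (Fin 3) k) ∈
        Ideal.span ({X 0} ∪ (fun j => ∏ l ∈ ({t} : Finset ι).erase j, lin (a l)) ''
          (({t} : Finset ι) : Set ι)) :=
      Ideal.subset_span (Or.inr ⟨t, by simp, by simp⟩)
    rw [(Ideal.eq_top_iff_one _).mpr this]
    exact le_top
  | cons t A ht hA ih =>
    have hcard : (Finset.cons t A ht).card - 1 = (A.card - 1) + 1 := by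
      rw [Finset.card_cons]
      have := hA.card_pos
      omega
    rw [hcard, pow_succ]
    refine (Ideal.mul_mono_left ih).trans ?_
    rw [irrelevantIdeal, Ideal.span_mul_span', Ideal.span_le]
    rintro _ ⟨s, hs, _, ⟨i, rfl⟩, rfl⟩
    rw [SetLike.mem_coe]
    simp only
    have hX : (X 0 : MvPolynomial (Fin 3) k) ∈ Ideal.span ({X 0} ∪
        (fun j => ∏ l ∈ (Finset.cons t A ht).erase j, lin (a l)) '' (Finset.cons t A ht : Set ι)) :=
      Ideal.subset_span (Or.inl rfl)
    rcases hs with hs | ⟨j, hj, rfl⟩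
    · rw [Set.mem_singleton_iff.mp hs]
      exact Ideal.mul_mem_right _ _ hX
    · have hjt : j ≠ t := fun h => ht (h ▸ hj)
      have hgen : ∀ l ∈ Finset.cons t A ht, ∏ l ∈ (Finset.cons t A ht).erase l, lin (a l) ∈
          Ideal.span ({X 0} ∪ (fun j => ∏ l ∈ (Finset.cons t A ht).erase j, lin (a l)) ''
            (Finset.cons t A ht : Set ι)) :=
        fun l hl => Ideal.subset_span (Or.inr ⟨l, hl, rfl⟩)
      have h1 := hgen t (by simp)
      have h2 := hgen j (by simp [show j ∈ A from hj])
      rw [Finset.erase_cons, ← Finset.prod_erase_mul A _ hj] at h1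
      have h3 : (Finset.cons t A ht).erase j = Finset.cons t (A.erase j) (by simp [ht]) := by
        ext l
        simp only [Finset.mem_erase, Finset.mem_cons]
        constructor
        · rintro ⟨hl, rfl | hl'⟩
          · exact Or.inl rfl
          · exact Or.inr ⟨hl, hl'⟩
        · rintro (rfl | ⟨hl, hl'⟩)
          · exact ⟨hjt.symm, Or.inl rfl⟩
          · exact ⟨hl, Or.inr hl'⟩
      rw [h3, Finset.prod_cons] at h2
      obtain ⟨α, β, δ, hi⟩ := exists_X_eq (ha j t hjt) i
      rw [hi]
      have e : (∏ l ∈ A.erase j, lin (a l)) * (C α * lin (a j) + C β * lin (a t) + C δ * X 0) =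
          C α * ((∏ l ∈ A.erase j, lin (a l)) * lin (a j)) +
          C β * (lin (a t) * ∏ l ∈ A.erase j, lin (a l)) +
          (C δ * ∏ l ∈ A.erase j, lin (a l)) * X 0 := by ring
      rw [e]
      exact Ideal.add_mem _ (Ideal.add_mem _ (Ideal.mul_mem_left _ _ h1)
        (Ideal.mul_mem_left _ _ h2)) (Ideal.mul_mem_left _ _ hX)

theorem homogeneous_mem_irrelevantIdeal_pow {f : MvPolynomial (Fin 3) k} {n : ℕ}
    (hf : f.IsHomogeneous n) : f ∈ irrelevantIdeal k ^ n := by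
  rw [f.as_sum]
  refine Ideal.sum_mem _ fun α hα => ?_
  rw [monomial_eq]
  refine Ideal.mul_mem_left _ _ ?_
  rw [hf.degree_eq_sum_deg_support hα, ← Finset.prod_pow_eq_pow_sum, Finsupp.prod]
  exact Ideal.prod_mem_prod fun i _ => Ideal.pow_mem_pow
    (show X i ∈ irrelevantIdeal k from Ideal.subset_span ⟨i, rfl⟩) _

/-- The cofactor of colour `c j` is the product of the lines of all other colours, hence divides the
product omitting only `j`. -/
theorem prod_erase_mem_cofactorIdeal [Fintype ι] [DecidableEq ι] (c : ι → Fin r)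
    (a : ι → Fin 3 → k) (j : ι) :
    ∏ l ∈ Finset.univ.erase j, lin (a l) ∈ cofactorIdeal (lineProducts c a) := by
  have h : cofactor (lineProducts c a) (c j) ∈ cofactorIdeal (lineProducts c a) :=
    Ideal.subset_span ⟨_, rfl⟩
  refine Ideal.mem_of_dvd _ ?_ h
  have h1 : cofactor (lineProducts c a) (c j) = ∏ l ∈ Finset.univ.filter fun l => c l ≠ c j,
      lin (a l) := by
    rw [cofactor, ← Finset.prod_fiberwise_of_maps_to (g := c) (t := Finset.univ.erase (c j))
      (s := Finset.univ.filter fun l => c l ≠ c j) (by simp)]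
    refine Finset.prod_congr rfl fun i hi => ?_
    rw [lineProducts, Finset.filter_filter]
    refine Finset.prod_congr ?_ fun _ _ => rfl
    ext l
    simp only [Finset.mem_filter, Finset.mem_univ, true_and]
    exact ⟨fun h => ⟨h ▸ Finset.ne_of_mem_erase hi, h⟩, fun h => h.2⟩
  rw [h1]
  refine Finset.prod_dvd_prod_of_subset _ _ _ fun l hl => ?_
  simp only [Finset.mem_filter, Finset.mem_univ, true_and] at hl
  simp only [Finset.mem_erase, Finset.mem_univ, and_true]
  rintro rfl
  exact hl rfl

/-- Forms of degree `|d|` lie in `I_F + (x₀)`. -/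
theorem mem_range_coprod_of_irrelevantIdeal {d : Fin r → ℕ} {F : Fin r → MvPolynomial (Fin 3) k}
    (hF : IsFactorTuple d F) {n : ℕ} (hn : ∑ i, d i = n + 1) {f : MvPolynomial (Fin 3) k}
    (hf : f.IsHomogeneous (n + 1)) (hmem : f ∈ Ideal.span {X 0} ⊔ cofactorIdeal F) :
    f ∈ LinearMap.range ((tangentMap d F).coprod (mulX k n)) := by
  obtain ⟨g, hg, q, hq, rfl⟩ := Submodule.mem_sup.mp hmem
  obtain ⟨g', rfl⟩ := Ideal.mem_span_singleton.mp hg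
  have h1 : homogeneousComponent (n + 1) (X 0 * g') = X 0 * homogeneousComponent n g' :=
    homogeneousComponent_mul_of_isHomogeneous (isHomogeneous_X k 0) g' n
  have h2 : homogeneousComponent (n + 1) q ∈ LinearMap.range (tangentMap d F) := by
    rw [cofactorIdeal, Ideal.mem_span_range_iff_exists_fun] at hq
    obtain ⟨K, hK⟩ := hq
    refine ⟨fun i => ⟨homogeneousComponent (d i) (K i), homogeneousComponent_isHomogeneous _ _⟩, ?_⟩
    rw [tangentMap_apply, ← hK, map_sum, ← hn]
    refine Finset.sum_congr rfl fun i _ => ?_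
    rw [mul_comm (K i), ← Finset.add_sum_erase _ _ (Finset.mem_univ i),
      homogeneousComponent_mul_of_isHomogeneous (cofactor_isHomogeneous hF i)]
  rw [← homogeneousComponent_eq_self hf, map_add, h1, LinearMap.range_coprod, add_comm]
  refine Submodule.add_mem_sup h2 ⟨⟨homogeneousComponent n g',
    homogeneousComponent_isHomogeneous _ _⟩, mulX_apply _ _⟩

theorem mem_range_coprod_lineProducts [Fintype ι] (c : ι → Fin r) {a : ι → Fin 3 → k}
    (ha : ∀ i j, i ≠ j → (a i ⨯₃ a j) 0 ≠ 0) {n : ℕ} (hn : Fintype.card ι = n + 1)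
    {f : MvPolynomial (Fin 3) k} (hf : f.IsHomogeneous (n + 1)) :
    f ∈ LinearMap.range ((tangentMap (colourCard c) (lineProducts c a)).coprod (mulX k n)) := by
  classical
  refine mem_range_coprod_of_irrelevantIdeal (lineProducts_isFactorTuple c a)
    (by rw [← card_eq_sum_colourCard, hn]) hf ?_
  have hne : (Finset.univ : Finset ι).Nonempty := Finset.card_pos.mp (by rw [Finset.card_univ]; omega)
  have h1 := irrelevantIdeal_pow_le ha Finset.univ hne
  rw [Finset.card_univ, hn, Nat.add_sub_cancel] at h1
  have h2 : irrelevantIdeal k ^ (n + 1) ≤ irrelevantIdeal k ^ n := Ideal.pow_le_pow_right (by omega)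
  refine (h2.trans (h1.trans ?_)) (homogeneous_mem_irrelevantIdeal_pow hf)
  rw [Ideal.span_le]
  rintro g (hg | ⟨j, -, rfl⟩)
  · exact Ideal.mem_sup_left (Ideal.subset_span hg)
  · exact Ideal.mem_sup_right (prod_erase_mem_cofactorIdeal c a j)

end Witness

end ReducibleCurves

namespace ReducibleCurves

open Matrix

/-! ### Maps with generic coefficients and their specializations -/

section Generic

variable {k : Type*} [Field k] {r : ℕ} {σ : Type*}

/-- Specialization of the coefficients of polynomials. -/
noncomputable def specialize (x : σ → k) :
    MvPolynomial (Fin 3) (MvPolynomial σ k) →ₐ[k] MvPolynomial (Fin 3) k :=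
  mapAlgHom (aeval x)

theorem coeff_specialize (x : σ → k) (f : MvPolynomial (Fin 3) (MvPolynomial σ k))
    (α : Fin 3 →₀ ℕ) : coeff α (specialize x f) = aeval x (coeff α f) := by
  simp [specialize, coeff_map]

/-- The dimension of the kernel of a linear map that depends polynomially on parameters is upper
semicontinuous. -/
theorem exists_finrank_ker_specialize_le {U : Type*} [AddCommGroup U] [Module k U]
    [Module.Finite k U] (B : U →ₗ[k] MvPolynomial (Fin 3) (MvPolynomial σ k)) (x₀ : σ → k) (n : ℕ)
    (hB : ∀ u, (specialize x₀ (B u)).IsHomogeneous n) :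
    ∃ P : MvPolynomial σ k, eval x₀ P ≠ 0 ∧ ∀ x, eval x P ≠ 0 →
      Module.finrank k (LinearMap.ker ((specialize x).toLinearMap ∘ₗ B)) ≤
        Module.finrank k (LinearMap.ker ((specialize x₀).toLinearMap ∘ₗ B)) := by
  -- Only the finitely many coefficients of degree `n` are used. At `x₀` the others vanish by `hB`;
  -- elsewhere ignoring them can only enlarge the kernel, which is harmless for an upper bound.
  let φ : ((Finset.univ : Finset (Fin 3)).finsuppAntidiag n) → U →ₗ[k] MvPolynomial σ k :=
    fun α => (lcoeff (MvPolynomial σ k) (α : Fin 3 →₀ ℕ)).restrictScalars k ∘ₗ B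
  have hφ : ∀ (x : σ → k) (u : U), u ∈ commonKer φ (aeval x) ↔
      ∀ α ∈ (Finset.univ : Finset (Fin 3)).finsuppAntidiag n, coeff α (specialize x (B u)) = 0 := by
    intro x u
    simp only [mem_commonKer, Subtype.forall, coeff_specialize]
    rfl
  have h0 : commonKer φ (aeval x₀) ≤ LinearMap.ker ((specialize x₀).toLinearMap ∘ₗ B) := by
    intro u hu
    rw [hφ] at hu
    change specialize x₀ (B u) = 0
    ext α
    rw [coeff_zero]
    by_cases hα : α.degree = n
    · exact hu α ((mem_finsuppAntidiag_iff_degree n α).mpr hα)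
    · exact (hB u).coeff_eq_zero hα
  obtain ⟨P, hP, hP'⟩ := exists_finrank_commonKer_le φ (aeval x₀) (Submodule.finrank_mono h0)
  refine ⟨P, by simpa [aeval_eq_eval] using hP, fun x hx => ?_⟩
  refine (Submodule.finrank_mono ?_).trans (hP' (aeval x) (by simpa [aeval_eq_eval] using hx))
  intro u hu
  have hu' : specialize x (B u) = 0 := hu
  rw [hφ, hu']
  simp

/-- The generic form of degree `n`, with coefficients the variables `v α`. -/
noncomputable def genericForm (k : Type*) [Field k] (v : (Fin 3 →₀ ℕ) → σ) (n : ℕ) :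
    MvPolynomial (Fin 3) (MvPolynomial σ k) :=
  ∑ α ∈ (Finset.univ : Finset (Fin 3)).finsuppAntidiag n, monomial α (X (v α))

theorem specialize_genericForm (v : (Fin 3 →₀ ℕ) → σ) {n : ℕ} {x : σ → k}
    {f : MvPolynomial (Fin 3) k} (hf : f.IsHomogeneous n) (hx : ∀ α, x (v α) = coeff α f) :
    specialize x (genericForm k v n) = f := by
  ext β
  rw [coeff_specialize, genericForm, coeff_sum, map_sum]
  by_cases hβ : β.degree = n
  · rw [Finset.sum_eq_single β]
    · simp [hx]
    · intro α _ hα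
      simp [coeff_monomial, hα]
    · intro h
      exact absurd ((mem_finsuppAntidiag_iff_degree n β).mpr hβ) h
  · rw [hf.coeff_eq_zero hβ]
    refine Finset.sum_eq_zero fun α hα => ?_
    have : α ≠ β := by
      rintro rfl
      exact hβ ((mem_finsuppAntidiag_iff_degree n α).mp hα)
    simp [coeff_monomial, this]

/-- The map `(H_i) ↦ ∑ (F / F_i) H_i` for forms `F_i` with polynomial coefficients. -/
noncomputable def genericTangentMap (d : Fin r → ℕ)
    (F : Fin r → MvPolynomial (Fin 3) (MvPolynomial σ k)) :
    (∀ i, homogeneousSubmodule (Fin 3) k (d i)) →ₗ[k] MvPolynomial (Fin 3) (MvPolynomial σ k) :=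
  ∑ i, LinearMap.mulLeft k (∏ j ∈ Finset.univ.erase i, F j) ∘ₗ
    (mapAlgHom (Algebra.ofId k (MvPolynomial σ k))).toLinearMap ∘ₗ Submodule.subtype _ ∘ₗ
      LinearMap.proj i

theorem specialize_mapAlgHom (x : σ → k) (f : MvPolynomial (Fin 3) k) :
    specialize x (mapAlgHom (Algebra.ofId k (MvPolynomial σ k)) f) = f := by
  ext α
  rw [coeff_specialize]
  simp [coeff_map]

theorem specialize_genericTangentMap (d : Fin r → ℕ) (x : σ → k)
    {F : Fin r → MvPolynomial (Fin 3) (MvPolynomial σ k)} {F₀ : Fin r → MvPolynomial (Fin 3) k}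
    (hF : ∀ i, specialize x (F i) = F₀ i) :
    (specialize x).toLinearMap ∘ₗ genericTangentMap d F = tangentMap d F₀ := by
  refine LinearMap.ext fun h => ?_
  rw [tangentMap_apply]
  simp only [genericTangentMap, LinearMap.comp_apply, LinearMap.sum_apply, map_sum,
    AlgHom.toLinearMap_apply, LinearMap.mulLeft_apply, map_mul, specialize_mapAlgHom, map_prod, hF]
  rfl

/-- Multiplication by `x₀`, into the polynomials with polynomial coefficients. -/
noncomputable def genericMulX (k : Type*) [Field k] (σ : Type*) (n : ℕ) :
    homogeneousSubmodule (Fin 3) k n →ₗ[k] MvPolynomial (Fin 3) (MvPolynomial σ k) :=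
  (mapAlgHom (Algebra.ofId k (MvPolynomial σ k))).toLinearMap ∘ₗ mulX k n

theorem specialize_genericMulX (n : ℕ) (x : σ → k) :
    (specialize x).toLinearMap ∘ₗ genericMulX k σ n = mulX k n := by
  refine LinearMap.ext fun h => ?_
  exact specialize_mapAlgHom x _

theorem specialize_coprod {U V : Type*} [AddCommGroup U] [Module k U] [AddCommGroup V] [Module k V]
    (x : σ → k) (f : U →ₗ[k] MvPolynomial (Fin 3) (MvPolynomial σ k))
    (g : V →ₗ[k] MvPolynomial (Fin 3) (MvPolynomial σ k)) :
    (specialize x).toLinearMap ∘ₗ f.coprod g =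
      ((specialize x).toLinearMap ∘ₗ f).coprod ((specialize x).toLinearMap ∘ₗ g) :=
  LinearMap.comp_coprod _ _ _

end Generic

/-! ### From the special pair to the general pair -/

section General

variable {k : Type*} [Field k] {r : ℕ}

/-- The coordinates on the space of pairs of tuples of forms. -/
abbrev PairCoord (r : ℕ) := (Fin r × (Fin 3 →₀ ℕ)) ⊕ (Fin r × (Fin 3 →₀ ℕ))

/-- Each of the five kernel dimensions is upper semicontinuous in the coefficients; the open set is
given by the product of the five polynomials, which is nonzero at the witness. -/
theorem ForGeneralPair.of_witness {d : Fin r → ℕ} {F₀ G₀ : Fin r → MvPolynomial (Fin 3) k}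
    (hF₀ : IsFactorTuple d F₀) (hG₀ : IsFactorTuple d G₀) {n : ℕ} (hn : ∑ i, d i = n + 1)
    {Q : (Fin r → MvPolynomial (Fin 3) k) → (Fin r → MvPolynomial (Fin 3) k) → Prop}
    (hQ : ∀ F G, IsFactorTuple d F → IsFactorTuple d G →
      Module.finrank k (LinearMap.ker (tangentMap d F)) ≤
        Module.finrank k (LinearMap.ker (tangentMap d F₀)) →
      Module.finrank k (LinearMap.ker (tangentMap d G)) ≤
        Module.finrank k (LinearMap.ker (tangentMap d G₀)) →
      Module.finrank k (LinearMap.ker ((tangentMap d F).coprod (tangentMap d G))) ≤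
        Module.finrank k (LinearMap.ker ((tangentMap d F₀).coprod (tangentMap d G₀))) →
      Module.finrank k (LinearMap.ker ((tangentMap d F).coprod (mulX k n))) ≤
        Module.finrank k (LinearMap.ker ((tangentMap d F₀).coprod (mulX k n))) →
      Module.finrank k (LinearMap.ker ((tangentMap d G).coprod (mulX k n))) ≤
        Module.finrank k (LinearMap.ker ((tangentMap d G₀).coprod (mulX k n))) → Q F G) :
    ForGeneralPair k d Q := by
  let gF : Fin r → MvPolynomial (Fin 3) (MvPolynomial (PairCoord r) k) :=
    fun i => genericForm k (fun α => Sum.inl (i, α)) (d i)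
  let gG : Fin r → MvPolynomial (Fin 3) (MvPolynomial (PairCoord r) k) :=
    fun i => genericForm k (fun α => Sum.inr (i, α)) (d i)
  have sF : ∀ {F G : Fin r → MvPolynomial (Fin 3) k}, IsFactorTuple d F →
      (specialize (coeffs F G)).toLinearMap ∘ₗ genericTangentMap d gF = tangentMap d F :=
    fun hF => specialize_genericTangentMap d _ fun i => specialize_genericForm _ (hF i) fun _ => rfl
  have sG : ∀ {F G : Fin r → MvPolynomial (Fin 3) k}, IsFactorTuple d G →
      (specialize (coeffs F G)).toLinearMap ∘ₗ genericTangentMap d gG = tangentMap d G :=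
    fun hG => specialize_genericTangentMap d _ fun i => specialize_genericForm _ (hG i) fun _ => rfl
  have hX : ∀ g : homogeneousSubmodule (Fin 3) k n, (mulX k n g).IsHomogeneous (n + 1) := by
    intro g
    rw [mulX_apply, add_comm]
    exact (isHomogeneous_X k 0).mul g.2
  have tF := tangentMap_isHomogeneous hF₀
  have tG := tangentMap_isHomogeneous hG₀
  rw [hn] at tF tG
  obtain ⟨P₁, h₁, h₁'⟩ := exists_finrank_ker_specialize_le (genericTangentMap d gF)
    (coeffs F₀ G₀) (n + 1) (fun u => by
      have := tF u
      rwa [← sF (G := G₀) hF₀] at this)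
  obtain ⟨P₂, h₂, h₂'⟩ := exists_finrank_ker_specialize_le (genericTangentMap d gG)
    (coeffs F₀ G₀) (n + 1) (fun u => by
      have := tG u
      rwa [← sG (F := F₀) hG₀] at this)
  obtain ⟨P₃, h₃, h₃'⟩ := exists_finrank_ker_specialize_le
    ((genericTangentMap d gF).coprod (genericTangentMap d gG)) (coeffs F₀ G₀) (n + 1) (fun u => by
      change (((specialize (coeffs F₀ G₀)).toLinearMap ∘ₗ
        (genericTangentMap d gF).coprod (genericTangentMap d gG)) u).IsHomogeneous _
      rw [specialize_coprod, sF hF₀, sG hG₀, LinearMap.coprod_apply]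
      exact (tF _).add (tG _))
  obtain ⟨P₄, h₄, h₄'⟩ := exists_finrank_ker_specialize_le
    ((genericTangentMap d gF).coprod (genericMulX k _ n)) (coeffs F₀ G₀) (n + 1) (fun u => by
      change (((specialize (coeffs F₀ G₀)).toLinearMap ∘ₗ
        (genericTangentMap d gF).coprod (genericMulX k _ n)) u).IsHomogeneous _
      rw [specialize_coprod, sF hF₀, specialize_genericMulX, LinearMap.coprod_apply]
      exact (tF _).add (hX _))
  obtain ⟨P₅, h₅, h₅'⟩ := exists_finrank_ker_specialize_le
    ((genericTangentMap d gG).coprod (genericMulX k _ n)) (coeffs F₀ G₀) (n + 1) (fun u => by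
      change (((specialize (coeffs F₀ G₀)).toLinearMap ∘ₗ
        (genericTangentMap d gG).coprod (genericMulX k _ n)) u).IsHomogeneous _
      rw [specialize_coprod, sG hG₀, specialize_genericMulX, LinearMap.coprod_apply]
      exact (tG _).add (hX _))
  refine ⟨P₁ * P₂ * P₃ * P₄ * P₅, ⟨F₀, G₀, hF₀, hG₀, ?_⟩, fun F G hF hG hP => ?_⟩
  · simp only [map_mul]
    exact mul_ne_zero (mul_ne_zero (mul_ne_zero (mul_ne_zero h₁ h₂) h₃) h₄) h₅
  · simp only [map_mul, mul_ne_zero_iff] at hP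
    obtain ⟨⟨⟨⟨p₁, p₂⟩, p₃⟩, p₄⟩, p₅⟩ := hP
    have q₁ := h₁' _ p₁
    have q₂ := h₂' _ p₂
    have q₃ := h₃' _ p₃
    have q₄ := h₄' _ p₄
    have q₅ := h₅' _ p₅
    rw [sF hF, sF hF₀] at q₁
    rw [sG hG, sG hG₀] at q₂
    rw [specialize_coprod, specialize_coprod, sF hF, sF hF₀, sG hG, sG hG₀] at q₃
    rw [specialize_coprod, specialize_coprod, sF hF, sF hF₀, specialize_genericMulX,
      specialize_genericMulX] at q₄
    rw [specialize_coprod, specialize_coprod, sG hG, sG hG₀, specialize_genericMulX,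
      specialize_genericMulX] at q₅
    exact hQ F G hF hG q₁ q₂ q₃ q₄ q₅

theorem range_coprod_le {d : Fin r → ℕ} {F : Fin r → MvPolynomial (Fin 3) k}
    (hF : IsFactorTuple d F) {n : ℕ} (hn : ∑ i, d i = n + 1) :
    LinearMap.range ((tangentMap d F).coprod (mulX k n)) ≤
      homogeneousSubmodule (Fin 3) k (n + 1) := by
  rintro _ ⟨⟨h, g⟩, rfl⟩
  rw [LinearMap.coprod_apply, mulX_apply]
  refine Submodule.add_mem _ ?_ ?_
  · have := tangentMap_isHomogeneous hF h
    rwa [hn] at this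
  · have := (isHomogeneous_X k (0 : Fin 3)).mul g.2
    rwa [add_comm] at this

/-- A kernel no larger than at the witness means an image no smaller, hence all forms of degree `n +
1`. -/
theorem X_pow_mem_range_coprod {d : Fin r → ℕ} {F F₀ : Fin r → MvPolynomial (Fin 3) k}
    (hF : IsFactorTuple d F) {n : ℕ} (hn : ∑ i, d i = n + 1)
    (h₀ : ∀ f : MvPolynomial (Fin 3) k, f.IsHomogeneous (n + 1) →
      f ∈ LinearMap.range ((tangentMap d F₀).coprod (mulX k n)))
    (hker : Module.finrank k (LinearMap.ker ((tangentMap d F).coprod (mulX k n))) ≤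
      Module.finrank k (LinearMap.ker ((tangentMap d F₀).coprod (mulX k n)))) (i : Fin 3) :
    X i ^ (n + 1) ∈ LinearMap.range ((tangentMap d F).coprod (mulX k n)) := by
  have e1 := LinearMap.finrank_range_add_finrank_ker ((tangentMap d F).coprod (mulX k n))
  have e2 := LinearMap.finrank_range_add_finrank_ker ((tangentMap d F₀).coprod (mulX k n))
  have e3 : homogeneousSubmodule (Fin 3) k (n + 1) ≤
      LinearMap.range ((tangentMap d F₀).coprod (mulX k n)) := fun f hf => h₀ f hf
  have e4 := Submodule.finrank_mono e3
  have e5 := Submodule.eq_of_le_of_finrank_le (range_coprod_le hF hn) (by omega)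
  rw [e5]
  exact isHomogeneous_X_pow i (n + 1)

theorem ne_zero_of_setZero_ne_zero {f : MvPolynomial (Fin 3) k} (h : setZero k f ≠ 0) : f ≠ 0 := by
  rintro rfl
  exact h (map_zero _)

theorem finrank_sup_range_tangentMap (d : Fin r → ℕ) (F G : Fin r → MvPolynomial (Fin 3) k) :
    Module.finrank k (LinearMap.range (tangentMap d F) ⊔ LinearMap.range (tangentMap d G) :
        Submodule k (MvPolynomial (Fin 3) k)) +
      Module.finrank k (LinearMap.ker ((tangentMap d F).coprod (tangentMap d G))) =
    ∑ i, (d i + 2).choose 2 + ∑ i, (d i + 2).choose 2 := by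
  rw [← LinearMap.range_coprod, LinearMap.finrank_range_add_finrank_ker, Module.finrank_prod,
    Module.finrank_pi_fintype]
  simp only [finrank_homogeneousSubmodule]

theorem finrank_sup_range_tangentMap_le {d : Fin r → ℕ} {F G : Fin r → MvPolynomial (Fin 3) k}
    (hF : IsFactorTuple d F) (hG : IsFactorTuple d G) :
    Module.finrank k (LinearMap.range (tangentMap d F) ⊔ LinearMap.range (tangentMap d G) :
      Submodule k (MvPolynomial (Fin 3) k)) ≤ (∑ i, d i + 2).choose 2 := by
  rw [← finrank_homogeneousSubmodule (k := k)]
  refine Submodule.finrank_mono (sup_le ?_ ?_)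
  · rintro _ ⟨h, rfl⟩
    exact tangentMap_isHomogeneous hF h
  · rintro _ ⟨h, rfl⟩
    exact tangentMap_isHomogeneous hG h

theorem degreePart_unionIdeal (hr : 2 ≤ r) {d : Fin r → ℕ} (hpos : ∀ i, 1 ≤ d i)
    {F G : Fin r → MvPolynomial (Fin 3) k} (hF : IsFactorTuple d F) (hG : IsFactorTuple d G)
    {n : ℕ} (hCF : ∀ i, X i ^ (n + 1) ∈ LinearMap.range ((tangentMap d F).coprod (mulX k n)))
    (hCG : ∀ i, X i ^ (n + 1) ∈ LinearMap.range ((tangentMap d G).coprod (mulX k n))) :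
    degreePart (unionIdeal F G) (∑ i, d i) =
      LinearMap.range (tangentMap d F) ⊓ LinearMap.range (tangentMap d G) := by
  rw [unionIdeal, saturation_cofactorIdeal hr hpos hF hCF, saturation_cofactorIdeal hr hpos hG hCG,
    ← degreePart_cofactorIdeal hF, ← degreePart_cofactorIdeal hG]
  ext f
  simp only [degreePart, Submodule.mem_inf, Submodule.restrictScalars_mem]
  tauto

/-- If the kernels of the maps `(H_i) ↦ ∑ (F / F_i) H_i` for `F₀` and `G₀` have the smallest
possible dimension, then the intersection of the images has its smallest dimension there. -/
theorem finrank_inf_range_tangentMap_le {d : Fin r → ℕ}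
    {F G F₀ G₀ : Fin r → MvPolynomial (Fin 3) k}
    (hkF : Module.finrank k (LinearMap.ker (tangentMap d F₀)) ≤
      Module.finrank k (LinearMap.ker (tangentMap d F)))
    (hkG : Module.finrank k (LinearMap.ker (tangentMap d G₀)) ≤
      Module.finrank k (LinearMap.ker (tangentMap d G)))
    (h : Module.finrank k (LinearMap.ker ((tangentMap d F).coprod (tangentMap d G))) ≤
      Module.finrank k (LinearMap.ker ((tangentMap d F₀).coprod (tangentMap d G₀)))) :
    Module.finrank k (LinearMap.range (tangentMap d F) ⊓ LinearMap.range (tangentMap d G) :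
        Submodule k (MvPolynomial (Fin 3) k)) ≤
      Module.finrank k (LinearMap.range (tangentMap d F₀) ⊓ LinearMap.range (tangentMap d G₀) :
        Submodule k (MvPolynomial (Fin 3) k)) := by
  -- By rank-nullity the intersection has the dimension of the kernel of the `coprod` minus those of
  -- the two single kernels.
  have rF := finrank_range_tangentMap d F
  have rG := finrank_range_tangentMap d G
  have rF₀ := finrank_range_tangentMap d F₀
  have rG₀ := finrank_range_tangentMap d G₀
  have s := finrank_sup_range_tangentMap d F G
  have s₀ := finrank_sup_range_tangentMap d F₀ G₀
  have i := Submodule.finrank_sup_add_finrank_inf_eq (LinearMap.range (tangentMap d F))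
    (LinearMap.range (tangentMap d G))
  have i₀ := Submodule.finrank_sup_add_finrank_inf_eq (LinearMap.range (tangentMap d F₀))
    (LinearMap.range (tangentMap d G₀))
  omega

/-- Two subspaces of codimension at most `D` in `R_d` meet in codimension at most `2 D`. -/
theorem virtualDim_le_finrank_inf {d : Fin r → ℕ} {F G : Fin r → MvPolynomial (Fin 3) k}
    (hF : IsFactorTuple d F) (hG : IsFactorTuple d G)
    (hkF : Module.finrank k (LinearMap.ker (tangentMap d F)) + 1 ≤ r)
    (hkG : Module.finrank k (LinearMap.ker (tangentMap d G)) + 1 ≤ r) :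
    virtualDim d ≤ Module.finrank k (LinearMap.range (tangentMap d F) ⊓
      LinearMap.range (tangentMap d G) : Submodule k (MvPolynomial (Fin 3) k)) := by
  have rF := finrank_range_tangentMap d F
  have rG := finrank_range_tangentMap d G
  have i := Submodule.finrank_sup_add_finrank_inf_eq (LinearMap.range (tangentMap d F))
    (LinearMap.range (tangentMap d G))
  have hle := finrank_sup_range_tangentMap_le hF hG
  have hnum := sum_choose_add_pairSum d
  rw [virtualDim]
  omega

theorem forGeneralPair_of_typeBound [Infinite k] (hr : 2 ≤ r) {d : Fin r → ℕ}
    (hpos : ∀ i, 1 ≤ d i) {m : ℕ} (h : TypeBound k d m) :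
    ForGeneralPair k d fun F G =>
      Module.finrank k (degreePart (unionIdeal F G) (∑ i, d i)) ≤ m ∧
      virtualDim d ≤ Module.finrank k (degreePart (unionIdeal F G) (∑ i, d i)) := by
  obtain ⟨ι, _, c, hc, hb⟩ := h
  obtain rfl : colourCard c = d := funext hc
  obtain ⟨a, b, hab, hx⟩ := hb.exists_generalPosition
  have hsum := card_eq_sum_colourCard c
  have hpos' : 2 ≤ Fintype.card ι := by
    rw [hsum]
    calc 2 ≤ r := hr
      _ = ∑ _i : Fin r, 1 := by simp
      _ ≤ _ := Finset.sum_le_sum fun i _ => hpos i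
  obtain ⟨n, hn⟩ : ∃ n, Fintype.card ι = n + 1 := ⟨Fintype.card ι - 1, by omega⟩
  have hn' : ∑ i, colourCard c i = n + 1 := by rw [← hsum, hn]
  have ha0 : ∀ i j, i ≠ j → (a i ⨯₃ a j) 0 ≠ 0 := fun i j hij =>
    hx.cross_zero (u := Sum.inl i) (v := Sum.inl j) (by simpa using hij)
  have hb0 : ∀ i j, i ≠ j → (b i ⨯₃ b j) 0 ≠ 0 := fun i j hij =>
    hx.cross_zero (u := Sum.inr i) (v := Sum.inr j) (by simpa using hij)
  have ne_zero : ∀ {a : ι → Fin 3 → k}, (∀ i j, i ≠ j → (a i ⨯₃ a j) 0 ≠ 0) → ∀ j, a j ≠ 0 := by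
    intro a ha j hj
    obtain ⟨i, hi⟩ := Fintype.exists_ne_of_one_lt_card (by omega) j
    apply ha i j hi
    rw [hj]
    simp
  have cross_ne : ∀ {a : ι → Fin 3 → k}, (∀ i j, i ≠ j → (a i ⨯₃ a j) 0 ≠ 0) →
      ∀ i j, i ≠ j → a i ⨯₃ a j ≠ 0 := by
    intro a ha i j hij h
    apply ha i j hij
    rw [h]
    rfl
  have hF₀ := lineProducts_isFactorTuple c a
  have hG₀ := lineProducts_isFactorTuple c b
  have kF₀ := finrank_ker_tangentMap_le (by omega) hF₀ (lineProducts_ne_zero c (ne_zero ha0))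
    fun i j hij => isRelPrime_lineProducts c (cross_ne ha0) hij
  have kG₀ := finrank_ker_tangentMap_le (by omega) hG₀ (lineProducts_ne_zero c (ne_zero hb0))
    fun i j hij => isRelPrime_lineProducts c (cross_ne hb0) hij
  have hinf₀ : Module.finrank k (LinearMap.range (tangentMap (colourCard c) (lineProducts c a)) ⊓
      LinearMap.range (tangentMap (colourCard c) (lineProducts c b)) :
        Submodule k (MvPolynomial (Fin 3) k)) ≤ m := by
    refine le_trans (Submodule.finrank_mono ?_) ((Submodule.finrank_map_le
      (homogeneousSubmodule (Fin 3) k (Fintype.card ι)).subtype _).trans hab)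
    rintro f ⟨hf, hf'⟩
    have hfh : f.IsHomogeneous (Fintype.card ι) := by
      obtain ⟨h, rfl⟩ := hf
      rw [hsum]
      exact tangentMap_isHomogeneous hF₀ h
    refine ⟨⟨f, hfh⟩, ?_, rfl⟩
    rintro p (hp | hp)
    · exact eval_tangentMap_lineProducts c a hf hp
    · exact eval_tangentMap_lineProducts c b hf' hp
  refine ForGeneralPair.of_witness hF₀ hG₀ hn' fun F G hF hG h1 h2 h3 h4 h5 => ?_
  have hCF := X_pow_mem_range_coprod hF hn'
    (fun f hf => mem_range_coprod_lineProducts c ha0 hn hf) h4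
  have hCG := X_pow_mem_range_coprod hG hn'
    (fun f hf => mem_range_coprod_lineProducts c hb0 hn hf) h5
  -- With `h1`, `h2` and the bounds at the witness, the kernels for `F` and `G` have dimension
  -- exactly `r - 1`, so both dimension estimates for the intersection apply.
  have kF := le_finrank_ker_tangentMap (by omega) hF
    fun i => ne_zero_of_setZero_ne_zero (setZero_ne_zero hr hpos hF hCF i)
  have kG := le_finrank_ker_tangentMap (by omega) hG
    fun i => ne_zero_of_setZero_ne_zero (setZero_ne_zero hr hpos hG hCG i)
  rw [degreePart_unionIdeal hr hpos hF hG hCF hCG]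
  refine ⟨(finrank_inf_range_tangentMap_le (by omega) (by omega) h3).trans hinf₀, ?_⟩
  exact virtualDim_le_finrank_inf hF hG (by omega) (by omega)

end General

end ReducibleCurves

theorem proposition4p7 (k : Type*) [Field k] [IsAlgClosed k] (r : ℕ) (hr : 2 ≤ r)
    (d : Fin r → ℕ) (hanti : Antitone d) (hpos : ∀ i, 1 ≤ d i)
    (hlt : d ⟨0, by omega⟩ < ∑ i ∈ Finset.univ.erase (⟨0, by omega⟩ : Fin r), d i) :
    ReducibleCurves.ForGeneralPair k d (fun F G =>
      (Module.finrank k (ReducibleCurves.degreePart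
          (ReducibleCurves.unionIdeal F G) (∑ i, d i)) : ℤ) = ReducibleCurves.expDim d ∧
      (ReducibleCurves.degreePart (ReducibleCurves.unionIdeal F G) (∑ i, d i) = ⊥ ↔
        ReducibleCurves.Dominates d [4, 3, 3] ∨
        ReducibleCurves.Dominates d [6, 6, 2] ∨
        ReducibleCurves.Dominates d [4, 4, 1, 1] ∨
        ReducibleCurves.Dominates d [2, 2, 2, 1] ∨
        ReducibleCurves.Dominates d [2, 1, 1, 1, 1] ∨
        (6 ≤ r ∧ ReducibleCurves.Dominates d (List.replicate r 1)))) := by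
  have := IsAlgClosed.instInfinite (K := k)
  have hfin : ∀ I : Ideal (MvPolynomial (Fin 3) k),
      Module.Finite k (ReducibleCurves.degreePart I (∑ i, d i)) := fun I =>
    Submodule.finiteDimensional_of_le
      (inf_le_right : ReducibleCurves.degreePart I (∑ i, d i) ≤ _)
  have hbot : ∀ I : Ideal (MvPolynomial (Fin 3) k),
      ReducibleCurves.degreePart I (∑ i, d i) = ⊥ ↔
        Module.finrank k (ReducibleCurves.degreePart I (∑ i, d i)) = 0 := fun I =>
    Submodule.finrank_eq_zero.symm
  have hexp : ReducibleCurves.expDim d = max (ReducibleCurves.virtualDim d) 0 := rfl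
  rcases ReducibleCurves.outcome k r hr d hanti hpos _ (fun _ => Nat.zero_le _) hlt with
    ⟨ht, hd⟩ | ⟨m, hm, ht, hv, hd⟩
  · obtain ⟨P, hP, hQ⟩ := ReducibleCurves.forGeneralPair_of_typeBound hr hpos ht
    refine ⟨P, hP, fun F G hF hG hFG => ?_⟩
    obtain ⟨h1, h2⟩ := hQ F G hF hG hFG
    refine ⟨?_, ?_⟩
    · rw [hexp]
      -- The virtual dimension is at most the dimension, which is zero.
      omega
    · rw [hbot]
      exact ⟨fun _ => hd, fun _ => by omega⟩
  · obtain ⟨P, hP, hQ⟩ := ReducibleCurves.forGeneralPair_of_typeBound hr hpos ht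
    refine ⟨P, hP, fun F G hF hG hFG => ?_⟩
    obtain ⟨h1, h2⟩ := hQ F G hF hG hFG
    refine ⟨?_, ?_⟩
    · rw [hexp]
      -- The dimension is squeezed between the virtual dimension and `m`, which agree and are
      -- positive.
      omega
    · rw [hbot]
      exact ⟨fun h => by omega, fun h => absurd h hd⟩
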